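/- Let $n\ge 0$ be an integer and let $0<h<1$ be a parameter. All symbols are families $a=a(z,h)$ of complex-valued $C^\infty$ functions of $z=(x,\xi)\in\mathbb R^{2n}$, indexed by $h\in(0,1)$. For an integer $k\ge 0$, $a\in S_{(k)}$ means that for every multi-index $\alpha$ with $|\alpha|\ge k$ there is $C_\alpha$, independent of $h$, with $|\partial_z^\alpha a(z,h)|\le C_\alpha$ for all $z$. For $0\le\rho<1$, $a\in S^{L^2}_\rho$ means that for every multi-index $\alpha$ there is $C_\alpha$, independent of $h$, with $$h^{-\frac n2}\,\|\partial_z^\alpha a(\cdot,h)\|_{L^2(\mathbb R^{2n})}\le C_\alpha h^{-\rho|\alpha|},$$ and $a\in h^sS^{L^2}_\rho$ means $h^{-s}a\in S^{L^2}_\rho$. The Weyl quantization is $$\mathrm{Op}(a)u(x)=\frac1{(2\pi h)^n}\iint a\Big(\frac{x+y}2,\xi\Big)e^{\frac ih\langle x-y,\xi\rangle}u(y)\,dy\,d\xi,\qquad u\in\mathscr S(\mathbb R^n),$$ understood as an iterated integral, first in $y$ and then in $\xi$. Write $D=\frac1i\partial$ and $$\sigma(D_x,D_\xi,D_y,D_\eta)=\langle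 D_x,D_\eta\rangle-\langle D_\xi,D_y\rangle .$$ **Lemma.** Let $0\le\rho<1$, $k\ge 0$, $a\in S_{(k)}$ and $b\in S^{L^2}_\rho$. Then there is a family $c=c(z,h)$, smooth in $z$, such that for every $h\in(0,1)$ the integrals defining $\mathrm{Op}(a)u$, $\mathrm{Op}(b)u$ and $\mathrm{Op}(c)u$ converge for all $u\in\mathscr S(\mathbb R^n)$ and define continuous linear operators $\mathscr S(\mathbb R^n)\to\mathscr S(\mathbb R^n)$ with $$\mathrm{Op}(a)\,\mathrm{Op}(b)=\mathrm{Op}(c),$$ and such that, for every integer $N\ge k$, $$c(x,\xi)-\sum_{j=0}^{N-1}\frac1{j!}\Big(\frac h{2i}\,\sigma(D_x,D_\xi,D_y,D_\eta)\Big)^j a(x,\xi)\,b(y,\eta)\Big|_{y=x,\ \eta=\xi}\ \in\ h^{N(1-\rho)}S^{L^2}_\rho .$$ -/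

import Mathlib

open MeasureTheory
open scoped ContDiff SchwartzMap ENNReal

noncomputable section

namespace WeylL2

/-- Configuration space `ℝⁿ` with its Euclidean structure. -/
abbrev Pos (n : ℕ) : Type := EuclideanSpace ℝ (Fin n)

/-- Phase space `ℝ²ⁿ = ℝⁿ × ℝⁿ`, with points `z = (x, ξ)`. -/
abbrev Phase (n : ℕ) : Type := Pos n × Pos n

/-- An `h`-dependent family of functions `z ↦ a h z` on phase space. Only the values for
`0 < h < 1` are ever used. -/
abbrev SymbolFamily (n : ℕ) : Type := ℝ → Phase n → ℂ

/-- The class `S_(k)`: smooth families all of whose derivatives of order at least `k` are bounded,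
uniformly in `z` and in `0 < h < 1`. The norm of the `m`-th Fréchet derivative at a point controls
and is controlled by the partial derivatives `∂^α` with `|α| = m`, up to constants that depend
only on `m` and `n`. -/
def MemSk {n : ℕ} (k : ℕ) (a : SymbolFamily n) : Prop :=
  (∀ h : ℝ, 0 < h → h < 1 → ContDiff ℝ ∞ (a h)) ∧
  ∀ m : ℕ, k ≤ m → ∃ C : ℝ, ∀ h : ℝ, 0 < h → h < 1 → ∀ z : Phase n,
    ‖iteratedFDeriv ℝ m (a h) z‖ ≤ C

/-- The class `S^{L²}_ρ`: smooth families with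
`h^{-n/2} ‖∂^α a‖_{L²(ℝ²ⁿ)} ≤ C_α h^{-ρ|α|}` for every multi-index `α`, where `C_α` does not
depend on `0 < h < 1`. All derivatives of order `m = |α|` are treated at once, through the norm
of the `m`-th Fréchet derivative. -/
def MemSL2 {n : ℕ} (ρ : ℝ) (a : SymbolFamily n) : Prop :=
  (∀ h : ℝ, 0 < h → h < 1 → ContDiff ℝ ∞ (a h)) ∧
  ∀ m : ℕ, ∃ C : ℝ, ∀ h : ℝ, 0 < h → h < 1 →
    ENNReal.ofReal (h ^ (-(n : ℝ) / 2)) *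
        eLpNorm (fun z : Phase n => iteratedFDeriv ℝ m (a h) z) 2 volume
      ≤ ENNReal.ofReal (C * h ^ (-(ρ * m)))

/-- The class `h^s S^{L²}_ρ`. -/
def MemPowSL2 {n : ℕ} (s ρ : ℝ) (a : SymbolFamily n) : Prop :=
  MemSL2 ρ (fun h z => ((h ^ (-s) : ℝ) : ℂ) * a h z)

/-- The integrand of the Weyl quantization, `a((x+y)/2, ξ) e^{(i/h)⟨x-y, ξ⟩} u(y)`. -/
def weylIntegrand {n : ℕ} (h : ℝ) (a : Phase n → ℂ) (u : Pos n → ℂ) (x ξ y : Pos n) : ℂ :=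
  a ((1 / 2 : ℝ) • (x + y), ξ) *
    Complex.exp (Complex.I / (h : ℂ) * ((inner ℝ (x - y) ξ : ℝ) : ℂ)) * u y

/-- `T = Op(a)` as an operator on Schwartz space, for one value of `h`:
`T u (x) = (2πh)^{-n} ∫ (∫ a((x+y)/2, ξ) e^{(i/h)⟨x-y, ξ⟩} u(y) dy) dξ`.
For symbols of polynomial growth the double integral need not converge absolutely; it is read as
the iterated integral, first in `y` and then in `ξ`, both of which are required to converge
absolutely. For a given `a` there is at most one such `T`. -/
def IsWeylQuantization {n : ℕ} (h : ℝ) (a : Phase n → ℂ)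
    (T : 𝓢(Pos n, ℂ) →L[ℂ] 𝓢(Pos n, ℂ)) : Prop :=
  ∀ (u : 𝓢(Pos n, ℂ)) (x : Pos n),
    (∀ ξ : Pos n, Integrable (fun y : Pos n => weylIntegrand h a u x ξ y)) ∧
    Integrable (fun ξ : Pos n => ∫ y : Pos n, weylIntegrand h a u x ξ y) ∧
    T u x = (1 / (2 * (Real.pi : ℂ) * (h : ℂ)) ^ n) *
      ∫ ξ : Pos n, ∫ y : Pos n, weylIntegrand h a u x ξ y

/-- The operator `D_v = (1/i) ∂_v` on functions of `((x, ξ), (y, η))`. -/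
def dirD {n : ℕ} (v : Phase n × Phase n) (F : Phase n × Phase n → ℂ) :
    Phase n × Phase n → ℂ :=
  fun p => (1 / Complex.I) * fderiv ℝ F p v

/-- The `j`-th standard basis vector of `ℝⁿ`. -/
def basisVec {n : ℕ} (j : Fin n) : Pos n := EuclideanSpace.single j (1 : ℝ)

/-- The operator `σ(D_x, D_ξ, D_y, D_η) = ∑_j (D_{x_j} D_{η_j} - D_{ξ_j} D_{y_j})`, that is, the
symplectic form `σ((x, ξ), (y, η)) = ⟨x, η⟩ - ⟨ξ, y⟩` of `∑_j dx_j ∧ dξ_j` evaluated at `D`.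
With this sign `(h/2i) σ(D) (a ⊗ b)` restricted to the diagonal is
`(h/2i) ∑_j (∂_{ξ_j} a ∂_{x_j} b - ∂_{x_j} a ∂_{ξ_j} b)`. -/
def sigmaD {n : ℕ} (F : Phase n × Phase n → ℂ) : Phase n × Phase n → ℂ :=
  fun p => ∑ j : Fin n,
    (dirD ((basisVec j, 0), (0, 0)) (dirD ((0, 0), (0, basisVec j)) F) p
      - dirD ((0, basisVec j), (0, 0)) (dirD ((0, 0), (basisVec j, 0)) F) p)

/-- The `j`-th term of the composition expansion,
`(1/j!) ((h/2i) σ(D_x, D_ξ, D_y, D_η))^j a(x, ξ) b(y, η)` at `(y, η) = (x, ξ) = z`. -/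
def moyalTerm {n : ℕ} (h : ℝ) (j : ℕ) (a b : Phase n → ℂ) (z : Phase n) : ℂ :=
  (1 / (j.factorial : ℂ)) * ((h : ℂ) / (2 * Complex.I)) ^ j *
    (sigmaD^[j] (fun p : Phase n × Phase n => a p.1 * b p.2)) (z, z)

end WeylL2

end

/-! By the Fourier transform, `b = syn g` is a superposition of characters `exp (2πi ζ·z)` with a
rapidly decreasing density `g` (`exists_syn`). The Weyl quantization of a character is a phase-space
translation `wtr`, and composing Op(a) on the right with it only shifts the symbol: the result has
symbol `a(z + h rot ζ) exp (2πi ζ·z)`. Integration against `g` suggests the exact symbol c = `tw h a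
g`, which involves no truncation and serves every `N` at once.

The operator identity is `quantizable_of_gam`. If `a` decays fast enough, it is itself a
superposition of characters, and the identity reduces to the composition law `wtr_wtr` and Fubini. A
general symbol of finite order is reached by writing `a = f + ∑ z_i (z_i f)` with `f = a / om`, two
orders better, and by tracking how multiplication by `x_j` or `ξ_j` acts on quantizations
(`Quantizable.x_mul`, `Quantizable.xi_mul`). Membership in S_(k) gives finite order through the mean
value inequality.

The expansion is the Taylor formula for `τ ↦ tw τ a g z` on `[0, h]`. Each derivative in `τ`
replaces `a` by a first derivative of `a` and multiplies `g` by a linear function of `ζ`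
(`hasDerivAt_tw`). At `τ = 0` the derivatives are the Moyal terms (`moyalTerm_syn`). The `N`-th one
contains only derivatives of `a` of order at least `N`, which are bounded when `N ≥ k`, and `N`
factors of `ζ`, each costing `h^(-ρ)` in L²; with the Taylor factor `h^N` this is the gain
`h^(N(1-ρ))`.

What remains is an L² bound for `tw τ a g`, uniform in `0 ≤ τ ≤ h`, when all derivatives of `a` are
bounded (`norm_tw_le`, `dominated_tw`). With `w = hζ`, the function `w ↦ a(z + (τ/h) rot w)` is `om
w ^ (2n+1)` times the Fourier synthesis of an integrable density, bounded uniformly in `z` and `τ`.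
Hence `tw τ a g` is dominated by an average of translates of the synthesis of `om (hζ) ^ (2n+1) g
ζ`. Plancherel finishes, because `h|ζ|` costs at most a constant when `ρ ≤ 1`. Derivatives in `z` of
the remainder are remainders of the same kind (`dd_rem`). -/

noncomputable section

namespace WeylL2

/-! ### Directional derivatives and derivative bounds with weights -/

section Directional

variable {E F : Type*} [NormedAddCommGroup E] [NormedSpace ℝ E] [NormedAddCommGroup F]
  [NormedSpace ℝ F]

/-- The directional derivative along `v`. -/
def dd (v : E) (f : E → F) : E → F := fun z => fderiv ℝ f z v

lemma contDiff_dd {f : E → F} (hf : ContDiff ℝ ∞ f) (v : E) : ContDiff ℝ ∞ (dd v f) :=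
  (hf.fderiv_right (m := ∞) (by simp)).clm_apply contDiff_const

lemma norm_iteratedFDeriv_dd_le {f : E → F} (hf : ContDiff ℝ ∞ f) (v : E) (m : ℕ) (z : E) :
    ‖iteratedFDeriv ℝ m (dd v f) z‖ ≤ ‖v‖ * ‖iteratedFDeriv ℝ (m + 1) f z‖ := by
  rw [← norm_iteratedFDeriv_fderiv]
  exact norm_iteratedFDeriv_clm_apply_const
    (hf.fderiv_right (m := ∞) (by simp)).contDiffAt (by exact_mod_cast le_top)

lemma dd_comm {f : E → F} (hf : ContDiff ℝ ∞ f) (v w : E) : dd v (dd w f) = dd w (dd v f) := by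
  have hd : Differentiable ℝ (fderiv ℝ f) :=
    (hf.fderiv_right (m := ∞) (by simp)).differentiable (by simp)
  have key : ∀ v w : E, ∀ z, dd v (dd w f) z = fderiv ℝ (fderiv ℝ f) z v w := by
    intro v w z
    have : HasFDerivAt (dd w f) ((ContinuousLinearMap.apply ℝ F w).comp
        (fderiv ℝ (fderiv ℝ f) z)) z :=
      (ContinuousLinearMap.apply ℝ F w).hasFDerivAt.comp z (hd z).hasFDerivAt
    rw [dd, this.fderiv]
    rfl
  funext z
  rw [key, key]
  exact (hf.contDiffAt.isSymmSndFDerivAt ((minSmoothness_of_isRCLikeNormedField (𝕜 := ℝ)).le.trans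
    (by norm_cast))) v w

variable {ι : Type*} [Fintype ι] {e : ι → E} {φ : ι → E →L[ℝ] ℝ}

/-- The hypothesis says that the functionals `φ i` are coordinates for the vectors `e i`. Stating it
abstractly serves configuration space and phase space alike. -/
lemma fderiv_eq_sum (h : ∀ v, ∑ i, φ i v • e i = v) (f : E → F) (z : E) :
    fderiv ℝ f z = ∑ i, (φ i).smulRight (dd (e i) f z) := by
  ext v
  conv_lhs => rw [← h v]
  simp [dd]

lemma dd_eq_sum (h : ∀ v, ∑ i, φ i v • e i = v) (f : E → F) (v z : E) :
    dd v f z = ∑ i, φ i v • dd (e i) f z := by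
  conv_lhs => rw [dd, fderiv_eq_sum h f z]
  simp

/-- Smoothness of parameter integrals is proved by induction through this lemma: their basis
derivatives are sums of integrals of the same type, so no higher Fréchet derivative has to be
computed. -/
lemma contDiff_succ_of_dd (h : ∀ v, ∑ i, φ i v • e i = v) {f : E → F}
    (hf : Differentiable ℝ f) {m : ℕ} (hd : ∀ i, ContDiff ℝ m (dd (e i) f)) :
    ContDiff ℝ (m + 1 : ℕ) f := by
  push_cast
  rw [contDiff_succ_iff_fderiv]
  refine ⟨hf, by simp, ?_⟩
  rw [funext (fderiv_eq_sum h f)]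
  refine ContDiff.sum fun i _ => ?_
  exact contDiff_const.smulRight (hd i)

lemma norm_iteratedFDeriv_succ_le_sum (h : ∀ v, ∑ i, φ i v • e i = v) {f : E → F}
    (hf : ContDiff ℝ ∞ f) (m : ℕ) (z : E) :
    ‖iteratedFDeriv ℝ (m + 1) f z‖ ≤ ∑ i, ‖φ i‖ * ‖iteratedFDeriv ℝ m (dd (e i) f) z‖ := by
  rw [← norm_iteratedFDeriv_fderiv, funext (fderiv_eq_sum h f)]
  have hs : ∀ i, ContDiff ℝ ∞ (fun z => (φ i).smulRight (dd (e i) f z)) := fun i =>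
    contDiff_const.smulRight (contDiff_dd hf _)
  rw [iteratedFDeriv_sum (fun i _ => (hs i).of_le (by exact_mod_cast le_top)), Finset.sum_apply]
  refine (norm_sum_le _ _).trans (Finset.sum_le_sum fun i _ => ?_)
  have := ContinuousLinearMap.norm_iteratedFDeriv_comp_left
    (ContinuousLinearMap.smulRightL ℝ E F (φ i)) (f := dd (e i) f) (x := z) (N := ∞) (n := m)
    (contDiff_dd hf _).contDiffAt (by exact_mod_cast le_top)
  refine this.trans (mul_le_mul_of_nonneg_right ?_ (norm_nonneg _))
  refine ContinuousLinearMap.opNorm_le_bound _ (norm_nonneg _) fun x => ?_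
  simp [ContinuousLinearMap.norm_smulRight_apply]

/-- The `m`-th derivative of `f` is bounded by a multiple of the weight `w`. -/
def DerivBound (m : ℕ) (w : E → ℝ) (f : E → F) : Prop :=
  ∃ C : ℝ, 0 ≤ C ∧ ∀ z, ‖iteratedFDeriv ℝ m f z‖ ≤ C * w z

lemma DerivBound.smul {G : Type*} [NormedAddCommGroup G] [NormedSpace ℝ G] {f : E → ℝ}
    {g : E → G} {w w' : E → ℝ} (hf : ContDiff ℝ ∞ f)
    (hg : ContDiff ℝ ∞ g) {m : ℕ}
    (h1 : ∀ j ≤ m, DerivBound j w f) (h2 : ∀ j ≤ m, DerivBound j w' g) :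
    DerivBound m (fun z => w z * w' z) (fun z => f z • g z) := by
  choose! C hC0 hC using h1
  choose! D hD0 hD using h2
  refine ⟨∑ i ∈ Finset.range (m + 1), (m.choose i : ℝ) * C i * D (m - i),
    Finset.sum_nonneg fun i hi => ?_, fun z => ?_⟩
  · have : i ≤ m := by simpa [Nat.lt_succ_iff] using hi
    have := hC0 i this
    have := hD0 (m - i) (by omega)
    positivity
  refine (norm_iteratedFDeriv_smul_le hf hg z (n := m) (by exact_mod_cast le_top)).trans ?_
  rw [Finset.sum_mul]
  refine Finset.sum_le_sum fun i hi => ?_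
  have hi : i ≤ m := by simpa [Nat.lt_succ_iff] using hi
  calc _ ≤ (m.choose i : ℝ) * (C i * w z) * (D (m - i) * w' z) := by
        have h1 := hC i hi z
        have h2 := hD (m - i) (by omega) z
        have := (norm_nonneg _).trans h1
        gcongr
    _ = _ := by ring

lemma DerivBound.of_fderiv {m : ℕ} {w : E → ℝ} {f : E → F} (h : DerivBound m w (_root_.fderiv ℝ f)) :
    DerivBound (m + 1) w f := by
  obtain ⟨C, hC0, hC⟩ := h
  exact ⟨C, hC0, fun z => by rw [← norm_iteratedFDeriv_fderiv]; exact hC z⟩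

lemma DerivBound.mono {m : ℕ} {w w' : E → ℝ} {f : E → F} (h : DerivBound m w f)
    (hw : ∀ z, w z ≤ w' z) : DerivBound m w' f := by
  obtain ⟨C, hC0, hC⟩ := h
  exact ⟨C, hC0, fun z => (hC z).trans (mul_le_mul_of_nonneg_left (hw z) hC0)⟩

end Directional

/-! ### Coordinates, the weight `om` and symbols of finite order -/

section PhaseCoordinates

variable {n : ℕ}

/-- The standard basis of phase space. -/
def pb : Fin n ⊕ Fin n → Phase n := Sum.elim (fun j => (basisVec j, 0)) (fun j => (0, basisVec j))

/-- The coordinates on phase space. -/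
def pc : Fin n ⊕ Fin n → Phase n →L[ℝ] ℝ :=
  Sum.elim (fun j => (EuclideanSpace.proj j).comp (ContinuousLinearMap.fst ℝ _ _))
    (fun j => (EuclideanSpace.proj j).comp (ContinuousLinearMap.snd ℝ _ _))

@[simp] lemma pc_inl (j : Fin n) (z : Phase n) : pc (Sum.inl j) z = z.1 j := rfl
@[simp] lemma pc_inr (j : Fin n) (z : Phase n) : pc (Sum.inr j) z = z.2 j := rfl

lemma pos_sum (v : Pos n) : ∑ j, (EuclideanSpace.proj j : Pos n →L[ℝ] ℝ) v • basisVec j = v := by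
  ext i
  simp [basisVec, Finset.sum_apply, Pi.single_apply]

lemma phase_sum (v : Phase n) : ∑ i, pc i v • pb i = v := by
  rw [Fintype.sum_sum_type]
  simp only [pc_inl, pc_inr, pb, Sum.elim_inl, Sum.elim_inr]
  ext1
  · simpa [Prod.fst_sum] using pos_sum v.1
  · simpa [Prod.snd_sum] using pos_sum v.2

lemma abs_pc_le (i : Fin n ⊕ Fin n) (z : Phase n) : |pc i z| ≤ ‖z‖ := by
  rcases i with j | j
  · exact (PiLp.norm_apply_le z.1 j).trans (norm_fst_le z)
  · exact (PiLp.norm_apply_le z.2 j).trans (norm_snd_le z)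

lemma norm_pc_le (i : Fin n ⊕ Fin n) : ‖(pc i : Phase n →L[ℝ] ℝ)‖ ≤ 1 :=
  ContinuousLinearMap.opNorm_le_bound _ zero_le_one fun z => by simpa using abs_pc_le i z

lemma norm_sq_le_sum (z : Phase n) : ‖z‖ ^ 2 ≤ ∑ i, (pc i z) ^ 2 := by
  rw [Fintype.sum_sum_type]
  simp only [pc_inl, pc_inr]
  have h1 : ∑ j, (z.1 j) ^ 2 = ‖z.1‖ ^ 2 := (EuclideanSpace.real_norm_sq_eq z.1).symm
  have h2 : ∑ j, (z.2 j) ^ 2 = ‖z.2‖ ^ 2 := (EuclideanSpace.real_norm_sq_eq z.2).symm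
  rw [h1, h2, Prod.norm_def]
  rcases max_cases ‖z.1‖ ‖z.2‖ with h | h <;> rw [h.1] <;> nlinarith [sq_nonneg ‖z.1‖, sq_nonneg ‖z.2‖]

/-- The weight `1 + |x|² + |ξ|²`. -/
def om (z : Phase n) : ℝ := 1 + ∑ i, (pc i z) ^ 2

lemma one_le_om (z : Phase n) : 1 ≤ om z := by
  have : 0 ≤ ∑ i, (pc i z) ^ 2 := Finset.sum_nonneg fun i _ => sq_nonneg _
  simp only [om]; linarith

lemma om_pos (z : Phase n) : 0 < om z := zero_lt_one.trans_le (one_le_om z)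

lemma norm_sq_le_om (z : Phase n) : 1 + ‖z‖ ^ 2 ≤ om z := by
  simp only [om]; linarith [norm_sq_le_sum z]

lemma norm_le_om (z : Phase n) : ‖z‖ ≤ om z := by
  nlinarith [norm_sq_le_om z, sq_nonneg (‖z‖ - 1)]

lemma one_add_norm_sq_le (z : Phase n) : (1 + ‖z‖) ^ 2 ≤ 2 * om z := by
  nlinarith [norm_sq_le_om z, sq_nonneg (‖z‖ - 1)]

lemma om_le (z : Phase n) : om z ≤ (1 + 2 * n) * (1 + ‖z‖) ^ 2 := by
  have : ∑ i, (pc i z) ^ 2 ≤ ∑ _i : Fin n ⊕ Fin n, ‖z‖ ^ 2 :=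
    Finset.sum_le_sum fun i _ => sq_le_sq' (neg_le_of_abs_le (abs_pc_le i z))
      (le_of_abs_le (abs_pc_le i z))
  simp only [Finset.sum_const, Finset.card_univ, Fintype.card_sum, Fintype.card_fin,
    nsmul_eq_mul, Nat.cast_add] at this
  have h0 := norm_nonneg z
  have hn : (0 : ℝ) ≤ n := Nat.cast_nonneg n
  simp only [om]
  nlinarith [mul_nonneg hn h0]

lemma contDiff_om : ContDiff ℝ ∞ (om : Phase n → ℝ) := by
  unfold om
  exact contDiff_const.add (ContDiff.sum fun i _ => (pc i).contDiff.pow 2)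

lemma fderiv_om : fderiv ℝ (om : Phase n → ℝ) =
    (∑ i, (2 : ℝ) • (pc i).smulRight (pc i) : Phase n →L[ℝ] Phase n →L[ℝ] ℝ) := by
  funext z
  have : HasFDerivAt (om : Phase n → ℝ) (∑ i, (2 * pc i z) • pc i) z := by
    unfold om
    refine (HasFDerivAt.fun_sum fun i _ => ?_).const_add 1
    simpa using ((pc i).hasFDerivAt (x := z)).pow 2
  rw [this.fderiv]
  refine ContinuousLinearMap.ext fun v => ?_
  simp [mul_assoc]

/-- The derivative of the quadratic weight is linear, so it grows at most like `om`; its own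
derivative is constant and all later ones vanish. -/
lemma derivBound_fderiv_om (m : ℕ) : DerivBound m om (fderiv ℝ (om : Phase n → ℝ)) := by
  rw [fderiv_om]
  set L : Phase n →L[ℝ] Phase n →L[ℝ] ℝ := ∑ i, (2 : ℝ) • (pc i).smulRight (pc i)
  refine ⟨‖L‖, norm_nonneg L, fun z => ?_⟩
  rcases m with _ | m
  · rw [norm_iteratedFDeriv_zero]
    exact (L.le_opNorm z).trans (mul_le_mul_of_nonneg_left (norm_le_om z) (norm_nonneg L))
  · rw [← norm_iteratedFDeriv_fderiv]
    have : fderiv ℝ L = fun _ => L := funext fun z => L.fderiv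
    rw [this]
    rcases m with _ | m
    · rw [norm_iteratedFDeriv_zero]
      exact le_mul_of_one_le_right (norm_nonneg L) (one_le_om z)
    · rw [iteratedFDeriv_const_of_ne (Nat.succ_ne_zero m)]
      simpa using mul_nonneg (norm_nonneg L) (om_pos z).le

lemma contDiff_om_inv : ContDiff ℝ ∞ (fun z : Phase n => (om z)⁻¹) :=
  contDiff_om.inv fun z => (om_pos z).ne'

/-- Strong induction on `D(om⁻¹) = -om⁻² D om`: the product rule gives the weight `om⁻¹ om⁻¹ om =
om⁻¹` again. -/
lemma derivBound_om_inv (m : ℕ) :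
    DerivBound m (fun z : Phase n => (om z)⁻¹) (fun z : Phase n => (om z)⁻¹) := by
  induction m using Nat.strong_induction_on with
  | _ m ih =>
  rcases m with _ | m
  · exact ⟨1, zero_le_one, fun z => by simp [abs_of_pos (om_pos z)]⟩
  have hsq : ∀ j ≤ m, DerivBound j (fun z : Phase n => (om z)⁻¹ * (om z)⁻¹)
      (fun z : Phase n => (om z)⁻¹ • (om z)⁻¹) := fun j hj =>
    DerivBound.smul contDiff_om_inv contDiff_om_inv (fun i hi => ih i (by omega))
      (fun i hi => ih i (by omega))
  have hd : fderiv ℝ (fun z : Phase n => (om z)⁻¹) =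
      fun z => -(((om z)⁻¹ • (om z)⁻¹) • fderiv ℝ (om : Phase n → ℝ) z) := by
    funext z
    have h1 := (hasDerivAt_inv (om_pos z).ne').comp_hasFDerivAt z
      ((contDiff_om.differentiable (by simp)) z).hasFDerivAt
    refine h1.fderiv.trans ?_
    rw [neg_smul]
    congr 2
    rw [smul_eq_mul, ← mul_inv, sq]
  refine DerivBound.of_fderiv ?_
  rw [hd]
  have h3 := (DerivBound.smul (contDiff_om_inv.smul contDiff_om_inv)
    (contDiff_om.fderiv_right (m := ∞) (by simp)) hsq (fun j _ => derivBound_fderiv_om j))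
  obtain ⟨C, hC0, hC⟩ := h3
  refine ⟨C, hC0, fun z => ?_⟩
  have h4 : (fun z => -(((om z)⁻¹ • (om z)⁻¹) • fderiv ℝ (om : Phase n → ℝ) z)) =
    -(fun z => ((om z)⁻¹ • (om z)⁻¹) • fderiv ℝ (om : Phase n → ℝ) z) := rfl
  rw [h4, iteratedFDeriv_neg, Pi.neg_apply, norm_neg]
  refine (hC z).trans (le_of_eq ?_)
  have := (om_pos z).ne'
  field_simp

variable {F : Type*} [NormedAddCommGroup F] [NormedSpace ℝ F]

/-- Symbols all of whose derivatives are bounded by `(1 + |z|²)^r`. -/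
def Gam (r : ℤ) (f : Phase n → F) : Prop :=
  ContDiff ℝ ∞ f ∧ ∀ m, DerivBound m (fun z => om z ^ r) f

lemma Gam.smul {r s : ℤ} {f : Phase n → ℝ} {g : Phase n → F} (hf : Gam r f) (hg : Gam s g) :
    Gam (r + s) (fun z => f z • g z) :=
  ⟨hf.1.smul hg.1, fun _ => (DerivBound.smul hf.1 hg.1 (fun j _ => hf.2 j)
    (fun j _ => hg.2 j)).mono fun z => (zpow_add₀ (om_pos z).ne' r s).ge⟩

lemma Gam.dd {r : ℤ} {f : Phase n → F} (hf : Gam r f) (v : Phase n) : Gam r (dd v f) := by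
  refine ⟨contDiff_dd hf.1 v, fun m => ?_⟩
  obtain ⟨C, hC0, hC⟩ := hf.2 (m + 1)
  refine ⟨‖v‖ * C, by positivity, fun z => (norm_iteratedFDeriv_dd_le hf.1 v m z).trans ?_⟩
  rw [mul_assoc]
  exact mul_le_mul_of_nonneg_left (hC z) (norm_nonneg _)

lemma gam_om_inv : Gam (-1) (fun z : Phase n => (om z)⁻¹) :=
  ⟨contDiff_om_inv, fun m => by simpa using derivBound_om_inv m⟩

lemma gam_om_inv_pow (M : ℕ) : Gam (-M : ℤ) (fun z : Phase n => ((om z)⁻¹) ^ M) := by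
  induction M with
  | zero =>
    refine ⟨by simpa using contDiff_const, fun m => ⟨1, zero_le_one, fun z => ?_⟩⟩
    simp only [pow_zero, CharP.cast_eq_zero, neg_zero, zpow_zero, mul_one]
    rcases m with _ | m
    · simp
    · rw [iteratedFDeriv_const_of_ne (Nat.succ_ne_zero m)]; simp
  | succ M ih =>
    have := gam_om_inv.smul ih
    convert this using 1
    · push_cast; ring
    · funext z; rw [pow_succ']; rfl

lemma Gam.mono {r s : ℤ} (hrs : r ≤ s) {f : Phase n → F} (hf : Gam r f) : Gam s f :=
  ⟨hf.1, fun m => (hf.2 m).mono fun z => zpow_le_zpow_right₀ (one_le_om z) hrs⟩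

/-- A smooth function with bounded derivatives of order at least `k` is a symbol of finite
order. -/
lemma gam_of_bounded_derivs {f : Phase n → F} (hf : ContDiff ℝ ∞ f) (k : ℕ)
    (hb : ∀ m, k ≤ m → ∃ C, ∀ z, ‖iteratedFDeriv ℝ m f z‖ ≤ C) : Gam k f := by
  -- Descending from order `k`, each missing derivative is recovered by the mean value inequality at
  -- the price of one factor `‖z‖ ≤ om z`; `j` counts the missing derivatives.
  have key : ∀ j : ℕ, ∀ m, k ≤ m + j → DerivBound m (fun z => om z ^ j) f := by
    intro j
    induction j with
    | zero =>
      intro m hm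
      obtain ⟨C, hC⟩ := hb m hm
      exact ⟨C, (norm_nonneg (iteratedFDeriv ℝ m f 0)).trans (hC 0), by simpa using hC⟩
    | succ j ih =>
      intro m hm
      obtain ⟨C, hC0, hC⟩ := ih (m + 1) (by omega)
      refine ⟨‖iteratedFDeriv ℝ m f 0‖ + C * (1 + 2 * n) ^ j * 2 ^ j, by positivity, fun z => ?_⟩
      have hd : ∀ y, DifferentiableAt ℝ (iteratedFDeriv ℝ m f) y := fun y =>
        (hf.differentiable_iteratedFDeriv (by exact_mod_cast WithTop.coe_lt_top _)) y
      -- The ball contains the segment from `0` to `z`, and on it the weight is at most a constant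
      -- times its value at `z`.
      have hom : ∀ y ∈ Metric.closedBall (0 : Phase n) ‖z‖,
          om y ≤ (1 + 2 * n) * 2 * om z := by
        intro y hy
        have hy' : ‖y‖ ≤ ‖z‖ := by simpa using hy
        have h0 := norm_nonneg y
        calc om y ≤ (1 + 2 * n) * (1 + ‖y‖) ^ 2 := om_le y
          _ ≤ (1 + 2 * n) * (1 + ‖z‖) ^ 2 := by gcongr
          _ ≤ (1 + 2 * n) * (2 * om z) := by gcongr; exact one_add_norm_sq_le z
          _ = _ := by ring
      have hmv := (convex_closedBall (0 : Phase n) ‖z‖).norm_image_sub_le_of_norm_fderiv_le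
        (f := iteratedFDeriv ℝ m f) (C := C * ((1 + 2 * n) * 2 * om z) ^ j) (x := 0) (y := z)
        (fun y _ => hd y) (fun y hy => ?_) (by simp) (by simp)
      · rw [sub_zero] at hmv
        have h1 : ‖iteratedFDeriv ℝ m f z‖ ≤ ‖iteratedFDeriv ℝ m f 0‖ +
            C * ((1 + 2 * n) * 2 * om z) ^ j * ‖z‖ := by
          have := norm_add_le (iteratedFDeriv ℝ m f 0)
            (iteratedFDeriv ℝ m f z - iteratedFDeriv ℝ m f 0)
          rw [add_sub_cancel] at this
          linarith
        have h3 := one_le_om z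
        calc ‖iteratedFDeriv ℝ m f z‖ ≤ _ := h1
          _ ≤ ‖iteratedFDeriv ℝ m f 0‖ * om z ^ (j + 1)
              + C * (1 + 2 * n) ^ j * 2 ^ j * om z ^ (j + 1) := ?_
          _ = _ := by ring
        refine add_le_add (le_mul_of_one_le_right (norm_nonneg (iteratedFDeriv ℝ m f 0))
          (one_le_pow₀ h3)) ?_
        rw [mul_pow, mul_pow, pow_succ (om z), mul_assoc]
        have h4 := norm_le_om z
        have := om_pos z
        calc _ ≤ C * ((1 + 2 * (n : ℝ)) ^ j * 2 ^ j * om z ^ j * om z) := by gcongr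
          _ = _ := by ring
      · rw [norm_fderiv_iteratedFDeriv]
        refine (hC y).trans ?_
        have := hom y hy
        have := (om_pos y).le
        show C * om y ^ j ≤ _
        gcongr
  refine ⟨hf, fun m => ?_⟩
  simpa using key k m (by omega)

end PhaseCoordinates

/-! ### The Fourier transform on L² and derivatives -/

section FourierL2

open FourierTransform LineDeriv TemperedDistribution

variable {V : Type*} [NormedAddCommGroup V] [InnerProductSpace ℝ V] [FiniteDimensional ℝ V]
  [MeasurableSpace V] [BorelSpace V]

lemma ae_eq_of_schwartz_pairing {f g : V → ℂ} (hf : LocallyIntegrable f volume)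
    (hg : LocallyIntegrable g volume)
    (h : ∀ φ : 𝓢(V, ℂ), ∫ x, φ x • f x = ∫ x, φ x • g x) : f =ᵐ[volume] g := by
  refine ae_eq_of_integral_contDiff_smul_eq hf hg fun φ hφ hc => ?_
  have hg₁ : HasCompactSupport (Complex.ofRealCLM ∘ φ) := hc.comp_left rfl
  have hg₂ : ContDiff ℝ ∞ (Complex.ofRealCLM ∘ φ) := by fun_prop
  simpa using h (hg₁.toSchwartzMap hg₂)

/-- Integration by parts against Schwartz functions shows that the classical derivative is also the
distributional one. The Fourier transform of tempered distributions turns it into a multiplication,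
and pairing with Schwartz functions brings the identity back to functions. -/
lemma fourierLp_dd {β : V → ℂ} (hβ : Differentiable ℝ β) (h0 : MemLp β 2 volume) (v : V)
    (h1 : MemLp (dd v β) 2 volume) :
    (𝓕 (h1.toLp (dd v β)) : Lp ℂ 2 volume) =ᵐ[volume]
      fun ζ => (2 * Real.pi * Complex.I) * ((inner ℝ ζ v : ℝ) : ℂ) *
        (𝓕 (h0.toLp β) : Lp ℂ 2 volume) ζ := by
  have hfact : Fact ((1 : ℝ≥0∞) ≤ 2) := ⟨by norm_num⟩
  have hT : ∂_{v} (Lp.toTemperedDistribution (h0.toLp β)) =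
      (Lp.toTemperedDistribution (h1.toLp (dd v β)) : 𝓢'(V, ℂ)) := by
    ext φ
    rw [lineDerivOp_apply_apply, Lp.toTemperedDistribution_apply, Lp.toTemperedDistribution_apply]
    have e1 : ∫ x, (-∂_{v} φ) x • (h0.toLp β) x = ∫ x, -(fderiv ℝ φ x v * β x) := by
      refine integral_congr_ae ?_
      filter_upwards [h0.coeFn_toLp] with x hx
      rw [hx]
      simp [SchwartzMap.lineDerivOp_apply_eq_fderiv]
    have e2 : ∫ x, φ x • (h1.toLp (dd v β)) x = ∫ x, φ x * fderiv ℝ β x v := by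
      refine integral_congr_ae ?_
      filter_upwards [h1.coeFn_toLp] with x hx
      rw [hx]
      rfl
    rw [e1, e2, integral_neg]
    have m1 : MemLp (fun x => fderiv ℝ φ x v) 2 volume := (∂_{v} φ).memLp 2 volume
    rw [integral_mul_fderiv_eq_neg_fderiv_mul_of_integrable]
    · exact m1.integrable_mul h0
    · exact (φ.memLp 2 volume).integrable_mul h1
    · exact (φ.memLp 2 volume).integrable_mul h0
    · exact fun x _ => φ.differentiableAt
    · exact fun x _ => hβ x
  have hF : (Lp.toTemperedDistribution (𝓕 (h1.toLp (dd v β)) : Lp ℂ 2 volume) : 𝓢'(V, ℂ)) =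
      (2 * Real.pi * Complex.I) • smulLeftCLM ℂ (fun x : V => ((inner ℝ x v : ℝ) : ℂ))
        (Lp.toTemperedDistribution (𝓕 (h0.toLp β) : Lp ℂ 2 volume)) := by
    rw [← Lp.fourier_toTemperedDistribution_eq, ← hT, fourier_lineDerivOp_eq,
      Lp.fourier_toTemperedDistribution_eq]
  have htg : (fun x : V => ((inner ℝ x v : ℝ) : ℂ)).HasTemperateGrowth := by fun_prop
  refine ae_eq_of_schwartz_pairing ((Lp.memLp _).locallyIntegrable (by norm_num)) ?_ fun φ => ?_
  · have := ((Lp.memLp (𝓕 (h0.toLp β) : Lp ℂ 2 volume)).locallyIntegrable (by norm_num))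
    rw [← locallyIntegrableOn_univ] at this ⊢
    refine this.continuousOn_mul ?_ isOpen_univ.isLocallyClosed
    fun_prop
  have := DFunLike.congr_fun hF φ
  rw [Lp.toTemperedDistribution_apply] at this
  rw [this]
  change (2 * Real.pi * Complex.I) • (smulLeftCLM ℂ _ _) φ = _
  rw [smulLeftCLM_apply_apply, Lp.toTemperedDistribution_apply, ← integral_smul]
  congr 1
  funext x
  rw [SchwartzMap.smulLeftCLM_apply_apply htg]
  simp only [smul_eq_mul]
  ring

omit [FiniteDimensional ℝ V] [MeasurableSpace V] [BorelSpace V] in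
lemma contDiff_iterate_dd {b : V → ℂ} (hb : ContDiff ℝ ∞ b) (v : V) (m : ℕ) :
    ContDiff ℝ ∞ ((dd v)^[m] b) := by
  induction m with
  | zero => exact hb
  | succ m ih => rw [Function.iterate_succ_apply']; exact contDiff_dd ih v

omit [FiniteDimensional ℝ V] [MeasurableSpace V] [BorelSpace V] in
lemma norm_iterate_dd_le {b : V → ℂ} (hb : ContDiff ℝ ∞ b) (v : V) (m : ℕ) (z : V) :
    ‖(dd v)^[m] b z‖ ≤ ‖v‖ ^ m * ‖iteratedFDeriv ℝ m b z‖ := by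
  have key : ∀ j, ‖iteratedFDeriv ℝ j ((dd v)^[m] b) z‖ ≤
      ‖v‖ ^ m * ‖iteratedFDeriv ℝ (j + m) b z‖ := by
    induction m with
    | zero => intro j; simp
    | succ m ih =>
      intro j
      rw [Function.iterate_succ_apply']
      refine (norm_iteratedFDeriv_dd_le (contDiff_iterate_dd hb v m) v j z).trans ?_
      rw [pow_succ', mul_assoc]
      refine mul_le_mul_of_nonneg_left ((ih (j + 1)).trans (le_of_eq ?_)) (norm_nonneg _)
      rw [show j + 1 + m = j + (m + 1) by ring]
  have h := key 0
  rw [norm_iteratedFDeriv_zero, zero_add m] at h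
  exact h

lemma memLp_iterate_dd {b : V → ℂ} (hb : ContDiff ℝ ∞ b)
    (h : ∀ m, MemLp (iteratedFDeriv ℝ m b) 2 volume) (v : V) (m : ℕ) :
    MemLp ((dd v)^[m] b) 2 volume := by
  refine (h m).of_le_mul (c := ‖v‖ ^ m) (contDiff_iterate_dd hb v m).continuous.aestronglyMeasurable
    (Filter.Eventually.of_forall fun z => norm_iterate_dd_le hb v m z)

lemma fourierLp_iterate_dd {b : V → ℂ} (hb : ContDiff ℝ ∞ b) (h0 : MemLp b 2 volume)
    (h : ∀ m, MemLp (iteratedFDeriv ℝ m b) 2 volume) (v : V) (m : ℕ) :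
    (𝓕 ((memLp_iterate_dd hb h v m).toLp _) : Lp ℂ 2 volume) =ᵐ[volume]
      fun ζ => ((2 * Real.pi * Complex.I) * ((inner ℝ ζ v : ℝ) : ℂ)) ^ m *
        (𝓕 (h0.toLp b) : Lp ℂ 2 volume) ζ := by
  induction m with
  | zero => simp
  | succ m ih =>
    have hs : (dd v)^[m + 1] b = dd v ((dd v)^[m] b) := Function.iterate_succ_apply' _ _ _
    have h1 : MemLp (dd v ((dd v)^[m] b)) 2 volume := hs ▸ memLp_iterate_dd hb h v (m + 1)
    have e1 : (memLp_iterate_dd hb h v (m + 1)).toLp ((dd v)^[m + 1] b) = h1.toLp _ :=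
      MemLp.toLp_congr _ _ (by rw [hs])
    rw [e1]
    filter_upwards [fourierLp_dd ((contDiff_iterate_dd hb v m).differentiable (by simp))
      (memLp_iterate_dd hb h v m) v h1, ih] with ζ h2 h3
    rw [h2, h3]
    ring

lemma continuous_fourierInv {g : V → ℂ} (hg : Integrable g volume) : Continuous (𝓕⁻ g) := by
  rw [show 𝓕⁻ g = fun x => 𝓕 g (-x) from funext fun x => Real.fourierInv_eq_fourier_neg g x]
  exact (VectorFourier.fourierIntegral_continuous Real.continuous_fourierChar
    (continuous_inner (𝕜 := ℝ) (E := V)) hg).comp continuous_neg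

/-- On both sides the transform can be moved onto a Schwartz test function: by definition for the L²
extension, by Fubini for the integral. -/
lemma fourierInvLp_ae_eq {g : V → ℂ} (h1 : Integrable g volume) (h2 : MemLp g 2 volume) :
    (𝓕⁻ (h2.toLp g) : Lp ℂ 2 volume) =ᵐ[volume] 𝓕⁻ g := by
  have hfact : Fact ((1 : ℝ≥0∞) ≤ 2) := ⟨by norm_num⟩
  refine ae_eq_of_schwartz_pairing ((Lp.memLp _).locallyIntegrable (by norm_num))
    (continuous_fourierInv h1).locallyIntegrable fun φ => ?_
  have := DFunLike.congr_fun
    (Lp.fourierInv_toTemperedDistribution_eq (h2.toLp g) : _ = (_ : 𝓢'(V, ℂ))) φ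
  rw [Lp.toTemperedDistribution_apply] at this
  rw [← this, fourierInv_apply, Lp.toTemperedDistribution_apply]
  have e1 : ∫ x, (𝓕⁻ φ) x • (h2.toLp g) x = ∫ x, (𝓕⁻ φ) x • g x := by
    refine integral_congr_ae ?_
    filter_upwards [h2.coeFn_toLp] with x hx
    rw [hx]
  rw [e1, SchwartzMap.fourierInv_coe]
  have := VectorFourier.integral_fourierIntegral_smul_eq_flip (V := V) (W := V) (F := ℂ)
    (μ := volume) (ν := volume) (L := -innerₗ V) (e := Real.fourierChar) (f := φ) (g := g)
    Real.continuous_fourierChar ((continuous_inner (𝕜 := ℝ) (E := V)).neg) φ.integrable h1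
  have hflip : (-innerₗ V).flip = -innerₗ V := by
    ext x y
    simp [real_inner_comm]
  rw [hflip] at this
  exact this

/-- Plancherel's theorem for functions in `L¹ ∩ L²`. -/
lemma eLpNorm_fourierInv {g : V → ℂ} (h1 : Integrable g volume) (h2 : MemLp g 2 volume) :
    eLpNorm (𝓕⁻ g) 2 volume = eLpNorm g 2 volume := by
  rw [← eLpNorm_congr_ae (fourierInvLp_ae_eq h1 h2), ← eLpNorm_congr_ae h2.coeFn_toLp]
  have h := Lp.norm_fourier_eq (𝓕⁻ (h2.toLp g) : Lp ℂ 2 volume)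
  rw [fourier_fourierInv_eq] at h
  rw [Lp.norm_def, Lp.norm_def] at h
  exact ((ENNReal.toReal_eq_toReal_iff' (Lp.memLp _).2.ne (Lp.memLp _).2.ne).1 h).symm

/-- The density is the L² Fourier transform. Its integrability is left as a condition, since it
follows only after the directional moments are assembled into moments of the norm. Inversion then
holds everywhere because both sides are continuous. -/
lemma exists_fourier_repr {b : V → ℂ} (hb : ContDiff ℝ ∞ b)
    (h : ∀ m, MemLp (iteratedFDeriv ℝ m b) 2 volume) :
    ∃ g : V → ℂ, AEStronglyMeasurable g volume ∧
      (∀ v m, eLpNorm (fun ζ => (inner ℝ ζ v) ^ m • g ζ) 2 volume ≤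
        ENNReal.ofReal (‖v‖ ^ m) * eLpNorm (iteratedFDeriv ℝ m b) 2 volume) ∧
      (Integrable g volume → ∀ z, b z = 𝓕⁻ g z) := by
  have h0 : MemLp b 2 volume := memLp_iterate_dd hb h 0 0
  refine ⟨(𝓕 (h0.toLp b) : Lp ℂ 2 volume), (Lp.memLp _).1, fun v m => ?_, fun hg => ?_⟩
  · have hpl := Lp.norm_fourier_eq ((memLp_iterate_dd hb h v m).toLp _)
    rw [Lp.norm_def, Lp.norm_def,
      ENNReal.toReal_eq_toReal_iff' (Lp.memLp _).2.ne (Lp.memLp _).2.ne,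
      eLpNorm_congr_ae (memLp_iterate_dd hb h v m).coeFn_toLp,
      eLpNorm_congr_ae (fourierLp_iterate_dd hb h0 h v m)] at hpl
    calc _ ≤ eLpNorm (fun ζ => ((2 * Real.pi * Complex.I) * ((inner ℝ ζ v : ℝ) : ℂ)) ^ m *
          (𝓕 (h0.toLp b) : Lp ℂ 2 volume) ζ) 2 volume := by
          refine eLpNorm_mono fun ζ => ?_
          rw [norm_smul, norm_mul, norm_pow, norm_pow, norm_mul]
          refine mul_le_mul_of_nonneg_right (pow_le_pow_left₀ (norm_nonneg _) ?_ _) (norm_nonneg _)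
          rw [Complex.norm_real]
          -- The factor `2πi` of the multiplier has modulus at least one and may be dropped.
          refine le_mul_of_one_le_left (norm_nonneg _) ?_
          simp only [Complex.norm_mul, Complex.norm_ofNat, Complex.norm_real, Complex.norm_I,
            mul_one, Real.norm_eq_abs, abs_of_pos Real.pi_pos]
          linarith [Real.pi_gt_three]
      _ = _ := hpl
      _ ≤ _ := by
          refine eLpNorm_le_mul_eLpNorm_of_ae_le_mul
            (Filter.Eventually.of_forall fun z => norm_iterate_dd_le hb v m z) 2
  · have h2 := Lp.memLp (𝓕 (h0.toLp b) : Lp ℂ 2 volume)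
    have e1 := fourierInvLp_ae_eq hg h2
    rw [Lp.toLp_coeFn, fourierInv_fourier_eq] at e1
    have e2 := h0.coeFn_toLp.symm.trans e1
    exact fun z => congrFun (Continuous.ae_eq_iff_eq volume hb.continuous (continuous_fourierInv hg) |>.1 e2) z

end FourierL2

/-! ### Fourier synthesis on phase space -/

section PhaseFourier

open FourierTransform

variable {n : ℕ}

/-- The Euclidean pairing on phase space. -/
def pair (ζ z : Phase n) : ℝ := ∑ i, pc i ζ * pc i z

/-- The character `z ↦ exp (2πi ζ·z)`. -/
def eph (ζ z : Phase n) : ℂ := Complex.exp (2 * Real.pi * Complex.I * (pair ζ z : ℝ))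

lemma pair_eq (ζ z : Phase n) : pair ζ z = inner ℝ ζ.1 z.1 + inner ℝ ζ.2 z.2 := by
  simp only [pair, Fintype.sum_sum_type, pc_inl, pc_inr, PiLp.inner_apply]
  congr 1 <;> exact Finset.sum_congr rfl fun i _ => by simp [mul_comm]

lemma pair_comm (ζ z : Phase n) : pair ζ z = pair z ζ :=
  Finset.sum_congr rfl fun _ _ => mul_comm _ _

lemma pair_add_left (ζ ζ' z : Phase n) : pair (ζ + ζ') z = pair ζ z + pair ζ' z := by
  simp [pair, add_mul, Finset.sum_add_distrib]

lemma pair_add_right (ζ z z' : Phase n) : pair ζ (z + z') = pair ζ z + pair ζ z' := by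
  simp [pair, mul_add, Finset.sum_add_distrib]

lemma pair_smul_left (t : ℝ) (ζ z : Phase n) : pair (t • ζ) z = t * pair ζ z := by
  simp only [pair, map_smul, smul_eq_mul, Finset.mul_sum, mul_assoc]

lemma pair_smul_right (t : ℝ) (ζ z : Phase n) : pair ζ (t • z) = t * pair ζ z := by
  rw [pair_comm, pair_smul_left, pair_comm]

lemma eph_add_left (ζ ζ' z : Phase n) : eph (ζ + ζ') z = eph ζ z * eph ζ' z := by
  simp only [eph, pair_add_left, ← Complex.exp_add]
  push_cast; ring_nf

lemma eph_add_right (ζ z z' : Phase n) : eph ζ (z + z') = eph ζ z * eph ζ z' := by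
  simp only [eph, pair_add_right, ← Complex.exp_add]
  push_cast; ring_nf

@[simp] lemma norm_eph (ζ z : Phase n) : ‖eph ζ z‖ = 1 := by
  rw [eph, Complex.norm_exp]
  simp

lemma contDiff_pair : ContDiff ℝ ∞ (fun p : Phase n × Phase n => pair p.1 p.2) := by
  unfold pair
  fun_prop

lemma contDiff_eph : ContDiff ℝ ∞ (fun p : Phase n × Phase n => eph p.1 p.2) := by
  unfold eph
  exact (contDiff_const.mul (Complex.ofRealCLM.contDiff.comp contDiff_pair)).cexp

lemma continuous_eph : Continuous (fun p : Phase n × Phase n => eph p.1 p.2) :=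
  contDiff_eph.continuous

/-- The identification of phase space with a Euclidean space. -/
abbrev PhaseE (n : ℕ) : Type := WithLp 2 (Pos n × Pos n)

/-- The linear identification of phase space with a Euclidean space. -/
def eqE : PhaseE n ≃L[ℝ] Phase n := WithLp.prodContinuousLinearEquiv 2 ℝ (Pos n) (Pos n)

lemma mp_eqE : MeasurePreserving (eqE : PhaseE n → Phase n) volume volume :=
  WithLp.volume_preserving_ofLp (Pos n) (Pos n)

lemma me_eqE : MeasurableEmbedding (eqE : PhaseE n → Phase n) :=
  eqE.toHomeomorph.measurableEmbedding

lemma mp_eqE_symm : MeasurePreserving (eqE.symm : Phase n → PhaseE n) volume volume :=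
  WithLp.volume_preserving_toLp (Pos n) (Pos n)

lemma inner_eqE (v w : PhaseE n) : (inner ℝ v w : ℝ) = pair (eqE v) (eqE w) := by
  rw [pair_eq, WithLp.prod_inner_apply]
  rfl

lemma norm_eqE_le (v : PhaseE n) : ‖eqE v‖ ≤ ‖v‖ := by
  have h : ‖v‖ ^ 2 = ‖(eqE v).1‖ ^ 2 + ‖(eqE v).2‖ ^ 2 := by
    rw [WithLp.prod_norm_sq_eq_of_L2]; rfl
  rw [Prod.norm_def]
  refine max_le ?_ ?_ <;>
  exact abs_le_of_sq_le_sq' (by nlinarith [sq_nonneg ‖(eqE v).1‖, sq_nonneg ‖(eqE v).2‖])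
    (norm_nonneg _) |>.2

lemma norm_iteratedFDeriv_comp_eqE_le {F : Type*} [NormedAddCommGroup F] [NormedSpace ℝ F]
    {f : Phase n → F} (hf : ContDiff ℝ ∞ f) (m : ℕ) (v : PhaseE n) :
    ‖iteratedFDeriv ℝ m (f ∘ eqE) v‖ ≤ ‖iteratedFDeriv ℝ m f (eqE v)‖ := by
  have h1 := (eqE (n := n) : PhaseE n →L[ℝ] Phase n).iteratedFDeriv_comp_right hf v (i := m)
    (by exact_mod_cast le_top)
  have h2 : ‖(eqE (n := n) : PhaseE n →L[ℝ] Phase n)‖ ≤ 1 :=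
    ContinuousLinearMap.opNorm_le_bound _ zero_le_one fun v => by simpa using norm_eqE_le v
  calc _ = ‖iteratedFDeriv ℝ m (f ∘ (eqE (n := n) : PhaseE n →L[ℝ] Phase n)) v‖ := rfl
    _ ≤ _ := by
      rw [h1]
      refine (ContinuousMultilinearMap.norm_compContinuousLinearMap_le _ _).trans ?_
      refine mul_le_of_le_one_right (norm_nonneg _) ?_
      exact Finset.prod_le_one (fun _ _ => norm_nonneg _) fun _ _ => h2

/-- Fourier synthesis: `∫ g(ζ) exp (2πi ζ·z) dζ`. -/
def syn (g : Phase n → ℂ) (z : Phase n) : ℂ := ∫ ζ, g ζ * eph ζ z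

lemma syn_eqE (g : Phase n → ℂ) (v : PhaseE n) : syn g (eqE v) = 𝓕⁻ (g ∘ eqE) v := by
  rw [Real.fourierInv_eq', syn, ← mp_eqE.integral_comp me_eqE]
  congr 1
  funext w
  rw [inner_eqE, eph, smul_eq_mul, mul_comm]
  simp only [Function.comp_apply]
  push_cast
  ring_nf

/-- Plancherel's theorem for Fourier synthesis on phase space. -/
lemma eLpNorm_syn {g : Phase n → ℂ} (h1 : Integrable g volume) (h2 : MemLp g 2 volume) :
    eLpNorm (syn g) 2 volume = eLpNorm g 2 volume := by
  have e1 : syn g = (𝓕⁻ (g ∘ eqE)) ∘ eqE.symm := by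
    funext z
    rw [Function.comp_apply, ← syn_eqE, ContinuousLinearEquiv.apply_symm_apply]
  have i1 : Integrable (g ∘ eqE) volume := mp_eqE.integrable_comp_of_integrable h1
  have i2 : MemLp (g ∘ eqE) 2 volume := h2.comp_measurePreserving mp_eqE
  rw [e1, eLpNorm_comp_measurePreserving
    (continuous_fourierInv i1).aestronglyMeasurable mp_eqE_symm,
    eLpNorm_fourierInv i1 i2, eLpNorm_comp_measurePreserving h2.1 mp_eqE]

lemma finrank_phase : Module.finrank ℝ (Phase n) = 2 * n := by
  simp [two_mul]

/-- Amplitudes all of whose moments are integrable. -/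
def Wt (g : Phase n → ℂ) : Prop :=
  AEStronglyMeasurable g volume ∧ ∀ M : ℕ, Integrable (fun ζ => (1 + ‖ζ‖) ^ M * ‖g ζ‖) volume

lemma Wt.integrable {g : Phase n → ℂ} (hg : Wt g) : Integrable g volume := by
  have := hg.2 0
  simp only [pow_zero, one_mul] at this
  exact (integrable_norm_iff hg.1).1 this

lemma Wt.mul {g : Phase n → ℂ} (hg : Wt g) {p : Phase n → ℂ} (hp : Continuous p) (N : ℕ)
    {C : ℝ} (hC : ∀ ζ, ‖p ζ‖ ≤ C * (1 + ‖ζ‖) ^ N) : Wt (fun ζ => p ζ * g ζ) := by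
  refine ⟨hp.aestronglyMeasurable.mul hg.1, fun M => ?_⟩
  refine ((hg.2 (M + N)).const_mul C).mono' ?_ (Filter.Eventually.of_forall fun ζ => ?_)
  · exact (by fun_prop : Continuous fun ζ : Phase n => (1 + ‖ζ‖) ^ M).aestronglyMeasurable.mul
      (hp.aestronglyMeasurable.mul hg.1).norm
  · rw [Real.norm_of_nonneg (by positivity), norm_mul, pow_add]
    have := hC ζ
    calc _ ≤ (1 + ‖ζ‖) ^ M * ((C * (1 + ‖ζ‖) ^ N) * ‖g ζ‖) := by gcongr
      _ = _ := by ring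

instance : (volume : Measure (Phase n)).IsAddHaarMeasure :=
  Measure.prod.instIsAddHaarMeasure _ _

/-- The square has exponent `2n + 2`, which exceeds the dimension `2n`. -/
lemma norm_rpow_integrable_sq : MemLp (fun ζ : Phase n => ((1 + ‖ζ‖) ^ (n + 1))⁻¹) 2 volume := by
  have hc : Continuous (fun ζ : Phase n => ((1 + ‖ζ‖) ^ (n + 1))⁻¹) :=
    (by fun_prop : Continuous fun ζ : Phase n => (1 + ‖ζ‖) ^ (n + 1)).inv₀ fun ζ => by positivity
  rw [memLp_two_iff_integrable_sq hc.aestronglyMeasurable]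
  have := integrable_one_add_norm (E := Phase n) (μ := volume) (r := (2 * n + 2 : ℕ))
    (by rw [finrank_phase]; push_cast; linarith)
  refine this.congr (Filter.Eventually.of_forall fun ζ => ?_)
  have h0 : (0 : ℝ) < 1 + ‖ζ‖ := by positivity
  simp only
  rw [Real.rpow_neg h0.le, Real.rpow_natCast, inv_pow, ← pow_mul]
  congr 2
  ring

/-- Cauchy-Schwarz: split `(1 + ‖ζ‖)^M` as `(1 + ‖ζ‖)^(-(n+1))`, which is in L², times `(1 +
‖ζ‖)^(M+n+1)`, whose product with `g` is in L² by the binomial formula. -/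
lemma wt_of_memLp {g : Phase n → ℂ} (hg : AEStronglyMeasurable g volume)
    (h : ∀ m : ℕ, eLpNorm (fun ζ => ‖ζ‖ ^ m • g ζ) 2 volume < ⊤) : Wt g := by
  refine ⟨hg, fun M => ?_⟩
  have hm : ∀ m : ℕ, MemLp (fun ζ => ‖ζ‖ ^ m • g ζ) 2 volume := fun m =>
    ⟨(by fun_prop : Continuous fun ζ : Phase n => ‖ζ‖ ^ m).aestronglyMeasurable.smul hg, h m⟩
  have hone : MemLp (fun ζ : Phase n => (1 + ‖ζ‖) ^ (M + (n + 1)) • g ζ) 2 volume := by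
    have e : (fun ζ : Phase n => (1 + ‖ζ‖) ^ (M + (n + 1)) • g ζ) = fun ζ =>
        ∑ j ∈ Finset.range (M + (n + 1) + 1),
          ((M + (n + 1)).choose j : ℝ) • (‖ζ‖ ^ j • g ζ) := by
      funext ζ
      rw [add_comm 1, add_pow, Finset.sum_smul]
      refine Finset.sum_congr rfl fun j _ => ?_
      rw [smul_smul, one_pow, mul_one, mul_comm]
    rw [e]
    exact memLp_finsetSum _ fun j _ => (hm j).const_smul ((M + (n + 1)).choose j : ℝ)
  have := norm_rpow_integrable_sq.integrable_mul hone.norm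
  refine this.congr (Filter.Eventually.of_forall fun ζ => ?_)
  have h0 : (0 : ℝ) < 1 + ‖ζ‖ := by positivity
  simp only [Pi.mul_apply, norm_smul, norm_pow, Real.norm_of_nonneg h0.le]
  rw [pow_add _ M]
  field_simp

/-- The exponent is kept positive: for exponent zero and `n = 0` the sum over coordinates is empty
while the left side is one. -/
lemma norm_pow_le_sum (m : ℕ) (ζ : Phase n) :
    ‖ζ‖ ^ (m + 1) ≤ (2 * n : ℝ) ^ m * ∑ i, |pc i ζ| ^ (m + 1) := by
  have h1 : ‖ζ‖ ≤ ∑ i, |pc i ζ| := by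
    refine abs_le_of_sq_le_sq' ((norm_sq_le_sum ζ).trans ?_)
      (Finset.sum_nonneg fun i _ => abs_nonneg _) |>.2
    simp_rw [← sq_abs (pc _ ζ)]
    exact Finset.sum_sq_le_sq_sum_of_nonneg fun i _ => abs_nonneg _
  refine (pow_le_pow_left₀ (norm_nonneg _) h1 _).trans ?_
  have h2 := pow_sum_le_card_mul_sum_pow (s := Finset.univ) (f := fun i => |pc i ζ|)
    (fun i _ => abs_nonneg _) m
  simpa [two_mul] using h2

lemma norm_eqE_symm_pb_le (i : Fin n ⊕ Fin n) : ‖(eqE.symm (pb i) : PhaseE n)‖ ≤ 1 := by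
  have : ‖(eqE.symm (pb i) : PhaseE n)‖ ^ 2 = 1 := by
    rw [WithLp.prod_norm_sq_eq_of_L2]
    rcases i with j | j <;> simp [pb, basisVec, eqE]
  nlinarith [norm_nonneg (eqE.symm (pb i) : PhaseE n)]

lemma integrable_inv_pow : Integrable (fun ζ : Phase n => ((1 + ‖ζ‖) ^ (2 * n + 1))⁻¹) volume := by
  have := integrable_one_add_norm (E := Phase n) (μ := volume) (r := (2 * n + 1 : ℕ))
    (by rw [finrank_phase]; push_cast; linarith)
  refine this.congr (Filter.Eventually.of_forall fun ζ => ?_)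
  have h0 : (0 : ℝ) < 1 + ‖ζ‖ := by positivity
  simp only
  rw [Real.rpow_neg h0.le, Real.rpow_natCast]

attribute [irreducible] eqE

end PhaseFourier

/-! ### Amplitudes controlled by derivatives -/

section PhaseFourierBounds

open FourierTransform

variable {n : ℕ}

lemma aestronglyMeasurable_iteratedFDeriv {E F : Type*} [NormedAddCommGroup E] [NormedSpace ℝ E]
    [MeasurableSpace E] [BorelSpace E] [SecondCountableTopology E] [NormedAddCommGroup F]
    [NormedSpace ℝ F] {μ : Measure E} {f : E → F} (hf : ContDiff ℝ ∞ f) (m : ℕ) :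
    AEStronglyMeasurable (iteratedFDeriv ℝ m f) μ :=
  have : SecondCountableTopologyEither E (E [×m]→L[ℝ] F) := ⟨Or.inl inferInstance⟩
  (hf.continuous_iteratedFDeriv (by exact_mod_cast le_top)).aestronglyMeasurable

lemma eLpNorm_norm_pow_le (m : ℕ) {g : Phase n → ℂ} (hg : AEStronglyMeasurable g volume) :
    eLpNorm (fun ζ => ‖ζ‖ ^ (m + 1) • g ζ) 2 volume ≤ ENNReal.ofReal ((2 * n : ℝ) ^ m) *
      ∑ i, eLpNorm (fun ζ => (pc i ζ) ^ (m + 1) • g ζ) 2 volume := by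
  have hs : ∀ i : Fin n ⊕ Fin n, AEStronglyMeasurable
      (fun ζ => (pc i ζ) ^ (m + 1) • g ζ) volume := fun i =>
    ((pc i).continuous.pow _).aestronglyMeasurable.smul hg
  have h1 : eLpNorm (fun ζ => ‖ζ‖ ^ (m + 1) • g ζ) 2 volume ≤
      eLpNorm (((2 * n : ℝ) ^ m) • ∑ i : Fin n ⊕ Fin n,
          fun ζ => ‖(pc i ζ) ^ (m + 1) • g ζ‖) 2 volume := by
    refine eLpNorm_mono_real fun ζ => ?_
    rw [Pi.smul_apply, Finset.sum_apply]
    simp only [norm_smul, norm_pow, Real.norm_eq_abs, abs_norm, smul_eq_mul]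
    rw [← Finset.sum_mul, ← mul_assoc]
    exact mul_le_mul_of_nonneg_right (norm_pow_le_sum m ζ) (norm_nonneg _)
  refine h1.trans ?_
  rw [eLpNorm_const_smul, Real.enorm_of_nonneg (by positivity)]
  gcongr
  refine (eLpNorm_sum_le (fun i _ => (hs i).norm) (by norm_num)).trans ?_
  refine Finset.sum_le_sum fun i _ => ?_
  rw [eLpNorm_norm]

lemma pc_eq_pair (i : Fin n ⊕ Fin n) (ζ : Phase n) : pc i ζ = pair ζ (pb i) := by
  rw [pair_eq]
  rcases i with j | j <;> simp [pb, basisVec, EuclideanSpace.inner_single_right]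

/-- The norm of `Phase n` is a maximum, so the Fourier theory is imported from the Euclidean model
through `eqE`. That map preserves volume and has norm at most one, so no constants appear. The basis
directions turn directional moments into coordinate moments. -/
lemma exists_amplitude {b : Phase n → ℂ} (hb : ContDiff ℝ ∞ b)
    (hfin : ∀ m, eLpNorm (iteratedFDeriv ℝ m b) 2 volume < ⊤) :
    ∃ g : Phase n → ℂ, AEStronglyMeasurable g volume ∧
      eLpNorm g 2 volume ≤ eLpNorm (iteratedFDeriv ℝ 0 b) 2 volume ∧
      (∀ i m, eLpNorm (fun ζ => (pc i ζ) ^ m • g ζ) 2 volume ≤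
        eLpNorm (iteratedFDeriv ℝ m b) 2 volume) ∧
      (Integrable g volume → b = syn g) := by
  have hb' : ContDiff ℝ ∞ (b ∘ eqE) := hb.comp eqE.contDiff
  have hle : ∀ m, eLpNorm (iteratedFDeriv ℝ m (b ∘ eqE)) 2 volume ≤
      eLpNorm (iteratedFDeriv ℝ m b) 2 volume := fun m => by
    rw [← eLpNorm_comp_measurePreserving (g := iteratedFDeriv ℝ m b)
      (aestronglyMeasurable_iteratedFDeriv hb m) mp_eqE]
    exact eLpNorm_mono fun v => norm_iteratedFDeriv_comp_eqE_le hb m v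
  obtain ⟨g, hg, hgm, hgi⟩ := exists_fourier_repr hb' fun m =>
    ⟨aestronglyMeasurable_iteratedFDeriv hb' m,
      (hle m).trans_lt (hfin m)⟩
  have hG : AEStronglyMeasurable (g ∘ eqE.symm) volume :=
    hg.comp_measurePreserving mp_eqE_symm
  refine ⟨g ∘ eqE.symm, hG, ?_, fun i m => ?_, fun hwt => ?_⟩
  · have h0 := hgm 0 0
    simp only [pow_zero, one_smul, ENNReal.ofReal_one, one_mul] at h0
    rw [eLpNorm_comp_measurePreserving hg mp_eqE_symm]
    exact h0.trans (hle 0)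
  · have h1 := (hgm (eqE.symm (pb i)) m).trans (mul_le_mul' (ENNReal.ofReal_le_ofReal
      (pow_le_one₀ (norm_nonneg _) (norm_eqE_symm_pb_le i))) (hle m))
    rw [ENNReal.ofReal_one, one_mul] at h1
    refine le_of_eq_of_le ?_ h1
    have h2 : AEStronglyMeasurable (fun ζ => (pc i ζ) ^ m • (g ∘ eqE.symm) ζ) volume :=
      ((pc i).continuous.pow m).aestronglyMeasurable.smul hG
    rw [← eLpNorm_comp_measurePreserving (f := eqE) h2 mp_eqE]
    congr 1
    funext v
    simp only [Function.comp_apply, pc_eq_pair, inner_eqE,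
      ContinuousLinearEquiv.apply_symm_apply, ContinuousLinearEquiv.symm_apply_apply]
  · funext z
    have hgint : Integrable g volume := by
      have := mp_eqE.integrable_comp_of_integrable hwt
      simpa only [Function.comp_def, ContinuousLinearEquiv.symm_apply_apply] using this
    have h1 := hgi hgint (eqE.symm z)
    have h2 := syn_eqE (g ∘ eqE.symm) (eqE.symm z)
    simp only [Function.comp_def, ContinuousLinearEquiv.apply_symm_apply,
      ContinuousLinearEquiv.symm_apply_apply] at h1 h2 ⊢
    rw [h1, h2]

/-- Smooth functions with square integrable derivatives are Fourier syntheses of amplitudes whose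
moments are controlled by the derivatives. -/
lemma exists_syn (n : ℕ) : ∃ K : ℕ → ℝ, ∀ b : Phase n → ℂ, ContDiff ℝ ∞ b →
    (∀ m, eLpNorm (iteratedFDeriv ℝ m b) 2 volume < ⊤) →
    ∃ g : Phase n → ℂ, Wt g ∧ b = syn g ∧
      ∀ m, eLpNorm (fun ζ => ‖ζ‖ ^ m • g ζ) 2 volume ≤
        ENNReal.ofReal (K m) * eLpNorm (iteratedFDeriv ℝ m b) 2 volume := by
  -- For `m > 0`: `(2n)^(m-1)` from comparing the norm with the coordinates, and `2n` for the number
  -- of coordinates. Order zero is Plancherel.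
  refine ⟨fun m => if m = 0 then 1 else (2 * n : ℝ) ^ (m - 1) * (2 * n), fun b hb hfin => ?_⟩
  obtain ⟨g, hG, hg0, hi, hgi⟩ := exists_amplitude hb hfin
  have hfinal : ∀ m, eLpNorm (fun ζ => ‖ζ‖ ^ m • g ζ) 2 volume ≤
      ENNReal.ofReal (if m = 0 then 1 else (2 * n : ℝ) ^ (m - 1) * (2 * n)) *
        eLpNorm (iteratedFDeriv ℝ m b) 2 volume := by
    intro m
    rcases m with _ | m
    · simpa only [pow_zero, one_smul, ENNReal.ofReal_one, one_mul, if_true] using hg0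
    · simp only [Nat.succ_ne_zero, if_false, Nat.add_sub_cancel]
      refine (eLpNorm_norm_pow_le m hG).trans ?_
      rw [ENNReal.ofReal_mul (by positivity), mul_assoc]
      refine mul_le_mul' le_rfl ((Finset.sum_le_sum fun i _ => hi i (m + 1)).trans ?_)
      simp only [Finset.sum_const, Finset.card_univ, Fintype.card_sum, Fintype.card_fin,
        nsmul_eq_mul]
      rw [show (2 * n : ℝ) = ((n + n : ℕ) : ℝ) by push_cast; ring, ENNReal.ofReal_natCast]
  have hwt : Wt g := wt_of_memLp hG fun m =>
    (hfinal m).trans_lt (ENNReal.mul_lt_top ENNReal.ofReal_lt_top (hfin m))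
  exact ⟨g, hwt, hgi hwt.integrable, hfinal⟩

/-- A function with integrable derivatives is the Fourier synthesis of a rapidly decreasing
amplitude, with a bound that is uniform in the function. -/
lemma exists_syn_of_decay (n R : ℕ) (hR : 2 * n + 1 ≤ R) : ∃ C : ℝ, 0 ≤ C ∧
    ∀ (q : Phase n → ℂ) (A : ℝ), ContDiff ℝ ∞ q →
    (∀ m ≤ R, ∀ w, ‖iteratedFDeriv ℝ m q w‖ ≤ A * ((1 + ‖w‖) ^ (2 * n + 1))⁻¹) →
    ∃ k : Phase n → ℂ, Continuous k ∧ (∀ v, ‖k v‖ ≤ C * A * ((1 + ‖v‖) ^ R)⁻¹) ∧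
      q = syn k := by
  set I : ℝ := ∫ ζ : Phase n, ((1 + ‖ζ‖) ^ (2 * n + 1))⁻¹ with hI
  have hI0 : 0 ≤ I := integral_nonneg fun ζ => by positivity
  refine ⟨2 ^ R * (I + 2 ^ R * ((R + 1) * I)), by positivity, fun q A hq hbd => ?_⟩
  have hA : 0 ≤ A := by
    have := (norm_nonneg _).trans (hbd 0 (Nat.zero_le _) 0)
    simpa using this
  have hq' : ContDiff ℝ ∞ (q ∘ eqE) := hq.comp eqE.contDiff
  have hint : Integrable (fun v : PhaseE n => A * ((1 + ‖eqE v‖) ^ (2 * n + 1))⁻¹) volume :=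
    (mp_eqE.integrable_comp_of_integrable integrable_inv_pow).const_mul A
  have hIe : ∫ v : PhaseE n, A * ((1 + ‖eqE v‖) ^ (2 * n + 1))⁻¹ = A * I := by
    rw [integral_const_mul, hI, ← mp_eqE.integral_comp me_eqE]
  have hbd' : ∀ m ≤ R, ∀ v, ‖iteratedFDeriv ℝ m (q ∘ eqE) v‖ ≤
      A * ((1 + ‖eqE v‖) ^ (2 * n + 1))⁻¹ := fun m hm v =>
    (norm_iteratedFDeriv_comp_eqE_le hq m v).trans (hbd m hm _)
  have hi : ∀ m ≤ R, Integrable (iteratedFDeriv ℝ m (q ∘ eqE)) volume := fun m hm =>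
    hint.mono' (aestronglyMeasurable_iteratedFDeriv hq' m)
      (Filter.Eventually.of_forall (hbd' m hm))
  have hi0 : Integrable (q ∘ eqE) volume :=
    hint.mono' hq'.continuous.aestronglyMeasurable (Filter.Eventually.of_forall fun v => by
      simpa using hbd' 0 (Nat.zero_le _) v)
  have hm : ∀ m ≤ R, ∫ v, ‖iteratedFDeriv ℝ m (q ∘ eqE) v‖ ≤ A * I := fun m hm => by
    rw [← hIe]
    exact integral_mono (hi m hm).norm hint (hbd' m hm)
  -- Powers of the frequency are paid for by L¹ norms of derivatives. Only `j = 0` and `j = R` are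
  -- needed, since `(1 + ‖w‖)^R` is at most a constant times `1 + ‖w‖^R`.
  have hdecay : ∀ j ≤ R, ∀ w, ‖w‖ ^ j * ‖𝓕 (q ∘ eqE) w‖ ≤ 2 ^ j * ((j + 1) * (A * I)) := by
    intro j hj w
    have := Real.pow_mul_norm_iteratedFDeriv_fourier_le (f := q ∘ eqE) (K := 0) (N := R) (k := 0)
      (n := j) (hq'.of_le (by exact_mod_cast le_top)) (fun k l hk hl => ?_) le_rfl
      (by exact_mod_cast hj) w
    · rw [norm_iteratedFDeriv_zero] at this
      refine this.trans ?_
      simp only [pow_zero, CharP.cast_eq_zero, mul_zero, zero_add, one_mul, Finset.range_one,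
        Finset.sum_product, Finset.sum_singleton]
      refine mul_le_mul_of_nonneg_left ?_ (by positivity)
      refine (Finset.sum_le_card_nsmul _ _ (A * I) fun m hm' => hm m ?_).trans ?_
      · have := Finset.mem_range.1 hm'; omega
      · simp
    · have hk0 : k = 0 := by simpa using hk
      subst hk0
      simpa using (hi l (by exact_mod_cast hl)).norm
  have hc : Continuous (𝓕 (q ∘ eqE)) := VectorFourier.fourierIntegral_continuous
    Real.continuous_fourierChar (continuous_inner (𝕜 := ℝ) (E := PhaseE n)) hi0
  have hkd : ∀ v : Phase n, ‖𝓕 (q ∘ eqE) (eqE.symm v)‖ ≤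
      2 ^ R * (I + 2 ^ R * ((R + 1) * I)) * A * ((1 + ‖v‖) ^ R)⁻¹ := by
    intro v
    rw [← div_eq_mul_inv, le_div_iff₀ (by positivity)]
    set w := eqE.symm v with hw
    have hvw : ‖v‖ ≤ ‖w‖ := by simpa [hw] using norm_eqE_le w
    have h0 := hdecay 0 (Nat.zero_le _) w
    have h1 := hdecay R le_rfl w
    simp only [pow_zero, one_mul, CharP.cast_eq_zero, zero_add] at h0
    have h2 : (1 + ‖v‖) ^ R ≤ 2 ^ R * (1 + ‖w‖ ^ R) := by
      calc (1 + ‖v‖) ^ R ≤ (1 + ‖w‖) ^ R := by gcongr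
        _ ≤ 2 ^ (R - 1) * (1 ^ R + ‖w‖ ^ R) := add_pow_le zero_le_one (norm_nonneg _) R
        _ ≤ 2 ^ R * (1 + ‖w‖ ^ R) := by
          rw [one_pow]
          gcongr
          · norm_num
          · omega
    calc _ ≤ ‖𝓕 (q ∘ eqE) w‖ * (2 ^ R * (1 + ‖w‖ ^ R)) := by gcongr
      _ = 2 ^ R * (‖𝓕 (q ∘ eqE) w‖ + ‖w‖ ^ R * ‖𝓕 (q ∘ eqE) w‖) := by ring
      _ ≤ 2 ^ R * (A * I + 2 ^ R * ((R + 1) * (A * I))) := by gcongr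
      _ = _ := by ring
  refine ⟨𝓕 (q ∘ eqE) ∘ eqE.symm, hc.comp eqE.symm.continuous, hkd, ?_⟩
  have hFi : Integrable (𝓕 (q ∘ eqE) ∘ eqE.symm) volume := by
    refine (integrable_inv_pow.const_mul (2 ^ R * (I + 2 ^ R * ((R + 1) * I)) * A)).mono'
      (hc.comp eqE.symm.continuous).aestronglyMeasurable
      (Filter.Eventually.of_forall fun v => (hkd v).trans ?_)
    have : (1 + ‖v‖) ^ (2 * n + 1) ≤ (1 + ‖v‖) ^ R :=
      pow_le_pow_right₀ (by linarith [norm_nonneg v]) hR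
    gcongr
  have hFi' : Integrable (𝓕 (q ∘ eqE)) volume := by
    have := mp_eqE.integrable_comp_of_integrable hFi
    simpa [Function.comp_def] using this
  funext z
  have h1 := congrFun (hq'.continuous.fourierInv_fourier_eq hi0 hFi') (eqE.symm z)
  have h2 := syn_eqE (𝓕 (q ∘ eqE) ∘ eqE.symm) (eqE.symm z)
  rw [show (𝓕 (q ∘ eqE) ∘ eqE.symm) ∘ eqE = 𝓕 (q ∘ eqE) by
    funext v; simp, h1] at h2
  simpa using h2.symm

end PhaseFourierBounds

/-! ### The twisted product and its derivatives -/

section TwistedProduct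

variable {n : ℕ}

/-- The rotation `(p, q) ↦ π (-q, p)` of phase space. -/
def rot : Phase n →L[ℝ] Phase n :=
  Real.pi • ((-(ContinuousLinearMap.snd ℝ (Pos n) (Pos n))).prod (ContinuousLinearMap.fst ℝ _ _))

/-- Multiplication of an amplitude by a linear function. -/
def lm (l : Phase n →L[ℝ] ℂ) (g : Phase n → ℂ) : Phase n → ℂ := fun ζ => l ζ * g ζ

/-- The linear function `ζ ↦ 2πi ζ·v`, the multiplier of the derivative along `v`. -/
def dsym (v : Phase n) : Phase n →L[ℝ] ℂ :=
  (2 * Real.pi * Complex.I) • Complex.ofRealCLM.comp (∑ i, pc i v • pc i : Phase n →L[ℝ] ℝ)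

lemma dsym_apply (v ζ : Phase n) : dsym v ζ = 2 * Real.pi * Complex.I * (pair ζ v : ℝ) := by
  simp only [dsym, pair, smul_apply, ContinuousLinearMap.comp_apply, sum_apply,
    Complex.ofRealCLM_apply, smul_eq_mul]
  congr 3
  exact funext fun i => mul_comm _ _

lemma dsym_comm (v ζ : Phase n) : dsym v ζ = dsym ζ v := by
  rw [dsym_apply, dsym_apply, pair_comm]

/-- The `i`-th coordinate of `rot ζ`. -/
def rc (i : Fin n ⊕ Fin n) : Phase n →L[ℝ] ℂ := Complex.ofRealCLM.comp ((pc i).comp rot)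

lemma rc_apply (i : Fin n ⊕ Fin n) (ζ : Phase n) : rc i ζ = (pc i (rot ζ) : ℝ) := rfl

lemma Wt.lm {g : Phase n → ℂ} (hg : Wt g) (l : Phase n →L[ℝ] ℂ) : Wt (lm l g) :=
  hg.mul l.continuous 1 (C := ‖l‖) fun ζ => (l.le_opNorm ζ).trans (by
    rw [pow_one]
    exact mul_le_mul_of_nonneg_left (by linarith) (norm_nonneg l))

/-- The twisted product `∫ a(z + τ rot ζ) g(ζ) exp (2πi ζ·z) dζ` of a symbol and an amplitude. -/
def tw (τ : ℝ) (a g : Phase n → ℂ) (z : Phase n) : ℂ :=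
  ∫ ζ, a (z + τ • rot ζ) * g ζ * eph ζ z

lemma Gam.growth {F : Type*} [NormedAddCommGroup F] [NormedSpace ℝ F] {r : ℕ} {f : Phase n → F}
    (hf : Gam r f) (m : ℕ) :
    ∃ C, 0 ≤ C ∧ ∀ z, ‖iteratedFDeriv ℝ m f z‖ ≤ C * (1 + ‖z‖) ^ (2 * r) := by
  obtain ⟨C, hC0, hC⟩ := hf.2 m
  refine ⟨C * (1 + 2 * n) ^ r, by positivity, fun z => (hC z).trans ?_⟩
  simp only [zpow_natCast]
  rw [pow_mul, mul_assoc, ← mul_pow]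
  have := (om_pos z).le
  have := om_le z
  gcongr

lemma one_add_norm_shift_le {R T : ℝ} (hT0 : 0 ≤ T) {z : Phase n} {τ : ℝ}
    (hz : ‖z‖ ≤ R) (hτ : |τ| ≤ T) (ζ : Phase n) :
    1 + ‖z + τ • rot ζ‖ ≤ (1 + R + T * ‖(rot : Phase n →L[ℝ] Phase n)‖) * (1 + ‖ζ‖) := by
  have h1 : ‖z + τ • rot ζ‖ ≤ R + T * (‖(rot : Phase n →L[ℝ] Phase n)‖ * ‖ζ‖) := by
    refine (norm_add_le _ _).trans (add_le_add hz ?_)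
    rw [norm_smul, Real.norm_eq_abs]
    exact mul_le_mul hτ (rot.le_opNorm ζ) (norm_nonneg _) hT0
  have hR : 0 ≤ R := (norm_nonneg z).trans hz
  have h0 := norm_nonneg ζ
  have h2 : 0 ≤ T * ‖(rot : Phase n →L[ℝ] Phase n)‖ := by positivity
  nlinarith [mul_nonneg hR h0]

lemma continuous_shift (z : Phase n) (τ : ℝ) : Continuous fun ζ : Phase n => z + τ • rot ζ := by
  fun_prop

lemma aesm_tw {a g : Phase n → ℂ} (ha : Continuous a) (hg : AEStronglyMeasurable g volume)
    (τ : ℝ) (z : Phase n) :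
    AEStronglyMeasurable (fun ζ => a (z + τ • rot ζ) * g ζ * eph ζ z) volume :=
  ((ha.comp (continuous_shift z τ)).aestronglyMeasurable.mul hg).mul
    (continuous_eph.comp (by fun_prop : Continuous fun ζ : Phase n => (ζ, z))).aestronglyMeasurable

lemma integrable_tw {r : ℕ} {a g : Phase n → ℂ} (ha : Gam r a) (hg : Wt g) (τ : ℝ)
    (z : Phase n) : Integrable (fun ζ => a (z + τ • rot ζ) * g ζ * eph ζ z) volume := by
  obtain ⟨C, hC0, hC⟩ := ha.growth 0
  simp only [norm_iteratedFDeriv_zero] at hC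
  set B := 1 + ‖z‖ + |τ| * ‖(rot : Phase n →L[ℝ] Phase n)‖
  refine ((hg.2 (2 * r)).const_mul (C * B ^ (2 * r))).mono'
    (aesm_tw ha.1.continuous hg.1 τ z) (Filter.Eventually.of_forall fun ζ => ?_)
  rw [norm_mul, norm_eph, mul_one, norm_mul]
  calc _ ≤ C * (B * (1 + ‖ζ‖)) ^ (2 * r) * ‖g ζ‖ := by
        refine mul_le_mul_of_nonneg_right ((hC _).trans ?_) (norm_nonneg _)
        have := one_add_norm_shift_le (abs_nonneg τ) le_rfl le_rfl ζ (z := z) (τ := τ)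
        gcongr
    _ = _ := by rw [mul_pow]; ring

/-- The derivative of the integrand of `tw` in `(τ, z)`. -/
def twDeriv (a g : Phase n → ℂ) (p : ℝ × Phase n) (ζ : Phase n) : ℝ × Phase n →L[ℝ] ℂ :=
  (g ζ * eph ζ p.2) • ((fderiv ℝ a (p.2 + p.1 • rot ζ)).comp
      (ContinuousLinearMap.snd ℝ ℝ (Phase n) +
        (ContinuousLinearMap.fst ℝ ℝ (Phase n)).smulRight (rot ζ)) +
    a (p.2 + p.1 • rot ζ) • (dsym ζ).comp (ContinuousLinearMap.snd ℝ ℝ (Phase n)))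

lemma hasFDerivAt_eph (ζ z : Phase n) : HasFDerivAt (eph ζ) (eph ζ z • dsym ζ) z := by
  have h1 : HasFDerivAt (fun z => dsym ζ z) (dsym ζ) z := (dsym ζ).hasFDerivAt
  have h2 := h1.cexp
  have e : eph ζ = fun z => Complex.exp (dsym ζ z) := by
    funext z
    rw [dsym_comm, dsym_apply, eph]
  rw [e]
  exact h2

lemma hasFDerivAt_tw_integrand {a : Phase n → ℂ} (ha : Differentiable ℝ a) (g : Phase n → ℂ)
    (ζ : Phase n) (p : ℝ × Phase n) :
    HasFDerivAt (fun p : ℝ × Phase n => a (p.2 + p.1 • rot ζ) * g ζ * eph ζ p.2)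
      (twDeriv a g p ζ) p := by
  have h0 : HasFDerivAt (fun p : ℝ × Phase n => p.2 + p.1 • rot ζ)
      (ContinuousLinearMap.snd ℝ ℝ (Phase n) +
        (ContinuousLinearMap.fst ℝ ℝ (Phase n)).smulRight (rot ζ)) p :=
    (ContinuousLinearMap.snd ℝ ℝ (Phase n) +
        (ContinuousLinearMap.fst ℝ ℝ (Phase n)).smulRight (rot ζ)).hasFDerivAt
  have h1 := (ha (p.2 + p.1 • rot ζ)).hasFDerivAt.comp p h0
  have h2 := (hasFDerivAt_eph ζ p.2).comp p (hasFDerivAt_snd (𝕜 := ℝ) (p := p))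
  have h3 := (h1.mul_const (g ζ)).mul h2
  refine h3.congr_fderiv ?_
  refine ContinuousLinearMap.ext fun v => ?_
  simp [twDeriv]
  ring

lemma norm_dsym_le (v : Phase n) : ‖dsym v‖ ≤ 2 * Real.pi * (2 * n) * ‖v‖ := by
  refine ContinuousLinearMap.opNorm_le_bound _ (by positivity) fun ζ => ?_
  rw [dsym_apply]
  have h1 : |pair ζ v| ≤ 2 * n * (‖ζ‖ * ‖v‖) := by
    refine (Finset.abs_sum_le_sum_abs _ _).trans ?_
    refine (Finset.sum_le_card_nsmul _ _ (‖ζ‖ * ‖v‖) fun i _ => ?_).trans (le_of_eq ?_)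
    · rw [abs_mul]
      exact mul_le_mul (abs_pc_le i ζ) (abs_pc_le i v) (abs_nonneg _) (norm_nonneg _)
    · rw [Finset.card_univ, Fintype.card_sum, Fintype.card_fin, nsmul_eq_mul]
      push_cast; ring
  simp only [norm_mul, Complex.norm_ofNat, Complex.norm_real, Complex.norm_I, mul_one,
    Real.norm_eq_abs, abs_of_pos Real.pi_pos]
  calc _ ≤ 2 * Real.pi * (2 * n * (‖ζ‖ * ‖v‖)) := by gcongr
    _ = _ := by ring

lemma norm_shiftDeriv_le (ζ : Phase n) : ‖ContinuousLinearMap.snd ℝ ℝ (Phase n) +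
      (ContinuousLinearMap.fst ℝ ℝ (Phase n)).smulRight (rot ζ)‖ ≤ 
  (1 + ‖(rot : Phase n →L[ℝ] Phase n)‖) * (1 + ‖ζ‖) := by
  set N := ‖(rot : Phase n →L[ℝ] Phase n)‖
  refine (norm_add_le _ _).trans ?_
  rw [ContinuousLinearMap.norm_smulRight_apply]
  have e1 := ContinuousLinearMap.norm_snd_le ℝ ℝ (Phase n)
  have e2 := ContinuousLinearMap.norm_fst_le ℝ ℝ (Phase n)
  have e3 : ‖rot ζ‖ ≤ N * ‖ζ‖ := rot.le_opNorm ζ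
  have e4 : 0 ≤ N := norm_nonneg _
  calc _ ≤ 1 + 1 * (N * ‖ζ‖) := by gcongr
    _ ≤ _ := by nlinarith [norm_nonneg ζ]

lemma norm_dsym_comp_snd_le (ζ : Phase n) : ‖(dsym ζ).comp (ContinuousLinearMap.snd ℝ ℝ (Phase n))‖ ≤
    2 * Real.pi * (2 * n) * (1 + ‖ζ‖) := by
  refine (ContinuousLinearMap.opNorm_comp_le _ _).trans ?_
  have e1 := ContinuousLinearMap.norm_snd_le ℝ ℝ (Phase n)
  have e2 := norm_dsym_le ζ
  calc _ ≤ 2 * Real.pi * (2 * n) * ‖ζ‖ * 1 := by gcongr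
    _ ≤ _ := by
      rw [mul_one]
      gcongr
      linarith

/-- This is the integrable majorant for differentiating under the integral: for bounded `(τ, z)` the
growth of `a` becomes polynomial growth in `ζ`, and one more power comes from differentiating the
shift or the character. -/
lemma norm_twDeriv_le {r : ℕ} {a : Phase n → ℂ} (ha : Gam r a) (R T : ℝ) (hT : 0 ≤ T) :
    ∃ C, 0 ≤ C ∧ ∀ (g : Phase n → ℂ) (p : ℝ × Phase n) (ζ : Phase n), ‖p.2‖ ≤ R → |p.1| ≤ T →
      ‖twDeriv a g p ζ‖ ≤ C * ((1 + ‖ζ‖) ^ (2 * r + 1) * ‖g ζ‖) := by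
  obtain ⟨C₀, hC₀, h0⟩ := ha.growth 0
  obtain ⟨C₁, hC₁, h1⟩ := ha.growth 1
  simp only [norm_iteratedFDeriv_zero] at h0
  simp only [norm_iteratedFDeriv_one] at h1
  set N := ‖(rot : Phase n →L[ℝ] Phase n)‖
  set B := 1 + R + T * N
  refine ⟨|B| ^ (2 * r) * (C₁ * (1 + N) + C₀ * (2 * Real.pi * (2 * n))), by positivity,
    fun g p ζ hp hτ => ?_⟩
  have hsh := one_add_norm_shift_le hT hp hτ ζ
  have hB : 1 + ‖p.2 + p.1 • rot ζ‖ ≤ |B| * (1 + ‖ζ‖) :=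
    hsh.trans (mul_le_mul_of_nonneg_right (le_abs_self B) (by positivity))
  have ha0 : ‖a (p.2 + p.1 • rot ζ)‖ ≤ C₀ * (|B| * (1 + ‖ζ‖)) ^ (2 * r) :=
    (h0 _).trans (by gcongr)
  have ha1 : ‖fderiv ℝ a (p.2 + p.1 • rot ζ)‖ ≤ C₁ * (|B| * (1 + ‖ζ‖)) ^ (2 * r) :=
    (h1 _).trans (by gcongr)
  have hL := norm_shiftDeriv_le ζ
  have hD := norm_dsym_comp_snd_le ζ
  rw [twDeriv, norm_smul, norm_mul, norm_eph, mul_one]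
  calc _ ≤ ‖g ζ‖ * (C₁ * (|B| * (1 + ‖ζ‖)) ^ (2 * r) * ((1 + N) * (1 + ‖ζ‖)) +
        C₀ * (|B| * (1 + ‖ζ‖)) ^ (2 * r) * (2 * Real.pi * (2 * n) * (1 + ‖ζ‖))) := by
        refine mul_le_mul_of_nonneg_left ((norm_add_le _ _).trans (add_le_add ?_ ?_))
          (norm_nonneg _)
        · refine (ContinuousLinearMap.opNorm_comp_le _ _).trans ?_
          gcongr
        · rw [norm_smul]
          gcongr
    _ = _ := by rw [mul_pow]; ring

lemma aesm_twDeriv {a g : Phase n → ℂ} (ha : ContDiff ℝ ∞ a) (hg : AEStronglyMeasurable g volume)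
    (p : ℝ × Phase n) : AEStronglyMeasurable (twDeriv a g p) volume := by
  have : SecondCountableTopologyEither (Phase n) (ℝ × Phase n →L[ℝ] ℂ) := ⟨Or.inl inferInstance⟩
  have hsh := continuous_shift p.2 p.1
  have hd : Continuous (dsym : Phase n → Phase n →L[ℝ] ℂ) := by
    unfold dsym
    fun_prop
  have h1 : Continuous (fun ζ : Phase n => (fderiv ℝ a (p.2 + p.1 • rot ζ)).comp
      (ContinuousLinearMap.snd ℝ ℝ (Phase n) +
        (ContinuousLinearMap.fst ℝ ℝ (Phase n)).smulRight (rot ζ)) +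
    a (p.2 + p.1 • rot ζ) • (dsym ζ).comp (ContinuousLinearMap.snd ℝ ℝ (Phase n))) := by
    refine Continuous.add ?_ ?_
    · refine ((ha.continuous_fderiv (by simp)).comp hsh).clm_comp ?_
      refine continuous_const.add ?_
      exact ((ContinuousLinearMap.smulRightL ℝ (ℝ × Phase n) (Phase n))
        (ContinuousLinearMap.fst ℝ ℝ (Phase n))).continuous.comp rot.continuous
    · exact (ha.continuous.comp hsh).smul (hd.clm_comp continuous_const)
  exact (hg.mul (continuous_eph.comp
    (by fun_prop : Continuous fun ζ : Phase n => (ζ, p.2))).aestronglyMeasurable).smul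
      h1.aestronglyMeasurable

/-- One dominated-convergence argument in the joint variable `(τ, z)` supplies both the Leibniz rule
in `z` and the derivative in `τ`. -/
lemma hasFDerivAt_tw {r : ℕ} {a g : Phase n → ℂ} (ha : Gam r a) (hg : Wt g) (p : ℝ × Phase n) :
    Integrable (twDeriv a g p) volume ∧
    HasFDerivAt (fun p : ℝ × Phase n => tw p.1 a g p.2) (∫ ζ, twDeriv a g p ζ) p := by
  obtain ⟨C, hC0, hC⟩ := norm_twDeriv_le ha (‖p.2‖ + 1) (|p.1| + 1) (by positivity)
  have hb : Integrable (fun ζ => C * ((1 + ‖ζ‖) ^ (2 * r + 1) * ‖g ζ‖)) volume :=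
    (hg.2 (2 * r + 1)).const_mul C
  have hm := aesm_twDeriv ha.1 hg.1 p
  refine ⟨hb.mono' hm (Filter.Eventually.of_forall fun ζ =>
    hC g p ζ (by linarith) (by linarith)), ?_⟩
  refine hasFDerivAt_integral_of_dominated_of_fderiv_le (Metric.ball_mem_nhds p zero_lt_one)
    (Filter.Eventually.of_forall fun q => aesm_tw ha.1.continuous hg.1 q.1 q.2)
    (integrable_tw ha hg p.1 p.2) hm (Filter.Eventually.of_forall fun ζ q hq => hC g q ζ ?_ ?_) hb
    (Filter.Eventually.of_forall fun ζ q _ =>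
      hasFDerivAt_tw_integrand (ha.1.differentiable (by simp)) g ζ q)
  · have h1 : ‖q - p‖ < 1 := by simpa [dist_eq_norm] using hq
    have h2 : ‖q.2 - p.2‖ ≤ ‖q - p‖ := norm_snd_le (q - p)
    have h3 := norm_le_norm_add_norm_sub' q.2 p.2
    linarith
  · have h1 : ‖q - p‖ < 1 := by simpa [dist_eq_norm] using hq
    have h2 : ‖q.1 - p.1‖ ≤ ‖q - p‖ := norm_fst_le (q - p)
    have h3 := norm_le_norm_add_norm_sub' q.1 p.1
    simp only [Real.norm_eq_abs] at h2 h3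
    linarith

lemma differentiable_tw {r : ℕ} {a g : Phase n → ℂ} (ha : Gam r a) (hg : Wt g) (τ : ℝ) :
    Differentiable ℝ (tw τ a g) := fun z =>
  ((hasFDerivAt_tw ha hg (τ, z)).2.comp z
    ((hasFDerivAt_const τ z).prodMk (hasFDerivAt_id z))).differentiableAt

/-- The derivative falls either on the symbol or on the character, where it becomes a linear
multiplier of `g`. Both terms are twisted products again, which drives every later induction on
derivatives. -/
lemma dd_tw {r : ℕ} {a g : Phase n → ℂ} (ha : Gam r a) (hg : Wt g) (τ : ℝ) (v : Phase n) :
    dd v (tw τ a g) = fun z => tw τ (dd v a) g z + tw τ a (lm (dsym v) g) z := by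
  funext z
  obtain ⟨hi, hd⟩ := hasFDerivAt_tw ha hg (τ, z)
  have h1 : HasFDerivAt (tw τ a g) _ z := hd.comp z
    ((hasFDerivAt_const τ z).prodMk (hasFDerivAt_id z))
  rw [dd, h1.fderiv]
  simp only [ContinuousLinearMap.comp_apply, ContinuousLinearMap.prod_apply]
  rw [ContinuousLinearMap.integral_apply hi, tw, tw,
    ← integral_add (integrable_tw (ha.dd v) hg τ z) (integrable_tw ha (hg.lm _) τ z)]
  congr 1
  funext ζ
  simp [twDeriv, dd, lm, dsym_comm ζ v]
  ring

/-- The central exchange: `τ` occurs only in the shift `τ rot ζ`, so each derivative in `τ` uses up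
one derivative of `a` and brings down one factor linear in `ζ`. -/
lemma hasDerivAt_tw {r : ℕ} {a g : Phase n → ℂ} (ha : Gam r a) (hg : Wt g) (τ : ℝ)
    (z : Phase n) :
    HasDerivAt (fun τ => tw τ a g z) (∑ i, tw τ (dd (pb i) a) (lm (rc i) g) z) τ := by
  obtain ⟨hi, hd⟩ := hasFDerivAt_tw ha hg (τ, z)
  have h0 : HasDerivAt (fun t : ℝ => (t, z)) ((1, 0) : ℝ × Phase n) τ :=
    (hasDerivAt_id τ).prodMk (hasDerivAt_const τ z)
  have h1 := hd.comp_hasDerivAt τ h0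
  refine h1.congr_deriv ?_
  rw [ContinuousLinearMap.integral_apply hi]
  have h2 : ∀ ζ, twDeriv a g (τ, z) ζ (1, 0) =
      ∑ i, dd (pb i) a (z + τ • rot ζ) * lm (rc i) g ζ * eph ζ z := by
    intro ζ
    have h2 := dd_eq_sum (phase_sum (n := n)) a (rot ζ) (z + τ • rot ζ)
    have h3 : twDeriv a g (τ, z) ζ (1, 0) =
        (g ζ * eph ζ z) * dd (rot ζ) a (z + τ • rot ζ) := by
      simp [twDeriv, dd]
    rw [h3, h2, Finset.mul_sum]
    refine Finset.sum_congr rfl fun i _ => ?_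
    rw [lm, rc_apply, Complex.real_smul]
    ring
  rw [integral_congr_ae (Filter.Eventually.of_forall h2), integral_finsetSum]
  · rfl
  · exact fun i _ => integrable_tw (ha.dd _) (hg.lm _) τ z

lemma contDiff_tw {r : ℕ} {a g : Phase n → ℂ} (ha : Gam r a) (hg : Wt g) (τ : ℝ) :
    ContDiff ℝ ∞ (tw τ a g) := by
  have key : ∀ m : ℕ, ∀ a g : Phase n → ℂ, Gam r a → Wt g → ContDiff ℝ m (tw τ a g) := by
    intro m
    induction m with
    | zero => exact fun a g ha hg => contDiff_zero.2 (differentiable_tw ha hg τ).continuous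
    | succ m ih =>
      intro a g ha hg
      refine contDiff_succ_of_dd phase_sum (differentiable_tw ha hg τ) fun i => ?_
      rw [dd_tw ha hg]
      exact (ih _ _ (ha.dd _) hg).add (ih _ _ ha (hg.lm _))
  exact contDiff_infty.2 fun m => key m a g ha hg

lemma tw_zero (a g : Phase n → ℂ) (z : Phase n) : tw 0 a g z = a z * syn g z := by
  simp only [tw, syn, zero_smul, add_zero, mul_assoc]
  rw [integral_const_mul]

end TwistedProduct

/-! ### Weyl translations and their superpositions on Schwartz space -/

section Translations

open LineDeriv

variable {n : ℕ}

/-- The Weyl translation `u ↦ exp (2πi p·(x + πh q)) u(x + 2πh q)` for `ζ = (p, q)`. -/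
def wtr (h : ℝ) (ζ : Phase n) (u : Pos n → ℂ) (x : Pos n) : ℂ :=
  Complex.exp (2 * Real.pi * Complex.I * (inner ℝ ζ.1 (x + (Real.pi * h) • ζ.2) : ℝ)) *
    u (x + (2 * Real.pi * h) • ζ.2)

/-- Superposition of Weyl translations. -/
def wop (h : ℝ) (g : Phase n → ℂ) (u : Pos n → ℂ) (x : Pos n) : ℂ := ∫ ζ, g ζ * wtr h ζ u x

lemma norm_wtr (h : ℝ) (ζ : Phase n) (u : Pos n → ℂ) (x : Pos n) :
    ‖wtr h ζ u x‖ = ‖u (x + (2 * Real.pi * h) • ζ.2)‖ := by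
  rw [wtr, norm_mul, Complex.norm_exp]
  simp

lemma continuous_wtr (h : ℝ) {u : Pos n → ℂ} (hu : Continuous u) :
    Continuous fun p : Phase n × Pos n => wtr h p.1 u p.2 := by
  unfold wtr
  refine Continuous.mul ?_ (hu.comp (by fun_prop))
  exact Complex.continuous_exp.comp (continuous_const.mul (Complex.continuous_ofReal.comp
    (Continuous.inner (by fun_prop) (by fun_prop))))

lemma SchwartzMap.exists_norm_le (u : 𝓢(Pos n, ℂ)) : ∃ C, 0 ≤ C ∧ ∀ x, ‖u x‖ ≤ C :=
  ⟨SchwartzMap.seminorm ℂ 0 0 u, apply_nonneg _ _, fun x => SchwartzMap.norm_le_seminorm ℂ u x⟩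

lemma integrable_mul_wtr (h : ℝ) {g : Phase n → ℂ} (hg : Integrable g volume) (u : 𝓢(Pos n, ℂ))
    (x : Pos n) : Integrable (fun ζ => g ζ * wtr h ζ u x) volume := by
  obtain ⟨C, hC0, hC⟩ := SchwartzMap.exists_norm_le u
  have hm : AEStronglyMeasurable (fun ζ => wtr h ζ u x) volume :=
    ((continuous_wtr h u.continuous).comp
      (by fun_prop : Continuous fun ζ : Phase n => (ζ, x))).aestronglyMeasurable
  refine (hg.norm.mul_const C).mono' (hg.1.mul hm) (Filter.Eventually.of_forall fun ζ => ?_)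
  rw [norm_mul, norm_wtr]
  exact mul_le_mul_of_nonneg_left (hC _) (norm_nonneg _)

/-- The derivative of a Weyl translation in the space variable. -/
def wtrDeriv (h : ℝ) (g : Phase n → ℂ) (u : 𝓢(Pos n, ℂ)) (x : Pos n) (ζ : Phase n) :
    Pos n →L[ℝ] ℂ :=
  (g ζ * wtr h ζ u x) • (dsym ζ).comp (ContinuousLinearMap.inl ℝ (Pos n) (Pos n)) +
    (g ζ * Complex.exp (2 * Real.pi * Complex.I *
      (inner ℝ ζ.1 (x + (Real.pi * h) • ζ.2) : ℝ))) •
      fderiv ℝ u (x + (2 * Real.pi * h) • ζ.2)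

lemma dsym_inl (ζ : Phase n) (v : Pos n) :
    dsym ζ (v, 0) = 2 * Real.pi * Complex.I * (inner ℝ ζ.1 v : ℝ) := by
  rw [← dsym_comm, dsym_apply, pair_eq]
  simp

lemma hasFDerivAt_mul_wtr (h : ℝ) (g : Phase n → ℂ) (u : 𝓢(Pos n, ℂ)) (ζ : Phase n)
    (x : Pos n) : HasFDerivAt (fun x => g ζ * wtr h ζ u x) (wtrDeriv h g u x ζ) x := by
  have hs : ∀ c : Pos n, HasFDerivAt (fun x : Pos n => x + c) (ContinuousLinearMap.id ℝ _) x :=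
    fun c => (hasFDerivAt_id x).add_const c
  have h1 : HasFDerivAt (fun x : Pos n => dsym ζ (x + (Real.pi * h) • ζ.2, 0))
      ((dsym ζ).comp (ContinuousLinearMap.inl ℝ (Pos n) (Pos n))) x := by
    have e2 : HasFDerivAt (fun y : Pos n => dsym ζ (y, 0))
        ((dsym ζ).comp (ContinuousLinearMap.inl ℝ (Pos n) (Pos n))) (x + (Real.pi * h) • ζ.2) :=
      ((dsym ζ).comp (ContinuousLinearMap.inl ℝ (Pos n) (Pos n))).hasFDerivAt
    exact (e2.comp x (hs _)).congr_fderiv (ContinuousLinearMap.comp_id _)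
  have h2 : HasFDerivAt (fun x : Pos n => u (x + (2 * Real.pi * h) • ζ.2))
      (fderiv ℝ u (x + (2 * Real.pi * h) • ζ.2)) x := by
    have e2 : HasFDerivAt u (fderiv ℝ u (x + (2 * Real.pi * h) • ζ.2))
      (x + (2 * Real.pi * h) • ζ.2) := u.differentiableAt.hasFDerivAt
    exact (e2.comp x (hs _)).congr_fderiv (ContinuousLinearMap.comp_id _)
  have h3 := (h1.cexp.mul h2).const_mul (g ζ)
  simp only [dsym_inl] at h3
  refine h3.congr_fderiv ?_
  refine ContinuousLinearMap.ext fun v => ?_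
  simp only [wtrDeriv, wtr, smul_apply, add_apply, smul_eq_mul]
  ring

lemma norm_wtrDeriv_le (h : ℝ) (u : 𝓢(Pos n, ℂ)) : ∃ C, 0 ≤ C ∧ ∀ g x (ζ : Phase n),
    ‖wtrDeriv h g u x ζ‖ ≤ C * ((1 + ‖ζ‖) ^ 1 * ‖g ζ‖) := by
  obtain ⟨C, hC0, hC⟩ := SchwartzMap.exists_norm_le u
  set D := SchwartzMap.seminorm ℂ 0 1 u
  have hD0 : 0 ≤ D := apply_nonneg _ _
  have hD : ∀ x, ‖fderiv ℝ u x‖ ≤ D := fun x => by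
    rw [← norm_iteratedFDeriv_one]
    exact SchwartzMap.norm_iteratedFDeriv_le_seminorm ℂ u 1 x
  refine ⟨C * (2 * Real.pi * (2 * n)) + D, by positivity, fun g x ζ => ?_⟩
  have h1 : ‖(dsym ζ).comp (ContinuousLinearMap.inl ℝ (Pos n) (Pos n))‖ ≤
      2 * Real.pi * (2 * n) * ‖ζ‖ := by
    refine ContinuousLinearMap.opNorm_le_bound _ (by positivity) fun v => ?_
    have := ((dsym ζ).le_opNorm (v, 0)).trans
      (mul_le_mul_of_nonneg_right (norm_dsym_le ζ) (norm_nonneg _))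
    simpa using this
  have h2 : ‖Complex.exp (2 * Real.pi * Complex.I *
      (inner ℝ ζ.1 (x + (Real.pi * h) • ζ.2) : ℝ))‖ = 1 := by
    rw [Complex.norm_exp]; simp
  refine (norm_add_le _ _).trans ?_
  rw [norm_smul, norm_smul, norm_mul, norm_mul, norm_wtr, h2, mul_one, pow_one]
  calc _ ≤ ‖g ζ‖ * C * (2 * Real.pi * (2 * n) * ‖ζ‖) + ‖g ζ‖ * D := by
        gcongr
        · exact hC _
        · exact hD _
    _ ≤ ‖g ζ‖ * C * (2 * Real.pi * (2 * n) * (1 + ‖ζ‖)) + ‖g ζ‖ * (D * (1 + ‖ζ‖)) := by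
        have := norm_nonneg ζ
        gcongr
        · linarith
        · exact le_mul_of_one_le_right hD0 (by linarith)
    _ = _ := by ring

lemma aesm_wtrDeriv (h : ℝ) {g : Phase n → ℂ} (hg : AEStronglyMeasurable g volume)
    (u : 𝓢(Pos n, ℂ)) (x : Pos n) : AEStronglyMeasurable (wtrDeriv h g u x) volume := by
  have : SecondCountableTopologyEither (Phase n) (Pos n →L[ℝ] ℂ) := ⟨Or.inl inferInstance⟩
  have hd : Continuous (dsym : Phase n → Phase n →L[ℝ] ℂ) := by
    unfold dsym
    fun_prop
  refine AEStronglyMeasurable.add ?_ ?_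
  · refine (hg.mul ((continuous_wtr h u.continuous).comp
      (by fun_prop : Continuous fun ζ : Phase n => (ζ, x))).aestronglyMeasurable).smul ?_
    exact (hd.clm_comp continuous_const).aestronglyMeasurable
  · refine (hg.mul (Continuous.aestronglyMeasurable ?_)).smul
      (Continuous.aestronglyMeasurable ?_)
    · exact Complex.continuous_exp.comp (continuous_const.mul (Complex.continuous_ofReal.comp
        (Continuous.inner (by fun_prop) (by fun_prop))))
    · exact ((u.smooth 1).continuous_fderiv (by simp)).comp (by fun_prop)

lemma hasFDerivAt_wop (h : ℝ) {g : Phase n → ℂ} (hg : Wt g) (u : 𝓢(Pos n, ℂ)) (x : Pos n) :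
    Integrable (wtrDeriv h g u x) volume ∧
    HasFDerivAt (wop h g u) (∫ ζ, wtrDeriv h g u x ζ) x := by
  obtain ⟨C, hC0, hC⟩ := norm_wtrDeriv_le h u
  have hb := (hg.2 1).const_mul C
  have hm := aesm_wtrDeriv h hg.1 u x
  refine ⟨hb.mono' hm (Filter.Eventually.of_forall fun ζ => hC g x ζ), ?_⟩
  exact hasFDerivAt_integral_of_dominated_of_fderiv_le (Metric.ball_mem_nhds x zero_lt_one)
    (Filter.Eventually.of_forall fun y => (integrable_mul_wtr h hg.integrable u y).1)
    (integrable_mul_wtr h hg.integrable u x) hm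
    (Filter.Eventually.of_forall fun ζ y _ => hC g y ζ) hb
    (Filter.Eventually.of_forall fun ζ y _ => hasFDerivAt_mul_wtr h g u ζ y)

lemma dd_wop (h : ℝ) {g : Phase n → ℂ} (hg : Wt g) (u : 𝓢(Pos n, ℂ)) (v : Pos n) :
    dd v (wop h g u) = fun x => wop h (lm (dsym (v, 0)) g) u x + wop h g (∂_{v} u : 𝓢(Pos n, ℂ)) x := by
  funext x
  obtain ⟨hi, hd⟩ := hasFDerivAt_wop h hg u x
  rw [dd, hd.fderiv, ContinuousLinearMap.integral_apply hi, wop, wop,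
    ← integral_add (integrable_mul_wtr h (hg.lm _).integrable u x)
      (integrable_mul_wtr h hg.integrable _ x)]
  congr 1
  funext ζ
  simp only [wtrDeriv, wtr, lm, smul_apply, add_apply, smul_eq_mul,
    SchwartzMap.lineDerivOp_apply_eq_fderiv, ContinuousLinearMap.comp_apply,
    ContinuousLinearMap.inl_apply, dsym_comm ζ]
  ring

lemma contDiff_wop (h : ℝ) {g : Phase n → ℂ} (hg : Wt g) (u : 𝓢(Pos n, ℂ)) :
    ContDiff ℝ ∞ (wop h g u) := by
  have key : ∀ m : ℕ, ∀ g : Phase n → ℂ, Wt g → ∀ u : 𝓢(Pos n, ℂ),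
      ContDiff ℝ m (wop h g u) := by
    intro m
    induction m with
    | zero => exact fun g hg u => contDiff_zero.2 (continuous_iff_continuousAt.2 fun x =>
        (hasFDerivAt_wop h hg u x).2.continuousAt)
    | succ m ih =>
      intro g hg u
      refine contDiff_succ_of_dd pos_sum
        (fun x => (hasFDerivAt_wop h hg u x).2.differentiableAt) fun i => ?_
      rw [dd_wop h hg]
      exact (ih _ (hg.lm _) _).add (ih _ hg _)
  exact contDiff_infty.2 fun m => key m g hg u

/-- With `y = x + 2πh q`, one has `‖x‖ ≤ ‖y‖ + |2πh| (1 + ‖ζ‖)`. The power of `‖y‖` is absorbed by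
the decay of `u`, the other one by a moment of `g`. -/
lemma wop_decay_zero (h : ℝ) (k : ℕ) {g : Phase n → ℂ} (hg : Wt g) :
    ∃ C D : NNReal, ∀ (u : 𝓢(Pos n, ℂ)) (x : Pos n), ‖x‖ ^ k * ‖wop h g u x‖ ≤
      C * SchwartzMap.seminorm ℂ k 0 u + D * SchwartzMap.seminorm ℂ 0 0 u := by
  set A := ∫ ζ, ‖g ζ‖
  set B := ∫ ζ, (1 + ‖ζ‖) ^ k * ‖g ζ‖
  have hA : 0 ≤ A := integral_nonneg fun ζ => norm_nonneg _
  have hB : 0 ≤ B := integral_nonneg fun ζ => by positivity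
  set s := |2 * Real.pi * h|
  refine ⟨(2 ^ k * A).toNNReal, (2 ^ k * s ^ k * B).toNNReal, fun u x => ?_⟩
  rw [Real.coe_toNNReal _ (by positivity), Real.coe_toNNReal _ (by positivity)]
  set p := SchwartzMap.seminorm ℂ k 0 u
  set q := SchwartzMap.seminorm ℂ 0 0 u
  have hp0 : 0 ≤ p := apply_nonneg _ _
  have hq0 : 0 ≤ q := apply_nonneg _ _
  have hpt : ∀ ζ : Phase n, ‖x‖ ^ k * ‖g ζ * wtr h ζ u x‖ ≤
      2 ^ k * p * ‖g ζ‖ + 2 ^ k * s ^ k * q * ((1 + ‖ζ‖) ^ k * ‖g ζ‖) := by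
    intro ζ
    rw [norm_mul, norm_wtr]
    set y := x + (2 * Real.pi * h) • ζ.2
    have hx : ‖x‖ ≤ ‖y‖ + s * (1 + ‖ζ‖) := by
      have e : x = y - (2 * Real.pi * h) • ζ.2 := by simp [y]
      calc ‖x‖ = ‖y - (2 * Real.pi * h) • ζ.2‖ := by rw [← e]
        _ ≤ ‖y‖ + ‖(2 * Real.pi * h) • ζ.2‖ := norm_sub_le _ _
        _ ≤ _ := by
          rw [norm_smul, Real.norm_eq_abs]
          have := norm_snd_le ζ
          gcongr
          linarith
    have hxk : ‖x‖ ^ k ≤ 2 ^ k * (‖y‖ ^ k + (s * (1 + ‖ζ‖)) ^ k) := by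
      calc ‖x‖ ^ k ≤ (‖y‖ + s * (1 + ‖ζ‖)) ^ k := by gcongr
        _ ≤ 2 ^ (k - 1) * (‖y‖ ^ k + (s * (1 + ‖ζ‖)) ^ k) :=
          add_pow_le (norm_nonneg _) (by positivity) k
        _ ≤ _ := by gcongr <;> [norm_num; omega]
    have h1 : ‖y‖ ^ k * ‖u y‖ ≤ p := SchwartzMap.norm_pow_mul_le_seminorm ℂ u k y
    have h2 : ‖u y‖ ≤ q := SchwartzMap.norm_le_seminorm ℂ u y
    calc _ ≤ 2 ^ k * (‖y‖ ^ k + (s * (1 + ‖ζ‖)) ^ k) * (‖g ζ‖ * ‖u y‖) := by gcongr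
      _ = 2 ^ k * (‖y‖ ^ k * ‖u y‖) * ‖g ζ‖ +
          2 ^ k * s ^ k * ‖u y‖ * ((1 + ‖ζ‖) ^ k * ‖g ζ‖) := by rw [mul_pow]; ring
      _ ≤ _ := by gcongr
  have hgi := hg.integrable.norm
  calc ‖x‖ ^ k * ‖wop h g u x‖ ≤ ‖x‖ ^ k * ∫ ζ, ‖g ζ * wtr h ζ u x‖ := by
        gcongr
        exact norm_integral_le_integral_norm _
    _ = ∫ ζ, ‖x‖ ^ k * ‖g ζ * wtr h ζ u x‖ := (integral_const_mul _ _).symm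
    _ ≤ ∫ ζ, (2 ^ k * p * ‖g ζ‖ + 2 ^ k * s ^ k * q * ((1 + ‖ζ‖) ^ k * ‖g ζ‖)) :=
        integral_mono ((integrable_mul_wtr h hg.integrable u x).norm.const_mul _)
          ((hgi.const_mul _).add ((hg.2 k).const_mul _)) hpt
    _ = 2 ^ k * p * A + 2 ^ k * s ^ k * q * B := by
        rw [integral_add (hgi.const_mul _) ((hg.2 k).const_mul _), integral_const_mul,
          integral_const_mul]
    _ = _ := by ring

lemma seminorm_sum_apply {E ι : Type*} [AddCommGroup E] [Module ℂ E] (s : Finset ι)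
    (p : ι → Seminorm ℂ E) (u : E) : (∑ i ∈ s, p i) u = ∑ i ∈ s, p i u := by
  induction s using Finset.cons_induction with
  | empty => rfl
  | cons i s hi ih => rw [Finset.sum_cons, Finset.sum_cons, add_apply, ih]

/-- Asking only for some continuous seminorm keeps the induction on `m` short: composing a seminorm
with a derivative of `u` gives a continuous seminorm, with no indices to follow. -/
lemma wop_decay (h : ℝ) (k m : ℕ) {g : Phase n → ℂ} (hg : Wt g) :
    ∃ p : Seminorm ℂ 𝓢(Pos n, ℂ), Continuous p ∧ ∀ (u : 𝓢(Pos n, ℂ)) (x : Pos n),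
      ‖x‖ ^ k * ‖iteratedFDeriv ℝ m (wop h g u) x‖ ≤ p u := by
  have hcs : ∀ i : ℕ × ℕ, Continuous (schwartzSeminormFamily ℂ (Pos n) ℂ i) :=
    (schwartz_withSeminorms ℂ (Pos n) ℂ).continuous_seminorm
  induction m generalizing g with
  | zero =>
    obtain ⟨C, D, hCD⟩ := wop_decay_zero h k hg
    refine ⟨C • schwartzSeminormFamily ℂ (Pos n) ℂ (k, 0) +
      D • schwartzSeminormFamily ℂ (Pos n) ℂ (0, 0), ?_, fun u x => ?_⟩
    · exact ((hcs (k, 0)).const_smul C).add ((hcs (0, 0)).const_smul D)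
    · rw [norm_iteratedFDeriv_zero]
      exact hCD u x
  | succ m ih =>
    choose p hpc hp using fun i : Fin n => ih (hg.lm (dsym (basisVec i, 0)))
    obtain ⟨q, hqc, hq⟩ := ih hg
    refine ⟨∑ i, (p i + q.comp (lineDerivOpCLM ℂ 𝓢(Pos n, ℂ) (basisVec i)).toLinearMap), ?_,
      fun u x => ?_⟩
    · have : ⇑(∑ i, (p i + q.comp (lineDerivOpCLM ℂ 𝓢(Pos n, ℂ) (basisVec i)).toLinearMap)) =
          fun u => ∑ i, (p i u + q (lineDerivOpCLM ℂ 𝓢(Pos n, ℂ) (basisVec i) u)) := by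
        funext u
        rw [seminorm_sum_apply]
        rfl
      rw [this]
      exact continuous_finsetSum _ fun i _ => (hpc i).add (hqc.comp (ContinuousLinearMap.continuous _))
    · have h1 := norm_iteratedFDeriv_succ_le_sum pos_sum (contDiff_wop h hg u) m x
      rw [seminorm_sum_apply]
      calc _ ≤ ‖x‖ ^ k * ∑ i : Fin n, ‖iteratedFDeriv ℝ m (dd (basisVec i) (wop h g u)) x‖ := by
            refine mul_le_mul_of_nonneg_left (h1.trans (Finset.sum_le_sum fun i _ => ?_))
              (by positivity)
            refine mul_le_of_le_one_left (norm_nonneg _) ?_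
            exact ContinuousLinearMap.opNorm_le_bound _ zero_le_one fun z => by
              simpa using PiLp.norm_apply_le z i
        _ ≤ _ := by
            rw [Finset.mul_sum]
            refine Finset.sum_le_sum fun i _ => ?_
            rw [dd_wop h hg]
            have e : iteratedFDeriv ℝ m (fun x => wop h (lm (dsym (basisVec i, 0)) g) u x +
                wop h g (∂_{basisVec i} u : 𝓢(Pos n, ℂ)) x) x = _ :=
              iteratedFDeriv_add_apply
                ((contDiff_wop h (hg.lm _) u).of_le (by exact_mod_cast le_top)).contDiffAt
                ((contDiff_wop h hg _).of_le (by exact_mod_cast le_top)).contDiffAt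
            rw [e]
            calc _ ≤ ‖x‖ ^ k * (_ + _) := by gcongr; exact norm_add_le _ _
              _ = _ := mul_add _ _ _
              _ ≤ _ := add_le_add (hp i u x) (hq _ x)

/-- Superpositions of Weyl translations act continuously on Schwartz space. -/
def wopCLM (h : ℝ) (g : Phase n → ℂ) (hg : Wt g) : 𝓢(Pos n, ℂ) →L[ℂ] 𝓢(Pos n, ℂ) :=
  SchwartzMap.mkCLM (σ := RingHom.id ℂ) (fun u => wop h g u)
    (fun u v x => by
      simp only [wop]
      rw [← integral_add (integrable_mul_wtr h hg.integrable u x)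
        (integrable_mul_wtr h hg.integrable v x)]
      congr 1
      funext ζ
      simp only [wtr, add_apply]
      ring)
    (fun c u x => by
      simp only [wop, RingHom.id_apply, smul_eq_mul]
      rw [← integral_const_mul]
      congr 1
      funext ζ
      simp only [wtr, smul_apply, smul_eq_mul]
      ring)
    (fun u => contDiff_wop h hg u)
    (fun km => by
      obtain ⟨p, hpc, hp⟩ := wop_decay h km.1 km.2 hg
      obtain ⟨s, C, -, hC⟩ := Seminorm.bound_of_continuous
        (schwartz_withSeminorms ℂ (Pos n) ℂ) p hpc
      exact ⟨s, C, C.2, fun u x => (hp u x).trans (hC u)⟩)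

lemma wopCLM_apply (h : ℝ) (g : Phase n → ℂ) (hg : Wt g) (u : 𝓢(Pos n, ℂ)) (x : Pos n) :
    wopCLM h g hg u x = wop h g u x := rfl

end Translations

/-! ### Quantization of superpositions of characters -/

section Superposition

open FourierTransform

variable {n : ℕ}

/-- The `y`-dependence is isolated as a Fourier kernel, so that the inner integral is the Fourier
transform of `u` at `ξ/(2πh) - p/2`, where `ζ = (p, q)`. -/
lemma weyl_phase (h : ℝ) (x ξ y : Pos n) (ζ : Phase n) :
    eph ζ ((1 / 2 : ℝ) • (x + y), ξ) *
      Complex.exp (Complex.I / (h : ℂ) * ((inner ℝ (x - y) ξ : ℝ) : ℂ)) =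
    Complex.exp (((2 * Real.pi * (inner ℝ ζ.1 x / 2 + inner ℝ ζ.2 ξ) + inner ℝ x ξ / h : ℝ) : ℂ) *
      Complex.I) *
      Complex.exp (((-2 * Real.pi * inner ℝ y ((2 * Real.pi * h)⁻¹ • ξ - (1 / 2 : ℝ) • ζ.1) : ℝ) : ℂ)
        * Complex.I) := by
  rw [eph, pair_eq, ← Complex.exp_add, ← Complex.exp_add]
  congr 1
  simp only [inner_smul_right, inner_add_right, inner_sub_left, inner_sub_right]
  rw [real_inner_comm y ζ.1]
  push_cast
  have : (Real.pi : ℂ) ≠ 0 := by exact_mod_cast Real.pi_ne_zero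
  by_cases hh : (h : ℂ) = 0
  · simp [hh]; ring
  · field_simp
    ring

lemma integral_weylIntegrand_eph (h : ℝ) (u : 𝓢(Pos n, ℂ)) (x ξ : Pos n) (ζ : Phase n) :
    ∫ y, weylIntegrand h (eph ζ) u x ξ y =
      Complex.exp (((2 * Real.pi * (inner ℝ ζ.1 x / 2 + inner ℝ ζ.2 ξ) + inner ℝ x ξ / h : ℝ) : ℂ)
        * Complex.I) * 𝓕 u ((2 * Real.pi * h)⁻¹ • ξ - (1 / 2 : ℝ) • ζ.1) := by
  simp only [weylIntegrand, weyl_phase, mul_assoc]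
  rw [integral_const_mul, SchwartzMap.fourier_coe, Real.fourier_eq']
  simp only [smul_eq_mul, mul_assoc]

lemma integrable_comp_affine (f : 𝓢(Pos n, ℂ)) {c : ℝ} (hc : c ≠ 0) (v : Pos n) :
    Integrable (fun ξ => f (c⁻¹ • ξ - v)) volume :=
  ((f.integrable (μ := volume)).comp_sub_right v).comp_smul (inv_ne_zero hc)

lemma integral_comp_affine (f : Pos n → ℂ) {c : ℝ} (hc : 0 < c) (v : Pos n) :
    ∫ ξ, f (c⁻¹ • ξ - v) = (c : ℂ) ^ n * ∫ η, f η := by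
  have h1 := Measure.integral_comp_inv_smul volume (fun w => f (w - v)) c
  rw [h1, integral_sub_right_eq_self (μ := volume) f v, finrank_euclideanSpace_fin,
    abs_of_pos (by positivity), Complex.real_smul]
  push_cast; rfl

/-- After the substitution `η = ξ/(2πh) - p/2`, the outer integral is Fourier inversion at `x + 2πh
q`; the Jacobian `(2πh)^n` cancels the normalization of Op. -/
lemma integral_integral_weylIntegrand_eph {h : ℝ} (hh : 0 < h) (u : 𝓢(Pos n, ℂ)) (x : Pos n)
    (ζ : Phase n) :
    ∫ ξ, ∫ y, weylIntegrand h (eph ζ) u x ξ y =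
      ((2 * Real.pi * h : ℝ) : ℂ) ^ n * wtr h ζ u x := by
  have hc : 0 < 2 * Real.pi * h := by have := Real.pi_pos; positivity
  set c := 2 * Real.pi * h with hcdef
  have hinv : (u : Pos n → ℂ) (x + c • ζ.2) = 𝓕⁻ (𝓕 u) (x + c • ζ.2) := by
    rw [fourierInv_fourier_eq]
  rw [SchwartzMap.fourierInv_coe, Real.fourierInv_eq'] at hinv
  have h1 : ∀ ξ : Pos n, ∫ y, weylIntegrand h (eph ζ) u x ξ y =
      (fun η : Pos n => Complex.exp (((2 * Real.pi * (inner ℝ ζ.1 (x + (Real.pi * h) • ζ.2)) : ℝ) : ℂ)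
        * Complex.I) * (Complex.exp (((2 * Real.pi * inner ℝ η (x + c • ζ.2) : ℝ) : ℂ) * Complex.I) •
          𝓕 u η)) (c⁻¹ • ξ - (1 / 2 : ℝ) • ζ.1) := by
    intro ξ
    beta_reduce
    rw [integral_weylIntegrand_eph, smul_eq_mul, ← mul_assoc, ← Complex.exp_add]
    congr 2
    simp only [inner_smul_right, inner_add_right, inner_sub_left, inner_smul_left]
    rw [real_inner_comm ξ x, real_inner_comm ξ ζ.2]
    have : (c : ℂ) ≠ 0 := by exact_mod_cast hc.ne'
    have h2 : (h : ℂ) ≠ 0 := by exact_mod_cast hh.ne'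
    have h3 : (Real.pi : ℂ) ≠ 0 := by exact_mod_cast Real.pi_ne_zero
    rw [hcdef]
    simp only [RCLike.conj_to_real]
    push_cast
    field_simp
    ring
  rw [integral_congr_ae (Filter.Eventually.of_forall h1), integral_comp_affine (fun η : Pos n => Complex.exp (((2 * Real.pi *
    (inner ℝ ζ.1 (x + (Real.pi * h) • ζ.2)) : ℝ) : ℂ) * Complex.I) *
    (Complex.exp (((2 * Real.pi * inner ℝ η (x + c • ζ.2) : ℝ) : ℂ) * Complex.I) • 𝓕 u η)) hc,
    integral_const_mul, ← hinv, wtr]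
  congr 3
  push_cast; ring

variable {X : Type*} [MeasurableSpace X] {μ : Measure X} [SFinite μ]

lemma continuous_weylIntegrand_eph (h : ℝ) (u : 𝓢(Pos n, ℂ)) (x ξ : Pos n) :
    Continuous fun p : Phase n × Pos n => weylIntegrand h (eph p.1) u x ξ p.2 := by
  unfold weylIntegrand
  refine Continuous.mul (Continuous.mul ?_ ?_) (u.continuous.comp continuous_snd)
  · exact continuous_eph.comp (by fun_prop :
      Continuous fun p : Phase n × Pos n => (p.1, ((1 / 2 : ℝ) • (x + p.2), ξ)))
  · exact Complex.continuous_exp.comp (continuous_const.mul (Complex.continuous_ofReal.comp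
      (Continuous.inner (by fun_prop) (by fun_prop))))

lemma norm_weylIntegrand_eph (h : ℝ) (u : Pos n → ℂ) (x ξ y : Pos n) (ζ : Phase n) :
    ‖weylIntegrand h (eph ζ) u x ξ y‖ = ‖u y‖ := by
  rw [weylIntegrand, weyl_phase, norm_mul, norm_mul, Complex.norm_exp_ofReal_mul_I,
    Complex.norm_exp_ofReal_mul_I, one_mul, one_mul]

/-- A superposition of characters is quantized by the superposition of Weyl translations. -/
lemma isWeylQuantization_of_superposition {h : ℝ} (hh : 0 < h) {Z : X → Phase n}
    (hZ : Measurable Z) {g : X → ℂ} (hg : Integrable g μ) {b : Phase n → ℂ}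
    (hb : ∀ z, b z = ∫ t, g t * eph (Z t) z ∂μ) {T : 𝓢(Pos n, ℂ) →L[ℂ] 𝓢(Pos n, ℂ)}
    (hT : ∀ u x, T u x = ∫ t, g t * wtr h (Z t) u x ∂μ) : IsWeylQuantization h b T := by
  intro u x
  have hc : 0 < 2 * Real.pi * h := by have := Real.pi_pos; positivity
  have hbw : ∀ ξ y, weylIntegrand h b u x ξ y =
      ∫ t, g t * weylIntegrand h (eph (Z t)) u x ξ y ∂μ := by
    intro ξ y
    rw [weylIntegrand, hb, mul_assoc, ← integral_mul_const]
    congr 1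
    funext t
    rw [weylIntegrand]
    ring
  have hi1 : ∀ ξ, Integrable (fun p : Pos n × X => g p.2 * weylIntegrand h (eph (Z p.2)) u x ξ p.1)
      (volume.prod μ) := by
    intro ξ
    have h1 : Integrable (fun p : Pos n × X => u p.1 * g p.2) (volume.prod μ) :=
      (u.integrable (μ := volume)).mul_prod hg
    refine h1.norm.mono' ?_ (Filter.Eventually.of_forall fun p => ?_)
    · refine hg.1.comp_snd.mul ?_
      exact ((continuous_weylIntegrand_eph h u x ξ).measurable.comp
        ((hZ.comp measurable_snd).prodMk measurable_fst)).aestronglyMeasurable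
    · rw [norm_mul, norm_mul, norm_weylIntegrand_eph, mul_comm]
  have hin : ∀ ξ, ∫ y, weylIntegrand h b u x ξ y =
      ∫ t, g t * (∫ y, weylIntegrand h (eph (Z t)) u x ξ y) ∂μ := by
    intro ξ
    simp only [hbw]
    rw [integral_integral_swap (f := fun y t => g t * weylIntegrand h (eph (Z t)) u x ξ y) (hi1 ξ)]
    simp only [integral_const_mul]
  -- Now the modulus is `|g(t)|` times `|𝓕 u|` at an affine image of `ξ`, whose integral over `ξ`
  -- does not depend on `t`.
  have hi2 : Integrable (fun p : Pos n × X => g p.2 * ∫ y, weylIntegrand h (eph (Z p.2)) u x p.1 y)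
      (volume.prod μ) := by
    have hm : AEStronglyMeasurable
        (fun p : Pos n × X => g p.2 * ∫ y, weylIntegrand h (eph (Z p.2)) u x p.1 y)
        (volume.prod μ) := by
      refine hg.1.comp_snd.mul ?_
      simp only [integral_weylIntegrand_eph]
      have hcont : Continuous fun p : Pos n × Phase n =>
          Complex.exp (((2 * Real.pi * (inner ℝ p.2.1 x / 2 + inner ℝ p.2.2 p.1) +
            inner ℝ x p.1 / h : ℝ) : ℂ) * Complex.I) *
            𝓕 u ((2 * Real.pi * h)⁻¹ • p.1 - (1 / 2 : ℝ) • p.2.1) := by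
        refine Continuous.mul ?_ ((𝓕 u).continuous.comp (by fun_prop))
        refine Complex.continuous_exp.comp ((Complex.continuous_ofReal.comp ?_).mul
          continuous_const)
        have i1 : Continuous fun p : Pos n × Phase n => inner ℝ p.2.1 x :=
          Continuous.inner (by fun_prop) (by fun_prop)
        have i2 : Continuous fun p : Pos n × Phase n => inner ℝ p.2.2 p.1 :=
          Continuous.inner (by fun_prop) (by fun_prop)
        have i3 : Continuous fun p : Pos n × Phase n => inner ℝ x p.1 :=
          Continuous.inner (by fun_prop) (by fun_prop)
        exact (continuous_const.mul ((i1.div_const 2).add i2)).add (i3.div_const h)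
      exact (hcont.measurable.comp
        (measurable_fst.prodMk (hZ.comp measurable_snd))).aestronglyMeasurable
    have hnorm : ∀ ξ t, ‖g t * ∫ y, weylIntegrand h (eph (Z t)) u x ξ y‖ =
        ‖g t‖ * ‖𝓕 u ((2 * Real.pi * h)⁻¹ • ξ - (1 / 2 : ℝ) • (Z t).1)‖ := by
      intro ξ t
      rw [integral_weylIntegrand_eph, norm_mul, norm_mul, Complex.norm_exp_ofReal_mul_I, one_mul]
    refine (integrable_prod_iff' hm).2 ⟨Filter.Eventually.of_forall fun t => ?_, ?_⟩
    · have h1 : AEStronglyMeasurable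
          (fun ξ => g t * ∫ y, weylIntegrand h (eph (Z t)) u x ξ y) volume := by
        simp only [integral_weylIntegrand_eph]
        refine Continuous.aestronglyMeasurable (continuous_const.mul (Continuous.mul ?_
          ((𝓕 u).continuous.comp (by fun_prop))))
        refine Complex.continuous_exp.comp ((Complex.continuous_ofReal.comp ?_).mul
          continuous_const)
        have i2 : Continuous fun ξ : Pos n => inner ℝ (Z t).2 ξ :=
          Continuous.inner (by fun_prop) (by fun_prop)
        have i3 : Continuous fun ξ : Pos n => inner ℝ x ξ :=
          Continuous.inner (by fun_prop) (by fun_prop)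
        exact (continuous_const.mul (continuous_const.add i2)).add (i3.div_const h)
      refine (((integrable_comp_affine (𝓕 u) hc.ne' ((1 / 2 : ℝ) • (Z t).1)).norm.const_mul
        ‖g t‖)).mono' h1 (Filter.Eventually.of_forall fun ξ => (hnorm ξ t).le)
    · simp only [hnorm, integral_const_mul]
      have h2 : ∀ v : Pos n, ∫ ξ, ‖𝓕 u ((2 * Real.pi * h)⁻¹ • ξ - v)‖ =
          (2 * Real.pi * h) ^ n * ∫ η, ‖𝓕 u η‖ := by
        intro v
        have h1 := Measure.integral_comp_inv_smul volume (fun w : Pos n => ‖𝓕 u (w - v)‖)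
          (2 * Real.pi * h)
        rw [h1, integral_sub_right_eq_self (μ := volume) (fun w : Pos n => ‖𝓕 u w‖) v,
          finrank_euclideanSpace_fin, abs_of_pos (by positivity), smul_eq_mul]
      simp only [h2]
      exact hg.norm.mul_const _
  refine ⟨fun ξ => ?_, ?_, ?_⟩
  · simp only [hbw]
    exact (hi1 ξ).integral_prod_left
  · simp only [hin]
    exact hi2.integral_prod_left
  · simp only [hin]
    rw [integral_integral_swap
      (f := fun ξ t => g t * ∫ y, weylIntegrand h (eph (Z t)) u x ξ y) hi2]
    simp only [integral_const_mul, integral_integral_weylIntegrand_eph hh]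
    rw [hT, ← integral_const_mul]
    congr 1
    funext t
    have h3 : (2 * (Real.pi : ℂ) * (h : ℂ)) ^ n ≠ 0 := by
      exact_mod_cast pow_ne_zero n hc.ne'
    push_cast
    field_simp

end Superposition

/-! ### Quantization and multiplication of the symbol by coordinates -/

section Closure

open LineDeriv

variable {n : ℕ} {h : ℝ} {a b : Phase n → ℂ} {A B : 𝓢(Pos n, ℂ) →L[ℂ] 𝓢(Pos n, ℂ)}

lemma IsWeylQuantization.congr (ha : IsWeylQuantization h a A) (hA : ∀ u x, A u x = B u x) :
    IsWeylQuantization h a B := fun u x =>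
  ⟨(ha u x).1, (ha u x).2.1, by rw [← hA]; exact (ha u x).2.2⟩

lemma IsWeylQuantization.add (ha : IsWeylQuantization h a A) (hb : IsWeylQuantization h b B) :
    IsWeylQuantization h (fun z => a z + b z) (A + B) := by
  intro u x
  obtain ⟨a1, a2, a3⟩ := ha u x
  obtain ⟨b1, b2, b3⟩ := hb u x
  have e : ∀ ξ y, weylIntegrand h (fun z => a z + b z) u x ξ y =
      weylIntegrand h a u x ξ y + weylIntegrand h b u x ξ y := fun ξ y => by
    simp only [weylIntegrand]; ring
  have e' : ∀ ξ, ∫ y, weylIntegrand h (fun z => a z + b z) u x ξ y =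
      (∫ y, weylIntegrand h a u x ξ y) + ∫ y, weylIntegrand h b u x ξ y := fun ξ => by
    simp only [e]; exact integral_add (a1 ξ) (b1 ξ)
  refine ⟨fun ξ => ?_, ?_, ?_⟩
  · simp only [e]; exact (a1 ξ).add (b1 ξ)
  · simp only [e']; exact a2.add b2
  · simp only [e']
    rw [integral_add a2 b2, mul_add, ← a3, ← b3]
    rfl

lemma IsWeylQuantization.smul (ha : IsWeylQuantization h a A) (c : ℂ) :
    IsWeylQuantization h (fun z => c * a z) (c • A) := by
  intro u x
  obtain ⟨a1, a2, a3⟩ := ha u x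
  have e : ∀ ξ y, weylIntegrand h (fun z => c * a z) u x ξ y =
      c * weylIntegrand h a u x ξ y := fun ξ y => by
    simp only [weylIntegrand]; ring
  refine ⟨fun ξ => ?_, ?_, ?_⟩
  · simp only [e]; exact (a1 ξ).const_mul c
  · simp only [e, integral_const_mul]; exact a2.const_mul c
  · simp only [e, integral_const_mul]
    rw [mul_left_comm, ← a3]
    rfl

lemma hasTemperateGrowth_coord (j : Fin n) :
    (fun x : Pos n => ((x j : ℝ) : ℂ)).HasTemperateGrowth :=
  (Complex.ofRealCLM.comp (EuclideanSpace.proj j : Pos n →L[ℝ] ℝ)).hasTemperateGrowth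

/-- Multiplication by the coordinate `x_j` on Schwartz space. -/
def mulX (j : Fin n) : 𝓢(Pos n, ℂ) →L[ℂ] 𝓢(Pos n, ℂ) :=
  SchwartzMap.smulLeftCLM ℂ fun x : Pos n => ((x j : ℝ) : ℂ)

lemma mulX_apply (j : Fin n) (u : 𝓢(Pos n, ℂ)) (x : Pos n) : mulX j u x = (x j : ℝ) * u x := by
  rw [mulX, SchwartzMap.smulLeftCLM_apply_apply (hasTemperateGrowth_coord j), smul_eq_mul]

/-- The symbol is evaluated at the midpoint: the half `x_j / 2` leaves the integral, the half `y_j /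
2` multiplies `u`. -/
lemma IsWeylQuantization.mul_x (ha : IsWeylQuantization h a A) (j : Fin n) :
    IsWeylQuantization h (fun z => (z.1 j : ℝ) * a z)
      ((1 / 2 : ℂ) • ((mulX j).comp A + A.comp (mulX j))) := by
  intro u x
  obtain ⟨a1, a2, a3⟩ := ha u x
  obtain ⟨b1, b2, b3⟩ := ha (mulX j u) x
  have e : ∀ ξ y, weylIntegrand h (fun z => (z.1 j : ℝ) * a z) u x ξ y =
      (x j / 2 : ℂ) * weylIntegrand h a u x ξ y +
        (1 / 2 : ℂ) * weylIntegrand h a (mulX j u) x ξ y := fun ξ y => by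
    simp only [weylIntegrand, mulX_apply, PiLp.smul_apply, PiLp.add_apply, smul_eq_mul]
    push_cast
    ring
  have e' : ∀ ξ, ∫ y, weylIntegrand h (fun z => (z.1 j : ℝ) * a z) u x ξ y =
      (x j / 2 : ℂ) * (∫ y, weylIntegrand h a u x ξ y) +
        (1 / 2 : ℂ) * ∫ y, weylIntegrand h a (mulX j u) x ξ y := fun ξ => by
    simp only [e]
    rw [integral_add ((a1 ξ).const_mul _) ((b1 ξ).const_mul _), integral_const_mul,
      integral_const_mul]
  refine ⟨fun ξ => ?_, ?_, ?_⟩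
  · simp only [e]; exact ((a1 ξ).const_mul _).add ((b1 ξ).const_mul _)
  · simp only [e']; exact (a2.const_mul _).add (b2.const_mul _)
  · simp only [e']
    rw [integral_add (a2.const_mul _) (b2.const_mul _), integral_const_mul, integral_const_mul,
      mul_add, mul_left_comm, ← a3, mul_left_comm, ← b3]
    simp only [smul_apply, add_apply, ContinuousLinearMap.comp_apply, mulX_apply, smul_eq_mul]
    ring

lemma dd_weylIntegrand (ha : Differentiable ℝ a) (u : 𝓢(Pos n, ℂ)) (x ξ y : Pos n) (j : Fin n) :
    DifferentiableAt ℝ (weylIntegrand h a u x ξ) y ∧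
    fderiv ℝ (weylIntegrand h a u x ξ) y (basisVec j) =
      (1 / 2 : ℂ) * weylIntegrand h (dd (basisVec j, 0) a) u x ξ y +
        weylIntegrand h a (∂_{basisVec j} u : 𝓢(Pos n, ℂ)) x ξ y -
        (Complex.I / h * (ξ j : ℝ)) * weylIntegrand h a u x ξ y := by
  set L : Pos n →L[ℝ] Phase n := (1 / 2 : ℝ) • ContinuousLinearMap.inl ℝ (Pos n) (Pos n)
  have h0 : HasFDerivAt (fun y : Pos n => L y + ((1 / 2 : ℝ) • x, ξ)) L y :=
    L.hasFDerivAt.add_const _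
  have e0 : ∀ y : Pos n, L y + ((1 / 2 : ℝ) • x, ξ) = ((1 / 2 : ℝ) • (x + y), ξ) := fun y => by
    simp [L, add_comm]
  simp only [e0] at h0
  have h1 := (ha ((1 / 2 : ℝ) • (x + y), ξ)).hasFDerivAt.comp y h0
  set l : Pos n →L[ℝ] ℂ := (Complex.I / (h : ℂ)) • Complex.ofRealCLM.comp (innerSL ℝ ξ)
  have h2 : HasFDerivAt (fun y : Pos n => l x - l y) (-l) y := by
    exact l.hasFDerivAt.const_sub (l x)
  have e2 : ∀ y, l x - l y = Complex.I / (h : ℂ) * ((inner ℝ (x - y) ξ : ℝ) : ℂ) := fun y => by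
    rw [← map_sub]
    simp [l, real_inner_comm]
  simp only [e2] at h2
  have h3 : HasFDerivAt u (fderiv ℝ u y) y := u.differentiableAt.hasFDerivAt
  have h4 := (h1.mul h2.cexp).mul h3
  have h5 : HasFDerivAt (weylIntegrand h a u x ξ) _ y := h4
  refine ⟨h5.differentiableAt, ?_⟩
  rw [h5.fderiv]
  have e5 : l (basisVec j) = Complex.I / h * (ξ j : ℝ) := by
    simp [l, basisVec, EuclideanSpace.inner_single_right]
  simp only [add_apply, smul_apply, ContinuousLinearMap.comp_apply, neg_apply, e5, smul_eq_mul,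
    Function.comp_apply, Pi.mul_apply, weylIntegrand, dd, SchwartzMap.lineDerivOp_apply_eq_fderiv]
  have e6 : L (basisVec j) = (1 / 2 : ℝ) • ((basisVec j, 0) : Phase n) := rfl
  rw [e6, map_smul, Complex.real_smul]
  push_cast
  ring

/-- A `y_j`-derivative of the whole integrand has integral zero. It hits the symbol (with the
midpoint factor 1/2), the function `u`, or the exponential, where it produces `-iξ_j/h`; solving for
that term gives the operator. -/
lemma IsWeylQuantization.mul_xi (hh : 0 < h) (hd : Differentiable ℝ a) {j : Fin n}
    (ha : IsWeylQuantization h a A) (hb : IsWeylQuantization h (dd (basisVec j, 0) a) B) :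
    IsWeylQuantization h (fun z => (z.2 j : ℝ) * a z) ((-Complex.I * h) • ((1 / 2 : ℂ) • B +
      A.comp (lineDerivOpCLM ℂ 𝓢(Pos n, ℂ) (basisVec j)))) := by
  intro u x
  obtain ⟨a1, a2, a3⟩ := ha u x
  obtain ⟨b1, b2, b3⟩ := hb u x
  obtain ⟨c1, c2, c3⟩ := ha (∂_{basisVec j} u : 𝓢(Pos n, ℂ)) x
  have e : ∀ ξ y, weylIntegrand h (fun z => (z.2 j : ℝ) * a z) u x ξ y =
      (ξ j : ℂ) * weylIntegrand h a u x ξ y := fun ξ y => by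
    simp only [weylIntegrand, mul_assoc]
  have hh' : (h : ℂ) ≠ 0 := by exact_mod_cast hh.ne'
  have key : ∀ ξ, (ξ j : ℂ) * ∫ y, weylIntegrand h a u x ξ y = (-Complex.I * h) *
      ((1 / 2 : ℂ) * (∫ y, weylIntegrand h (dd (basisVec j, 0) a) u x ξ y) +
        ∫ y, weylIntegrand h a (∂_{basisVec j} u : 𝓢(Pos n, ℂ)) x ξ y) := by
    intro ξ
    have hi : Integrable (fun y => fderiv ℝ (weylIntegrand h a u x ξ) y (basisVec j)) volume := by
      simp only [fun y => (dd_weylIntegrand (h := h) hd u x ξ y j).2]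
      exact (((b1 ξ).const_mul _).add (c1 ξ)).sub ((a1 ξ).const_mul _)
    -- Integration by parts against the constant function one.
    have hz := integral_mul_fderiv_eq_neg_fderiv_mul_of_integrable (μ := volume)
      (f := fun _ : Pos n => (1 : ℂ)) (g := weylIntegrand h a u x ξ) (v := basisVec j)
      (by simp) (by simpa using hi) (by simpa using a1 ξ) (fun y _ => differentiableAt_const _)
      (fun y _ => (dd_weylIntegrand hd u x ξ y j).1)
    simp only [one_mul, fderiv_fun_const, Pi.zero_apply, zero_apply, zero_mul, integral_zero,
      neg_zero, fun y => (dd_weylIntegrand (h := h) hd u x ξ y j).2] at hz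
    have hbc := ((b1 ξ).const_mul (1 / 2 : ℂ)).add (c1 ξ)
    simp only [Pi.add_def] at hbc
    rw [integral_sub hbc ((a1 ξ).const_mul _), integral_add ((b1 ξ).const_mul _) (c1 ξ), integral_const_mul, integral_const_mul,
      sub_eq_zero] at hz
    rw [hz]
    field_simp
    rw [Complex.I_sq]
    ring
  have key' := fun ξ => (integral_const_mul (ξ j : ℂ) (weylIntegrand h a u x ξ) (μ := volume)).trans
    (key ξ)
  refine ⟨fun ξ => ?_, ?_, ?_⟩
  · simp only [e]; exact (a1 ξ).const_mul _
  · simp only [e, key']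
    exact ((b2.const_mul _).add c2).const_mul _
  · simp only [e, key']
    rw [integral_const_mul, integral_add (b2.const_mul _) c2, integral_const_mul, mul_left_comm,
      mul_add, mul_left_comm, ← b3, ← c3]
    rfl

end Closure

/-! ### The composition formula for symbols of finite order -/

section Quantizable

open LineDeriv

variable {n : ℕ} {h : ℝ} {a b : Phase n → ℂ}

/-- The translation evaluates `u` at `x + 2πh q`, and `x_j` differs from that coordinate by `-2πh
q_j`, which is `2h` times coordinate `j` of `rot ζ`. -/
lemma mulX_wopCLM (h : ℝ) (j : Fin n) {g : Phase n → ℂ} (hg : Wt g) (u : 𝓢(Pos n, ℂ)) :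
    mulX j (wopCLM h g hg u) = wopCLM h g hg (mulX j u) +
      (2 * h : ℂ) • wopCLM h (lm (rc (Sum.inl j)) g) (hg.lm _) u := by
  ext x
  rw [mulX_apply, add_apply, smul_apply, wopCLM_apply, wopCLM_apply, wopCLM_apply, wop, wop, wop,
    smul_eq_mul, ← integral_const_mul, ← integral_const_mul,
    ← integral_add (integrable_mul_wtr h hg.integrable _ x)
      ((integrable_mul_wtr h (hg.lm _).integrable u x).const_mul _)]
  congr 1
  funext ζ
  simp only [wtr, mulX_apply, lm, rc_apply, pc_inl, rot, smul_apply, ContinuousLinearMap.prod_apply,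
    Prod.smul_mk, neg_apply, ContinuousLinearMap.coe_snd', PiLp.smul_apply, PiLp.neg_apply,
    PiLp.add_apply, smul_eq_mul]
  push_cast
  ring

lemma dsym_basis_left (j : Fin n) (ζ : Phase n) :
    dsym (basisVec j, 0) ζ = 2 * Complex.I * rc (Sum.inr j) ζ := by
  rw [dsym_apply, rc_apply, pair_eq]
  simp [rot, basisVec, EuclideanSpace.inner_single_right]
  ring

lemma lineDeriv_wopCLM (h : ℝ) (j : Fin n) {g : Phase n → ℂ} (hg : Wt g) (u : 𝓢(Pos n, ℂ)) :
    (∂_{basisVec j} (wopCLM h g hg u) : 𝓢(Pos n, ℂ)) =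
      wopCLM h g hg (∂_{basisVec j} u : 𝓢(Pos n, ℂ)) +
      (2 * Complex.I) • wopCLM h (lm (rc (Sum.inr j)) g) (hg.lm _) u := by
  ext x
  have h1 := congrFun (dd_wop h hg u (basisVec j)) x
  have e : (∂_{basisVec j} (wopCLM h g hg u) : 𝓢(Pos n, ℂ)) x = dd (basisVec j) (wop h g u) x := by
    rw [SchwartzMap.lineDerivOp_apply_eq_fderiv]
    rfl
  rw [e, h1, add_apply, smul_apply, wopCLM_apply, wopCLM_apply, add_comm, smul_eq_mul]
  congr 1
  rw [wop, wop, ← integral_const_mul]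
  congr 1
  funext ζ
  rw [lm, dsym_basis_left, lm]
  ring

lemma wopCLM_dsym (h : ℝ) (j : Fin n) {g : Phase n → ℂ} (hg : Wt g) (u : 𝓢(Pos n, ℂ)) :
    wopCLM h (lm (dsym (basisVec j, 0)) g) (hg.lm _) u =
      (2 * Complex.I) • wopCLM h (lm (rc (Sum.inr j)) g) (hg.lm _) u := by
  ext x
  rw [smul_apply, wopCLM_apply, wopCLM_apply, smul_eq_mul, wop, wop, ← integral_const_mul]
  congr 1
  funext ζ
  rw [lm, dsym_basis_left, lm]
  ring

/-- Smooth symbols of polynomial growth together with all derivatives. -/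
def Tame (a : Phase n → ℂ) : Prop := ∃ r : ℕ, Gam r a

lemma Gam.tame {r : ℤ} (ha : Gam r a) : Tame a := ⟨r.toNat, ha.mono (Int.self_le_toNat r)⟩

lemma gam_pc (i : Fin n ⊕ Fin n) : Gam 1 (pc i : Phase n → ℝ) := by
  refine gam_of_bounded_derivs (pc i).contDiff 1 fun m hm => ?_
  obtain ⟨m, rfl⟩ := Nat.exists_eq_add_of_le' hm
  have e : fderiv ℝ (pc i : Phase n → ℝ) = fun _ => pc i := by
    funext z; exact (pc i).fderiv
  simp only [← norm_iteratedFDeriv_fderiv, e]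
  rcases m with _ | m
  · exact ⟨‖(pc i : Phase n →L[ℝ] ℝ)‖, fun z => by simp⟩
  · exact ⟨0, fun z => by simp [iteratedFDeriv_const_of_ne]⟩

lemma Gam.pc_mul {r : ℤ} (ha : Gam r a) (i : Fin n ⊕ Fin n) :
    Gam (1 + r) (fun z => (pc i z : ℂ) * a z) := by
  simpa only [Complex.real_smul] using (gam_pc i).smul ha

lemma Tame.pc_mul (ha : Tame a) (i : Fin n ⊕ Fin n) : Tame (fun z => (pc i z : ℂ) * a z) :=
  let ⟨_, hr⟩ := ha
  (hr.pc_mul i).tame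

lemma Tame.integrable_tw (ha : Tame a) {g : Phase n → ℂ} (hg : Wt g) (τ : ℝ) (z : Phase n) :
    Integrable (fun ζ => a (z + τ • rot ζ) * g ζ * eph ζ z) volume :=
  let ⟨_, hr⟩ := ha
  WeylL2.integrable_tw hr hg τ z

lemma tw_pc_mul (ha : Tame a) {g : Phase n → ℂ} (hg : Wt g) (τ : ℝ) (i : Fin n ⊕ Fin n) :
    tw τ (fun z => (pc i z : ℂ) * a z) g =
      fun z => (pc i z : ℂ) * tw τ a g z + τ * tw τ a (lm (rc i) g) z := by
  funext z
  rw [tw, tw, tw, ← integral_const_mul, ← integral_const_mul,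
    ← integral_add ((ha.integrable_tw hg τ z).const_mul _)
      ((ha.integrable_tw (hg.lm _) τ z).const_mul _)]
  congr 1
  funext ζ
  simp only [lm, rc_apply, map_add, map_smul, smul_eq_mul]
  push_cast
  ring

lemma tw_add_left (ha : Tame a) (hb : Tame b) {g : Phase n → ℂ} (hg : Wt g) (τ : ℝ) :
    tw τ (fun z => a z + b z) g = fun z => tw τ a g z + tw τ b g z := by
  funext z
  rw [tw, tw, tw, ← integral_add (ha.integrable_tw hg τ z) (hb.integrable_tw hg τ z)]
  congr 1
  funext ζ
  ring

/-- `a` has a Weyl quantization, and its twisted product with every amplitude quantizes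
the composition. -/
def Quantizable (h : ℝ) (a : Phase n → ℂ) : Prop :=
  ∃ A : 𝓢(Pos n, ℂ) →L[ℂ] 𝓢(Pos n, ℂ), IsWeylQuantization h a A ∧
    ∀ (g : Phase n → ℂ) (hg : Wt g), IsWeylQuantization h (tw h a g) (A.comp (wopCLM h g hg))

lemma Quantizable.add (qa : Quantizable h a) (qb : Quantizable h b) (ha : Tame a) (hb : Tame b) :
    Quantizable h (fun z => a z + b z) := by
  obtain ⟨A, hA, hA'⟩ := qa
  obtain ⟨B, hB, hB'⟩ := qb
  refine ⟨A + B, hA.add hB, fun g hg => ?_⟩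
  rw [tw_add_left ha hb hg]
  exact ((hA' g hg).add (hB' g hg)).congr fun u x => rfl

/-- In the twisted product, `x_j` is evaluated at the shifted point and leaves an extra term with
multiplier `h rc`. Half of the commutator `mulX_wopCLM` is exactly that term on the operator side.
-/
lemma Quantizable.x_mul (qa : Quantizable h a) (ha : Tame a) (j : Fin n) :
    Quantizable h (fun z => (pc (Sum.inl j) z : ℂ) * a z) := by
  obtain ⟨A, hA, hA'⟩ := qa
  refine ⟨_, hA.mul_x j, fun g hg => ?_⟩
  rw [tw_pc_mul ha hg]
  refine (((hA' g hg).mul_x j).add ((hA' _ (hg.lm (rc (Sum.inl j)))).smul h)).congr fun u x => ?_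
  have e := congrArg (fun w => A w x) (mulX_wopCLM h j hg u)
  simp only [map_add, map_smul, add_apply, smul_apply, smul_eq_mul] at e
  simp only [add_apply, smul_apply, ContinuousLinearMap.comp_apply, smul_eq_mul]
  rw [e]
  ring

/-- The same matching as for `x_j`, with the commutator of a derivative and a translation. The
operator for `ξ_j a` involves the quantization of `∂_{x_j} a`, so that symbol must be quantizable
too. -/
lemma Quantizable.xi_mul (hh : 0 < h) (ha : Tame a) (j : Fin n) (qa : Quantizable h a)
    (qb : Quantizable h (dd (basisVec j, 0) a)) :
    Quantizable h (fun z => (pc (Sum.inr j) z : ℂ) * a z) := by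
  obtain ⟨A, hA, hA'⟩ := qa
  obtain ⟨B, hB, hB'⟩ := qb
  obtain ⟨r, hr⟩ := ha
  refine ⟨_, hA.mul_xi hh (hr.1.differentiable (by simp)) hB, fun g hg => ?_⟩
  have h1 : IsWeylQuantization h (dd (basisVec j, 0) (tw h a g)) (B.comp (wopCLM h g hg) +
      A.comp (wopCLM h (lm (dsym (basisVec j, 0)) g) (hg.lm _))) := by
    rw [dd_tw hr hg]
    exact (hB' g hg).add (hA' _ (hg.lm (dsym (basisVec j, 0))))
  rw [tw_pc_mul ⟨r, hr⟩ hg]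
  refine (((hA' g hg).mul_xi hh (differentiable_tw hr hg h) h1).add
    ((hA' _ (hg.lm (rc (Sum.inr j)))).smul h)).congr fun u x => ?_
  have e := congrArg (fun w => A w x) (lineDeriv_wopCLM h j hg u)
  simp only [map_add, map_smul, add_apply, smul_apply, smul_eq_mul] at e
  have e2 := congrArg (fun w => A w x) (wopCLM_dsym h j hg u)
  simp only [map_smul, smul_apply, smul_eq_mul] at e2
  simp only [add_apply, smul_apply, ContinuousLinearMap.comp_apply, smul_eq_mul,
    lineDerivOpCLM_apply]
  rw [e, e2]
  linear_combination ((h : ℂ) * (A (wopCLM h (lm (rc (Sum.inr j)) g) (hg.lm _) u) x)) * Complex.I_sq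

/-- The Weyl commutation relation. Its phase is the character of `ζ'` at `h rot ζ`, precisely the
shift in the twisted product; this fixes the normalization and sign of `rot`. -/
lemma wtr_wtr (h : ℝ) (ζ' ζ : Phase n) (u : Pos n → ℂ) (x : Pos n) :
    wtr h ζ' (wtr h ζ u) x = eph ζ' (h • rot ζ) * wtr h (ζ' + ζ) u x := by
  rw [wtr, wtr, wtr, eph, pair_eq]
  have e2 : x + (2 * Real.pi * h) • (ζ' + ζ).2 =
      x + (2 * Real.pi * h) • ζ'.2 + (2 * Real.pi * h) • ζ.2 := by
    rw [Prod.snd_add, smul_add, add_assoc]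
  rw [e2]
  simp only [← mul_assoc]
  congr 1
  simp only [← Complex.exp_add]
  congr 1
  simp only [rot, smul_apply, ContinuousLinearMap.prod_apply, neg_apply,
    ContinuousLinearMap.coe_snd', ContinuousLinearMap.coe_fst', Prod.smul_mk, Prod.fst_add,
    Prod.snd_add, inner_add_left, inner_add_right, inner_smul_right, inner_neg_right,
    smul_neg, smul_add]
  rw [real_inner_comm ζ'.2 ζ.1]
  push_cast
  ring

lemma integrable_mul_of_bounded {X : Type*} [MeasurableSpace X] [TopologicalSpace X]
    [OpensMeasurableSpace X] [SecondCountableTopology X] {μ : Measure X} {f p : X → ℂ}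
    (hf : Integrable f μ) (hp : Continuous p) {C : ℝ} (hC : ∀ x, ‖p x‖ ≤ C) :
    Integrable (fun x => f x * p x) μ := by
  refine (hf.norm.mul_const C).mono' (hf.1.mul hp.aestronglyMeasurable)
    (Filter.Eventually.of_forall fun x => ?_)
  rw [norm_mul]
  exact mul_le_mul_of_nonneg_left (hC x) (norm_nonneg _)

lemma integrable_mul_mul_eph {γ g : Phase n → ℂ} (hγ : Wt γ) (hg : Wt g) (h : ℝ) :
    Integrable (fun p : Phase n × Phase n => γ p.1 * g p.2 * eph p.1 (h • rot p.2))
      (volume.prod volume) := by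
  have hph : Continuous fun p : Phase n × Phase n => eph p.1 (h • rot p.2) :=
    continuous_eph.comp (by fun_prop :
      Continuous fun p : Phase n × Phase n => (p.1, h • rot p.2))
  have h0 : Integrable (fun p : Phase n × Phase n => γ p.1 * g p.2) (volume.prod volume) :=
    hγ.integrable.mul_prod hg.integrable
  exact integrable_mul_of_bounded h0 hph fun p => (norm_eph _ _).le

lemma tw_syn {γ g : Phase n → ℂ} (hγ : Wt γ) (hg : Wt g) (h : ℝ) (z : Phase n) :
    tw h (syn γ) g z = ∫ p : Phase n × Phase n, γ p.1 * g p.2 * eph p.1 (h • rot p.2) *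
      eph (p.1 + p.2) z ∂(volume.prod volume) := by
  have hi := integrable_mul_mul_eph hγ hg h
  have hz : Continuous fun ζ : Phase n => eph ζ z :=
    continuous_eph.comp (continuous_id.prodMk continuous_const)
  have hc : Continuous fun p : Phase n × Phase n => eph (p.1 + p.2) z := hz.comp continuous_add
  have hi' : Integrable (fun p : Phase n × Phase n =>
      γ p.1 * g p.2 * eph p.1 (h • rot p.2) * eph (p.1 + p.2) z) (volume.prod volume) :=
    integrable_mul_of_bounded hi hc fun p => (norm_eph _ _).le
  have h1 := integral_prod_symm _ hi'
  rw [h1]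
  clear h1 hi' hi hc
  unfold tw
  refine integral_congr_ae (Filter.Eventually.of_forall fun ζ => ?_)
  simp only [syn]
  rw [mul_assoc, ← integral_mul_const]
  refine integral_congr_ae (Filter.Eventually.of_forall fun ζ' => ?_)
  simp only [eph_add_left, eph_add_right]
  ring

lemma wtr_wop (h : ℝ) (g : Phase n → ℂ) (u : Pos n → ℂ) (ζ' : Phase n) (x : Pos n) :
    wtr h ζ' (wop h g u) x = ∫ ζ, g ζ * wtr h ζ' (wtr h ζ u) x := by
  rw [wtr, wop, ← integral_const_mul]
  congr 1
  funext ζ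
  simp only [wtr]
  ring

lemma continuous_wtr_left (h : ℝ) {u : Pos n → ℂ} (hu : Continuous u) (x : Pos n) :
    Continuous fun ζ : Phase n => wtr h ζ u x := by
  have h1 : Continuous fun ζ : Phase n => (ζ, x) := by fun_prop
  have h2 := (continuous_wtr h hu).comp h1
  exact h2

lemma wop_wopCLM {γ g : Phase n → ℂ} (hγ : Wt γ) (hg : Wt g) (h : ℝ) (u : 𝓢(Pos n, ℂ))
    (x : Pos n) : wop h γ (wopCLM h g hg u) x =
      ∫ p : Phase n × Phase n, γ p.1 * g p.2 * eph p.1 (h • rot p.2) *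
        wtr h (p.1 + p.2) u x ∂(volume.prod volume) := by
  have hi := integrable_mul_mul_eph hγ hg h
  obtain ⟨C, hC0, hC⟩ := SchwartzMap.exists_norm_le u
  have hx := continuous_wtr_left h u.continuous x
  have hw : Continuous fun p : Phase n × Phase n => wtr h (p.1 + p.2) u x :=
    hx.comp continuous_add
  have hi' : Integrable (fun p : Phase n × Phase n =>
      γ p.1 * g p.2 * eph p.1 (h • rot p.2) * wtr h (p.1 + p.2) u x) (volume.prod volume) :=
    integrable_mul_of_bounded hi hw fun p => (norm_wtr _ _ _ _).le.trans (hC _)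
  have h1 := integral_prod _ hi'
  rw [h1]
  clear h1 hi' hi hw
  refine integral_congr_ae (Filter.Eventually.of_forall fun ζ' => ?_)
  have e1 := wtr_wop h g u ζ' x
  have e2 : ∀ ζ, γ ζ' * (g ζ * wtr h ζ' (wtr h ζ u) x) =
      γ ζ' * g ζ * eph ζ' (h • rot ζ) * wtr h (ζ' + ζ) u x := fun ζ => by
    rw [wtr_wtr]
    ring
  have e3 : wtr h ζ' (wopCLM h g hg u) x = wtr h ζ' (wop h g u) x := rfl
  beta_reduce
  rw [e3, e1, ← integral_const_mul]
  exact integral_congr_ae (Filter.Eventually.of_forall e2)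

/-- The twisted product and the composed operator are superpositions over pairs `(ζ', ζ)`, at
frequency `ζ' + ζ`, with the same density `γ(ζ') g(ζ)` times the phase of `wtr_wtr`. -/
lemma quantizable_syn (hh : 0 < h) {γ : Phase n → ℂ} (hγ : Wt γ) : Quantizable h (syn γ) :=
  ⟨wopCLM h γ hγ, isWeylQuantization_of_superposition hh measurable_id hγ.integrable
    (fun _ => rfl) (fun _ _ => rfl), fun _ hg =>
    isWeylQuantization_of_superposition hh (Z := fun p : Phase n × Phase n => p.1 + p.2)
      (measurable_fst.add measurable_snd) (integrable_mul_mul_eph hγ hg h) (tw_syn hγ hg h)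
      (wop_wopCLM hγ hg h)⟩

/-- At this order all derivatives are square integrable, so the symbol is a Fourier synthesis with
finite moments. -/
lemma quantizable_of_decay (hh : 0 < h) (ha : Gam (-(2 * n + 1 : ℕ) : ℤ) a) : Quantizable h a := by
  obtain ⟨K, hK⟩ := exists_syn n
  obtain ⟨γ, hγ, rfl, -⟩ := hK a ha.1 fun m => by
    obtain ⟨C, hC0, hC⟩ := ha.2 m
    set w : Phase n → ℝ := fun z => ((1 + ‖z‖) ^ (2 * n + 1))⁻¹
    have hw0 : ∀ z, 0 ≤ w z := fun z => by positivity
    have hw1 : ∀ z, w z ≤ 1 := fun z => inv_le_one_of_one_le₀ (one_le_pow₀ (by simp))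
    have hwc : Continuous w := by
      refine Continuous.inv₀ (by fun_prop) fun z => by positivity
    have hwm : MemLp w 2 volume := by
      refine (memLp_two_iff_integrable_sq hwc.aestronglyMeasurable).2 ?_
      refine integrable_inv_pow.mono' (hwc.pow 2).aestronglyMeasurable
        (Filter.Eventually.of_forall fun z => ?_)
      rw [Real.norm_of_nonneg (sq_nonneg _), sq]
      exact mul_le_of_le_one_left (hw0 z) (hw1 z)
    have hle : ∀ z, ‖iteratedFDeriv ℝ m a z‖ ≤ C * 2 ^ (2 * n + 1) * w z := by
      intro z
      refine (hC z).trans ?_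
      rw [mul_assoc]
      refine mul_le_mul_of_nonneg_left ?_ hC0
      beta_reduce
      rw [zpow_neg, zpow_natCast]
      have h1 : 1 + ‖z‖ ≤ 2 * om z := by
        have := one_add_norm_sq_le z
        nlinarith [norm_nonneg z]
      have h2 : (0 : ℝ) < 1 + ‖z‖ := by positivity
      have h3 := om_pos z
      rw [inv_eq_one_div, div_le_iff₀ (by positivity)]
      simp only [w]
      rw [mul_assoc, mul_left_comm, ← div_eq_inv_mul, le_div_iff₀ (by positivity), one_mul,
        ← mul_pow]
      gcongr
    exact ((hwm.const_mul (C * 2 ^ (2 * n + 1))).mono' (aestronglyMeasurable_iteratedFDeriv ha.1 m)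
      (Filter.Eventually.of_forall hle)).2
  exact quantizable_syn hh hγ

lemma quantizable_sum {ι : Type*} (s : Finset ι) (f : ι → Phase n → ℂ)
    (hf : ∀ i ∈ s, Tame (f i)) (hq : ∀ i ∈ s, Quantizable h (f i)) (ha : Tame a)
    (qa : Quantizable h a) :
    Tame (fun z => a z + ∑ i ∈ s, f i z) ∧ Quantizable h (fun z => a z + ∑ i ∈ s, f i z) := by
  induction s using Finset.cons_induction with
  | empty => simpa using ⟨ha, qa⟩
  | cons i s hi ih =>
    obtain ⟨h1, h2⟩ := ih (fun i hi => hf i (Finset.mem_cons_of_mem hi))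
      (fun i hi => hq i (Finset.mem_cons_of_mem hi))
    have e : (fun z => a z + ∑ i ∈ Finset.cons i s hi, f i z) =
        fun z => f i z + (a z + ∑ i ∈ s, f i z) := by
      funext z
      rw [Finset.sum_cons]
      ring
    rw [e]
    have hfi := hf i (Finset.mem_cons_self _ _)
    refine ⟨?_, (hq i (Finset.mem_cons_self _ _)).add h2 hfi h1⟩
    obtain ⟨r, hr⟩ := hfi
    obtain ⟨s, hs⟩ := h1
    refine ⟨max r s, hr.1.add hs.1, fun m => ?_⟩
    obtain ⟨C, hC0, hC⟩ := (hr.mono (s := (max r s : ℕ)) (by simp)).2 m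
    obtain ⟨D, hD0, hD⟩ := (hs.mono (s := (max r s : ℕ)) (by simp)).2 m
    refine ⟨C + D, by positivity, fun z => ?_⟩
    have e2 := iteratedFDeriv_add_apply (x := z)
      (hr.1.of_le (by exact_mod_cast le_top) : ContDiff ℝ m (f i)).contDiffAt
      (hs.1.of_le (by exact_mod_cast le_top) : ContDiff ℝ m _).contDiffAt
    simp only [Pi.add_def] at e2
    rw [e2, add_mul]
    exact (norm_add_le _ _).trans (add_le_add (hC z) (hD z))

/-- Symbols of polynomial growth are quantizable. -/
lemma quantizable_of_gam (hh : 0 < h) {r : ℤ} (ha : Gam r a) : Quantizable h a := by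
  have key : ∀ (k : ℕ) (a : Phase n → ℂ), Gam (k - (2 * n + 1 : ℕ) : ℤ) a → Quantizable h a := by
    intro k
    induction k with
    | zero =>
      intro a ha
      exact quantizable_of_decay hh (by simpa using ha)
    | succ k ih =>
      intro a ha
      set s : ℤ := k - (2 * n + 1 : ℕ) with hs
      set f : Phase n → ℂ := fun z => (om z)⁻¹ • a z with hf
      have hfG : Gam s f := by
        have := gam_om_inv.smul ha
        refine this.mono (le_of_eq ?_)
        push_cast at hs ⊢
        omega
      -- Since `om = 1 + ∑ z_i²`, the symbol is recovered from `f = a / om`, to which the induction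
      -- hypothesis applies, by multiplying twice by coordinates.
      have e : a = fun z => f z + ∑ i, (pc i z : ℂ) * ((pc i z : ℂ) * f z) := by
        funext z
        have h1 : a z = (om z : ℂ) * f z := by
          rw [hf]
          simp only [Complex.real_smul]
          rw [← mul_assoc, ← Complex.ofReal_mul, mul_inv_cancel₀ (om_pos z).ne']
          simp
        rw [h1, om]
        push_cast
        rw [add_mul, one_mul, Finset.sum_mul]
        congr 1
        exact Finset.sum_congr rfl fun i _ => by ring
      rw [e]
      refine (quantizable_sum _ _ (fun i _ => (hfG.tame.pc_mul i).pc_mul i) (fun i _ => ?_)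
        hfG.tame (ih f hfG)).2
      rcases i with j | j
      · exact ((ih f hfG).x_mul hfG.tame j).x_mul (hfG.tame.pc_mul _) j
      -- The second multiplication by `ξ_j` also needs `∂_{x_j}(ξ_j f) = ξ_j ∂_{x_j} f`;
      -- differentiation preserves the order, so the first multiplication is proved for every symbol
      -- of order `s`.
      · have q1 : ∀ f, Gam s f → Quantizable h (fun z => (pc (Sum.inr j) z : ℂ) * f z) :=
          fun f hf => (ih f hf).xi_mul hh hf.tame j (ih _ (hf.dd _))
        refine (q1 f hfG).xi_mul hh (hfG.tame.pc_mul _) j ?_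
        have e3 : dd (basisVec j, 0) (fun z => (pc (Sum.inr j) z : ℂ) * f z) =
            fun z => (pc (Sum.inr j) z : ℂ) * dd (basisVec j, 0) f z := by
          funext z
          have h1 : HasFDerivAt (fun z : Phase n => (pc (Sum.inr j) z : ℂ))
              (Complex.ofRealCLM.comp (pc (Sum.inr j))) z :=
            (Complex.ofRealCLM.comp (pc (Sum.inr j))).hasFDerivAt
          have h2 := h1.mul (hfG.1.differentiable (by simp) z).hasFDerivAt
          have h3 : HasFDerivAt (fun z => (pc (Sum.inr j) z : ℂ) * f z) _ z := h2
          rw [dd, h3.fderiv]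
          simp [dd]
        rw [e3]
        exact q1 _ (hfG.dd _)
  refine key (r + (2 * n + 1 : ℕ)).toNat a (ha.mono ?_)
  have := Int.self_le_toNat (r + (2 * n + 1 : ℕ))
  omega

end Quantizable

/-! ### L² bounds for averages of translates -/

section Averages

variable {n : ℕ}

lemma lintegral_mul_rpow_two_le {α : Type*} [MeasurableSpace α] {μ : Measure α}
    {w f : α → ℝ≥0∞} (hw : Measurable w) (hf : Measurable f) :
    (∫⁻ v, w v * f v ∂μ) ^ (2 : ℝ) ≤ (∫⁻ v, w v ∂μ) * ∫⁻ v, w v * f v ^ (2 : ℝ) ∂μ := by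
  have hs : Measurable fun v => w v ^ (1 / 2 : ℝ) := hw.pow_const _
  have hsq : ∀ v, (w v ^ (1 / 2 : ℝ)) ^ (2 : ℝ) = w v := fun v => by
    rw [← ENNReal.rpow_mul]; norm_num
  have hmul : ∀ v, w v ^ (1 / 2 : ℝ) * w v ^ (1 / 2 : ℝ) = w v := fun v => by
    rw [← sq, ← ENNReal.rpow_two, hsq]
  have h1 := ENNReal.lintegral_mul_le_Lp_mul_Lq μ Real.HolderConjugate.two_two
    hs.aemeasurable (hs.mul hf).aemeasurable
  simp only [Pi.mul_apply, ← mul_assoc, hmul, ENNReal.mul_rpow_of_nonneg _ _ zero_le_two, hsq] at h1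
  calc _ ≤ ((∫⁻ v, w v ∂μ) ^ (1 / 2 : ℝ) * (∫⁻ v, w v * f v ^ (2 : ℝ) ∂μ) ^ (1 / 2 : ℝ)) ^ (2 : ℝ) :=
        ENNReal.rpow_le_rpow h1 zero_le_two
    _ = _ := by
      rw [ENNReal.mul_rpow_of_nonneg _ _ zero_le_two, ← ENNReal.rpow_mul, ← ENNReal.rpow_mul]
      norm_num

/-- The average of `‖G‖` over the translates `z + h v` with weight `w v`. -/
def avg (w : Phase n → ℝ) (h : ℝ) (G : Phase n → ℂ) (z : Phase n) : ℝ :=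
  ∫ v, w v * ‖G (z + h • v)‖

lemma aestronglyMeasurable_avg {w : Phase n → ℝ} (hw : Continuous w) (h : ℝ) {G : Phase n → ℂ}
    (hG : Continuous G) : AEStronglyMeasurable (avg w h G) volume := by
  have h1 : Continuous fun p : Phase n × Phase n => w p.2 * ‖G (p.1 + h • p.2)‖ :=
    (hw.comp continuous_snd).mul (hG.comp (by fun_prop)).norm
  exact h1.aestronglyMeasurable.integral_prod_right'

/-- Cauchy-Schwarz for the weight `w`, then Tonelli and translation invariance. The constant does
not involve `h`. -/
lemma eLpNorm_avg_le {w : Phase n → ℝ} (hw : Continuous w) (hw0 : ∀ v, 0 ≤ w v)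
    (hwi : Integrable w volume) (h : ℝ) {G : Phase n → ℂ} (hG : Continuous G) :
    eLpNorm (avg w h G) 2 volume ≤ ENNReal.ofReal (∫ v, w v) * eLpNorm G 2 volume := by
  have hwE : Measurable fun v => ENNReal.ofReal (w v) := hw.measurable.ennreal_ofReal
  set W : ℝ≥0∞ := ∫⁻ v, ENNReal.ofReal (w v) with hW
  have hWe : ENNReal.ofReal (∫ v, w v) = W :=
    ofReal_integral_eq_lintegral_ofReal hwi (Filter.Eventually.of_forall hw0)
  have hpt : ∀ z, ‖avg w h G z‖ₑ ^ (2 : ℝ) ≤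
      W * ∫⁻ v, ENNReal.ofReal (w v) * ‖G (z + h • v)‖ₑ ^ (2 : ℝ) := by
    intro z
    have h1 : ‖avg w h G z‖ₑ ≤ ∫⁻ v, ENNReal.ofReal (w v) * ‖G (z + h • v)‖ₑ := by
      refine (enorm_integral_le_lintegral_enorm _).trans (le_of_eq ?_)
      refine lintegral_congr fun v => ?_
      rw [enorm_mul, Real.enorm_of_nonneg (hw0 v), enorm_norm]
    refine (ENNReal.rpow_le_rpow h1 zero_le_two).trans ?_
    exact lintegral_mul_rpow_two_le hwE (hG.comp (by fun_prop)).measurable.enorm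
  have hint : ∫⁻ z, ‖avg w h G z‖ₑ ^ (2 : ℝ) ≤ W * (W * ∫⁻ z, ‖G z‖ₑ ^ (2 : ℝ)) := by
    have hm : Measurable fun p : Phase n × Phase n =>
        ENNReal.ofReal (w p.2) * ‖G (p.1 + h • p.2)‖ₑ ^ (2 : ℝ) := by
      have h1 : Continuous fun p : Phase n × Phase n => G (p.1 + h • p.2) :=
        hG.comp (by fun_prop)
      exact (hwE.comp measurable_snd).mul (h1.measurable.enorm.pow_const _)
    calc _ ≤ ∫⁻ z, W * ∫⁻ v, ENNReal.ofReal (w v) * ‖G (z + h • v)‖ₑ ^ (2 : ℝ) :=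
          lintegral_mono hpt
      _ = W * ∫⁻ z, ∫⁻ v, ENNReal.ofReal (w v) * ‖G (z + h • v)‖ₑ ^ (2 : ℝ) :=
          lintegral_const_mul _ hm.lintegral_prod_right'
      _ = W * ∫⁻ v, ∫⁻ z, ENNReal.ofReal (w v) * ‖G (z + h • v)‖ₑ ^ (2 : ℝ) := by
          rw [lintegral_lintegral_swap hm.aemeasurable]
      _ = W * ∫⁻ v, ENNReal.ofReal (w v) * ∫⁻ z, ‖G z‖ₑ ^ (2 : ℝ) := by
          congr 1
          refine lintegral_congr fun v => ?_
          have h1 : Continuous fun z => G (z + h • v) := hG.comp (by fun_prop)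
          rw [lintegral_const_mul _ (h1.measurable.enorm.pow_const _),
            lintegral_add_right_eq_self (μ := volume) (fun z => ‖G z‖ₑ ^ (2 : ℝ)) (h • v)]
      _ = _ := by rw [lintegral_mul_const _ hwE]
  rw [hWe, eLpNorm_eq_lintegral_rpow_enorm_toReal (by simp) (by simp),
    eLpNorm_eq_lintegral_rpow_enorm_toReal (by simp) (by simp)]
  simp only [ENNReal.toReal_ofNat]
  calc _ ≤ (W * (W * ∫⁻ z, ‖G z‖ₑ ^ (2 : ℝ))) ^ (1 / 2 : ℝ) :=
        ENNReal.rpow_le_rpow hint (by norm_num)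
    _ = _ := by
      rw [← mul_assoc, ENNReal.mul_rpow_of_nonneg _ _ (by norm_num), ← sq, ← ENNReal.rpow_two,
        ← ENNReal.rpow_mul]
      norm_num

/-- The weight `(1 + ‖v‖)^{-(2n+1)}`. -/
def wgt (v : Phase n) : ℝ := ((1 + ‖v‖) ^ (2 * n + 1))⁻¹

lemma wgt_nonneg (v : Phase n) : 0 ≤ wgt v := by unfold wgt; positivity

lemma continuous_wgt : Continuous (wgt : Phase n → ℝ) :=
  Continuous.inv₀ (by fun_prop) fun v => by positivity

/-- The amplitude `ζ ↦ om (h ζ)^{2n+1} g ζ`. -/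
def omul (h : ℝ) (g : Phase n → ℂ) (ζ : Phase n) : ℂ := ((om (h • ζ) ^ (2 * n + 1) : ℝ) : ℂ) * g ζ

lemma om_smul_pow_le {h : ℝ} (h0 : 0 ≤ h) (ζ : Phase n) : om (h • ζ) ^ (2 * n + 1) ≤
    (1 + 2 * n) ^ (2 * n + 1) * 2 ^ (2 * (2 * n + 1)) *
      (1 + h ^ (2 * (2 * n + 1)) * ‖ζ‖ ^ (2 * (2 * n + 1))) := by
  have h1 := om_le (h • ζ)
  have h2 := om_pos (h • ζ)
  set M := 2 * n + 1
  calc om (h • ζ) ^ M ≤ ((1 + 2 * n) * (1 + ‖h • ζ‖) ^ 2) ^ M := by gcongr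
    _ = (1 + 2 * n) ^ M * (1 + ‖h • ζ‖) ^ (2 * M) := by rw [mul_pow, ← pow_mul]
    _ ≤ (1 + 2 * n) ^ M * (2 ^ (2 * M - 1) * (1 ^ (2 * M) + ‖h • ζ‖ ^ (2 * M))) := by
        gcongr
        exact add_pow_le zero_le_one (norm_nonneg _) _
    _ ≤ (1 + 2 * n) ^ M * (2 ^ (2 * M) * (1 ^ (2 * M) + ‖h • ζ‖ ^ (2 * M))) := by
        gcongr
        · norm_num
        · omega
    _ = _ := by
        rw [norm_smul, Real.norm_of_nonneg h0, mul_pow, one_pow]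
        ring

lemma Wt.omul {g : Phase n → ℂ} (hg : Wt g) (h : ℝ) : Wt (omul h g) := by
  refine hg.mul (p := fun ζ => ((om (h • ζ) ^ (2 * n + 1) : ℝ) : ℂ)) ?_ (2 * (2 * n + 1))
    (C := (1 + 2 * n) ^ (2 * n + 1) * (1 + |h|) ^ (2 * (2 * n + 1))) fun ζ => ?_
  · exact Complex.continuous_ofReal.comp ((contDiff_om.continuous.comp (by fun_prop)).pow _)
  · have h1 := om_le (h • ζ)
    have h2 := om_pos (h • ζ)
    rw [Complex.norm_real, Real.norm_of_nonneg (by positivity)]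
    have h3 : 1 + ‖h • ζ‖ ≤ (1 + |h|) * (1 + ‖ζ‖) := by
      rw [norm_smul, Real.norm_eq_abs]
      nlinarith [norm_nonneg ζ, abs_nonneg h]
    calc _ ≤ ((1 + 2 * n) * (1 + ‖h • ζ‖) ^ 2) ^ (2 * n + 1) := by gcongr
      _ ≤ ((1 + 2 * n) * ((1 + |h|) * (1 + ‖ζ‖)) ^ 2) ^ (2 * n + 1) := by gcongr
      _ = _ := by
        rw [mul_pow, ← pow_mul, mul_pow, mul_assoc]

lemma continuous_syn {g : Phase n → ℂ} (hg : Wt g) : Continuous (syn g) := by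
  refine continuous_of_dominated (bound := fun ζ => ‖g ζ‖) (fun z => ?_) (fun z => ?_)
    hg.integrable.norm (Filter.Eventually.of_forall fun ζ => ?_)
  · exact hg.1.mul (continuous_eph.comp
      (by fun_prop : Continuous fun ζ : Phase n => (ζ, z))).aestronglyMeasurable
  · exact Filter.Eventually.of_forall fun ζ => by rw [norm_mul, norm_eph, mul_one]
  · exact continuous_const.mul (continuous_iff_continuousAt.2 fun z =>
      (hasFDerivAt_eph ζ z).continuousAt)

end Averages

/-! ### Pointwise domination of the twisted product -/

section Domination

variable {n : ℕ}

lemma norm_iteratedFDeriv_shift_le {a : Phase n → ℂ} (ha : ContDiff ℝ ∞ a) {A : ℝ} {m : ℕ}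
    (hA : ∀ z, ‖iteratedFDeriv ℝ m a z‖ ≤ A) (z : Phase n) {t : ℝ} (ht : |t| ≤ 1) (w : Phase n) :
    ‖iteratedFDeriv ℝ m (fun w => a (z + t • rot w)) w‖ ≤
      A * (1 + ‖(rot : Phase n →L[ℝ] Phase n)‖) ^ m := by
  have h1 : ContDiff ℝ ∞ fun w => a (z + w) := ha.comp (contDiff_const.add contDiff_id)
  have h2 : iteratedFDeriv ℝ m ((fun w => a (z + w)) ∘ (t • rot : Phase n →L[ℝ] Phase n)) w = _ :=
    (t • rot : Phase n →L[ℝ] Phase n).iteratedFDeriv_comp_right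
      (h1.of_le (by exact_mod_cast le_top) : ContDiff ℝ m _) w le_rfl
  have h3 : (fun w => a (z + t • rot w)) =
      (fun w => a (z + w)) ∘ (t • rot : Phase n →L[ℝ] Phase n) := rfl
  rw [h3, h2]
  refine (ContinuousMultilinearMap.norm_compContinuousLinearMap_le _ _).trans ?_
  rw [Finset.prod_const, Finset.card_univ, Fintype.card_fin, iteratedFDeriv_comp_add_left]
  have h4 : ‖(t • rot : Phase n →L[ℝ] Phase n)‖ ≤ 1 + ‖(rot : Phase n →L[ℝ] Phase n)‖ := by
    rw [norm_smul, Real.norm_eq_abs]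
    nlinarith [norm_nonneg (rot : Phase n →L[ℝ] Phase n)]
  have h5 : 0 ≤ A := (norm_nonneg _).trans (hA 0)
  gcongr
  exact hA _

lemma om_inv_pow_le_wgt (w : Phase n) : ((om w)⁻¹) ^ (2 * n + 1) ≤ 2 ^ (2 * n + 1) * wgt w := by
  have h0 : (1 : ℝ) ≤ 1 + ‖w‖ := by simp
  have h1 : 1 + ‖w‖ ≤ 2 * om w := by
    have := one_add_norm_sq_le w
    nlinarith
  have h3 := om_pos w
  rw [wgt, ← inv_pow, ← mul_pow]
  gcongr
  rw [← div_eq_mul_inv, le_div_iff₀ (by positivity), inv_mul_le_iff₀ h3]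
  linarith

/-- The function of `w` has bounded derivatives but no decay; division by `om ^ (2n+1)` makes its
derivatives integrable, so that it becomes a Fourier synthesis. The density `k` depends on `z` and
`t`, its bound does not. -/
lemma exists_shift_repr (n : ℕ) : ∃ C : ℝ, 0 ≤ C ∧ ∀ (a : Phase n → ℂ) (A : ℝ), ContDiff ℝ ∞ a →
    (∀ m ≤ 2 * n + 1, ∀ z, ‖iteratedFDeriv ℝ m a z‖ ≤ A) → ∀ (z : Phase n) (t : ℝ), |t| ≤ 1 →
    ∃ k : Phase n → ℂ, Continuous k ∧ (∀ v, ‖k v‖ ≤ C * A * wgt v) ∧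
      ∀ w, a (z + t • rot w) = ((om w ^ (2 * n + 1) : ℝ) : ℂ) * syn k w := by
  obtain ⟨C₀, hC₀, hC⟩ := exists_syn_of_decay n (2 * n + 1) le_rfl
  have hp := gam_om_inv_pow (n := n) (2 * n + 1)
  choose D hD0 hD using hp.2
  set L := ‖(rot : Phase n →L[ℝ] Phase n)‖
  set K : ℕ → ℝ := fun m => ∑ i ∈ Finset.range (m + 1),
    (m.choose i : ℝ) * (D i * 2 ^ (2 * n + 1)) * (1 + L) ^ (m - i)
  have hL : 0 ≤ L := norm_nonneg _
  have hK0 : ∀ m, 0 ≤ K m := fun m => Finset.sum_nonneg fun i _ => by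
    have := hD0 i
    positivity
  set S := ∑ m ∈ Finset.range (2 * n + 2), K m
  have hS0 : 0 ≤ S := Finset.sum_nonneg fun m _ => hK0 m
  refine ⟨C₀ * S, by positivity, fun a A ha hA z t ht => ?_⟩
  have hA0 : 0 ≤ A := (norm_nonneg _).trans (hA 0 (Nat.zero_le _) 0)
  have hsm : ContDiff ℝ ∞ fun w : Phase n => a (z + t • rot w) :=
    ha.comp (contDiff_const.add (rot.contDiff.const_smul t))
  obtain ⟨k, hk, hkb, hq⟩ := hC (fun w => (((om w)⁻¹) ^ (2 * n + 1)) • a (z + t • rot w))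
    (S * A) (hp.1.smul hsm) fun m hm w => by
      refine (norm_iteratedFDeriv_smul_le hp.1 hsm w (by exact_mod_cast le_top)).trans ?_
      have hw0 := wgt_nonneg w
      calc _ ≤ ∑ i ∈ Finset.range (m + 1), (m.choose i : ℝ) * (D i * (2 ^ (2 * n + 1) * wgt w)) *
            (A * (1 + L) ^ (m - i)) := by
            refine Finset.sum_le_sum fun i hi => ?_
            have h1 : ‖iteratedFDeriv ℝ i (fun z : Phase n => ((om z)⁻¹) ^ (2 * n + 1)) w‖ ≤
                D i * (2 ^ (2 * n + 1) * wgt w) := by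
              refine (hD i w).trans (mul_le_mul_of_nonneg_left ?_ (hD0 i))
              refine le_trans (le_of_eq ?_) (om_inv_pow_le_wgt w)
              beta_reduce
              rw [zpow_neg, zpow_natCast, inv_pow]
            have h2 := norm_iteratedFDeriv_shift_le ha (hA (m - i) (by omega)) z ht w
            have := hD0 i
            gcongr
        _ = K m * A * wgt w := by
            simp only [K, Finset.sum_mul]
            exact Finset.sum_congr rfl fun i _ => by ring
        _ ≤ S * A * wgt w := by
            gcongr
            exact Finset.single_le_sum (fun m _ => hK0 m) (Finset.mem_range.2 (by omega))
  refine ⟨k, hk, fun v => (hkb v).trans (le_of_eq (by rw [wgt]; ring)), fun w => ?_⟩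
  rw [← hq]
  beta_reduce
  rw [Complex.real_smul, ← mul_assoc, ← Complex.ofReal_mul, ← mul_pow,
    mul_inv_cancel₀ (om_pos w).ne', one_pow, Complex.ofReal_one, one_mul]

lemma norm_syn_le (g : Phase n → ℂ) (z : Phase n) : ‖syn g z‖ ≤ ∫ ζ, ‖g ζ‖ := by
  refine (norm_integral_le_integral_norm _).trans (le_of_eq ?_)
  simp only [norm_mul, norm_eph, mul_one]

lemma eph_swap (h : ℝ) (v ζ : Phase n) : eph v (h • ζ) = eph ζ (h • v) := by
  rw [eph, eph, pair_smul_right, pair_smul_right, pair_comm]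

/-- Take `w = hζ`: the factor `om (hζ) ^ (2n+1)` joins `g`, and the character of `v` at `hζ` equals
that of `ζ` at `hv`, so it merely translates `z`. Scaling by `h` rather than `τ` keeps the
translates independent of `τ`. -/
lemma tw_eq_integral_syn {a k g : Phase n → ℂ} (hk : Integrable k volume) (hg : Wt g) {h τ : ℝ}
    (hh : 0 < h) (z : Phase n)
    (hak : ∀ w, a (z + (τ / h) • rot w) = ((om w ^ (2 * n + 1) : ℝ) : ℂ) * syn k w) :
    tw τ a g z = ∫ v, k v * syn (omul h g) (z + h • v) := by
  have h0 : Integrable (fun p : Phase n × Phase n => omul h g p.1 * k p.2)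
      (volume.prod volume) := (hg.omul h).integrable.mul_prod hk
  have hz : Continuous fun ζ : Phase n => eph ζ z := by
    have h1 : Continuous fun ζ : Phase n => (ζ, z) := by fun_prop
    have h2 := continuous_eph.comp h1
    exact h2
  have hv : Continuous fun p : Phase n × Phase n => eph p.2 (h • p.1) := by
    have h1 : Continuous fun p : Phase n × Phase n => (p.2, h • p.1) := by fun_prop
    have h2 := continuous_eph.comp h1
    exact h2
  have hi : Integrable (fun p : Phase n × Phase n =>
      omul h g p.1 * k p.2 * (eph p.2 (h • p.1) * eph p.1 z)) (volume.prod volume) :=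
    integrable_mul_of_bounded h0 (hv.mul (hz.comp continuous_fst)) (C := 1) fun p => by
      rw [norm_mul, norm_eph, norm_eph, one_mul]
  calc tw τ a g z = ∫ ζ, ∫ v, omul h g ζ * k v * (eph v (h • ζ) * eph ζ z) := by
        refine integral_congr_ae (Filter.Eventually.of_forall fun ζ => ?_)
        have e : z + τ • rot ζ = z + (τ / h) • rot (h • ζ) := by
          rw [map_smul, smul_smul, div_mul_cancel₀ _ hh.ne']
        beta_reduce
        rw [e, hak, syn, mul_assoc, mul_assoc, ← integral_mul_const, ← integral_const_mul]
        refine integral_congr_ae (Filter.Eventually.of_forall fun v => ?_)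
        simp only [omul]
        ring
    _ = ∫ v, ∫ ζ, omul h g ζ * k v * (eph v (h • ζ) * eph ζ z) :=
        integral_integral_swap (f := fun ζ v => omul h g ζ * k v * (eph v (h • ζ) * eph ζ z)) hi
    _ = _ := by
        refine integral_congr_ae (Filter.Eventually.of_forall fun v => ?_)
        beta_reduce
        rw [syn, ← integral_const_mul]
        refine integral_congr_ae (Filter.Eventually.of_forall fun ζ => ?_)
        simp only [eph_swap h v ζ, eph_add_right]
        ring

/-- The pointwise bound of the twisted product by an average that does not depend on `τ`. -/
lemma norm_tw_le (n : ℕ) : ∃ C : ℝ, 0 ≤ C ∧ ∀ (a : Phase n → ℂ) (A : ℝ), ContDiff ℝ ∞ a →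
    (∀ m ≤ 2 * n + 1, ∀ z, ‖iteratedFDeriv ℝ m a z‖ ≤ A) → ∀ g : Phase n → ℂ, Wt g →
    ∀ h τ : ℝ, 0 < h → |τ| ≤ h → ∀ z,
      ‖tw τ a g z‖ ≤ C * A * avg wgt h (syn (omul h g)) z := by
  obtain ⟨C, hC0, hC⟩ := exists_shift_repr n
  refine ⟨C, hC0, fun a A ha hA g hg h τ hh hτ z => ?_⟩
  obtain ⟨k, hk, hkb, hak⟩ := hC a A ha hA z (τ / h) (by
    rw [abs_div, abs_of_pos hh]
    exact (div_le_one hh).2 hτ)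
  have hki : Integrable k volume :=
    (integrable_inv_pow.const_mul (C * A)).mono' hk.aestronglyMeasurable
      (Filter.Eventually.of_forall hkb)
  have hGc : Continuous fun v => syn (omul h g) (z + h • v) :=
    (continuous_syn (hg.omul h)).comp (by fun_prop)
  have hwi : Integrable (fun v => wgt v * ‖syn (omul h g) (z + h • v)‖) volume := by
    refine (integrable_inv_pow.mul_const (∫ ζ, ‖omul h g ζ‖)).mono'
      (continuous_wgt.mul hGc.norm).aestronglyMeasurable (Filter.Eventually.of_forall fun v => ?_)
    have := wgt_nonneg v
    rw [Real.norm_of_nonneg (by positivity)]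
    exact mul_le_mul_of_nonneg_left (norm_syn_le _ _) this
  rw [tw_eq_integral_syn hki hg hh z hak, avg, ← integral_const_mul]
  refine norm_integral_le_of_norm_le (hwi.const_mul _) (Filter.Eventually.of_forall fun v => ?_)
  rw [norm_mul, ← mul_assoc]
  exact mul_le_mul_of_nonneg_right (hkb v) (norm_nonneg _)

end Domination

/-! ### Families of amplitudes and uniform L² domination -/

section Expansion

variable {n : ℕ} {ρ s : ℝ}

/-- Families of amplitudes `g` with `‖|ζ|^m g‖ = O(h^(s - ρ m))` in `L²` for all `m`: the Fourier
side of the symbol class. -/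
def GSym (ρ s : ℝ) (g : ℝ → Phase n → ℂ) : Prop :=
  (∀ h, 0 < h → h < 1 → Wt (g h)) ∧ ∀ m : ℕ, ∃ C, 0 ≤ C ∧ ∀ h, 0 < h → h < 1 →
    eLpNorm (fun ζ => ‖ζ‖ ^ m • g h ζ) 2 volume ≤ ENNReal.ofReal (C * h ^ (s - ρ * m))

lemma GSym.lm_mul {g : ℝ → Phase n → ℂ} (hg : GSym ρ s g) (l : Phase n →L[ℝ] ℂ) :
    GSym ρ (s - ρ) (fun h => lm l (g h)) := by
  refine ⟨fun h h0 h1 => (hg.1 h h0 h1).lm l, fun m => ?_⟩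
  obtain ⟨C, hC0, hC⟩ := hg.2 (m + 1)
  refine ⟨‖l‖ * C, by positivity, fun h h0 h1 => ?_⟩
  have e1 : eLpNorm (fun ζ => ‖ζ‖ ^ m • lm l (g h) ζ) 2 volume ≤
      ENNReal.ofReal ‖l‖ * eLpNorm (fun ζ => ‖ζ‖ ^ (m + 1) • g h ζ) 2 volume := by
    refine eLpNorm_le_mul_eLpNorm_of_ae_le_mul (Filter.Eventually.of_forall fun ζ => ?_) 2
    simp only [lm, norm_smul, norm_mul, norm_pow, norm_norm]
    calc _ ≤ ‖ζ‖ ^ m * (‖l‖ * ‖ζ‖ * ‖g h ζ‖) := by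
          gcongr
          exact l.le_opNorm ζ
      _ = _ := by ring
  refine e1.trans ((mul_le_mul_right (hC h h0 h1) _).trans (le_of_eq ?_))
  rw [← ENNReal.ofReal_mul (norm_nonneg _)]
  congr 1
  rw [mul_assoc]
  congr 3
  push_cast
  ring

/-- The weight is bounded by a constant times `1 + h^M ‖ζ‖^M` with `M = 2(2n+1)`, and the moment
costs `h^(-ρM)`, so the product `h^(M(1-ρ))` is at most one. -/
lemma GSym.eLpNorm_omul_le (hρ : ρ ≤ 1) {g : ℝ → Phase n → ℂ} (hg : GSym ρ s g) : ∃ C, 0 ≤ C ∧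
    ∀ h, 0 < h → h < 1 → eLpNorm (omul h (g h)) 2 volume ≤ ENNReal.ofReal (C * h ^ s) := by
  obtain ⟨C, hC0, hC⟩ := hg.2 0
  set M := 2 * (2 * n + 1)
  obtain ⟨D, hD0, hD⟩ := hg.2 M
  set c : ℝ := (1 + 2 * n) ^ (2 * n + 1) * 2 ^ M
  have hc0 : 0 ≤ c := by positivity
  refine ⟨c * (C + D), by positivity, fun h h0 h1 => ?_⟩
  have hgm := (hg.1 h h0 h1).1
  set f1 : Phase n → ℝ := fun ζ => ‖(‖ζ‖ ^ 0 • g h ζ)‖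
  set f2 : Phase n → ℝ := fun ζ => h ^ M * ‖(‖ζ‖ ^ M • g h ζ)‖
  have m1 : AEStronglyMeasurable f1 volume :=
    ((by fun_prop : Continuous fun ζ : Phase n => ‖ζ‖ ^ 0).aestronglyMeasurable.smul hgm).norm
  have m2 : AEStronglyMeasurable f2 volume :=
    ((by fun_prop : Continuous fun ζ : Phase n => ‖ζ‖ ^ M).aestronglyMeasurable.smul
      hgm).norm.const_mul _
  have e1 : eLpNorm (omul h (g h)) 2 volume ≤ ENNReal.ofReal c * eLpNorm (f1 + f2) 2 volume := by
    refine eLpNorm_le_mul_eLpNorm_of_ae_le_mul (Filter.Eventually.of_forall fun ζ => ?_) 2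
    have hom := om_pos (h • ζ)
    rw [omul, norm_mul, Complex.norm_real, Real.norm_of_nonneg (by positivity),
      Real.norm_of_nonneg (by simp only [Pi.add_apply, f1, f2]; positivity)]
    simp only [Pi.add_apply, f1, f2, norm_smul, norm_pow, norm_norm, pow_zero, norm_one, one_mul]
    calc _ ≤ c * (1 + h ^ M * ‖ζ‖ ^ M) * ‖g h ζ‖ :=
          mul_le_mul_of_nonneg_right (om_smul_pow_le h0.le ζ) (norm_nonneg _)
      _ = _ := by ring
  have e2 : eLpNorm f1 2 volume ≤ ENNReal.ofReal (C * h ^ s) := by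
    rw [eLpNorm_norm]
    simpa using hC h h0 h1
  have e3 : eLpNorm f2 2 volume ≤ ENNReal.ofReal (D * h ^ s) := by
    have e4 : eLpNorm f2 2 volume ≤
        ENNReal.ofReal (h ^ M) * eLpNorm (fun ζ => ‖ζ‖ ^ M • g h ζ) 2 volume := by
      refine eLpNorm_le_mul_eLpNorm_of_ae_le_mul (Filter.Eventually.of_forall fun ζ => ?_) 2
      rw [Real.norm_of_nonneg (by positivity)]
    refine e4.trans ((mul_le_mul_right (hD h h0 h1) _).trans ?_)
    rw [← ENNReal.ofReal_mul (by positivity)]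
    refine ENNReal.ofReal_le_ofReal ?_
    rw [mul_left_comm, ← Real.rpow_natCast h M, ← Real.rpow_add h0]
    refine mul_le_mul_of_nonneg_left (Real.rpow_le_rpow_of_exponent_ge h0 h1.le ?_) hD0
    have : (0 : ℝ) ≤ M := by positivity
    nlinarith
  refine e1.trans ?_
  calc _ ≤ ENNReal.ofReal c * (ENNReal.ofReal (C * h ^ s) + ENNReal.ofReal (D * h ^ s)) := by
        gcongr
        exact (eLpNorm_add_le m1 m2 (by norm_num)).trans (add_le_add e2 e3)
    _ = _ := by
        have : 0 ≤ h ^ s := by positivity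
        rw [← ENNReal.ofReal_add (by positivity) (by positivity), ← ENNReal.ofReal_mul hc0]
        ring_nf

/-- The family `F` is dominated, uniformly in `0 ≤ τ ≤ h`, by functions of size `O(h^s)`
in `L²`. -/
def Dominated (s : ℝ) (F : ℝ → ℝ → Phase n → ℂ) : Prop :=
  ∃ C, 0 ≤ C ∧ ∀ h, 0 < h → h < 1 → ∃ Ψ : Phase n → ℝ, AEStronglyMeasurable Ψ volume ∧
    (∀ τ, 0 ≤ τ → τ ≤ h → ∀ z, ‖F h τ z‖ ≤ Ψ z) ∧
    eLpNorm Ψ 2 volume ≤ ENNReal.ofReal (C * h ^ s)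

lemma Dominated.zero : Dominated s (fun _ _ _ => 0 : ℝ → ℝ → Phase n → ℂ) :=
  ⟨0, le_rfl, fun h _ _ => ⟨fun _ => 0, aestronglyMeasurable_const, by simp, by simp⟩⟩

lemma Dominated.add {F G : ℝ → ℝ → Phase n → ℂ} (hF : Dominated s F) (hG : Dominated s G) :
    Dominated s (fun h τ z => F h τ z + G h τ z) := by
  obtain ⟨C, hC0, hC⟩ := hF
  obtain ⟨D, hD0, hD⟩ := hG
  refine ⟨C + D, by positivity, fun h h0 h1 => ?_⟩
  obtain ⟨Φ, hΦm, hΦ, hΦL⟩ := hC h h0 h1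
  obtain ⟨Ψ, hΨm, hΨ, hΨL⟩ := hD h h0 h1
  refine ⟨Φ + Ψ, hΦm.add hΨm, fun τ t0 t1 z => (norm_add_le _ _).trans
    (add_le_add (hΦ τ t0 t1 z) (hΨ τ t0 t1 z)), ?_⟩
  have : 0 ≤ h ^ s := by positivity
  rw [add_mul, ENNReal.ofReal_add (by positivity) (by positivity)]
  exact (eLpNorm_add_le hΦm hΨm (by norm_num)).trans (add_le_add hΦL hΨL)

lemma Dominated.sum {ι : Type*} (t : Finset ι) {F : ι → ℝ → ℝ → Phase n → ℂ}
    (hF : ∀ i ∈ t, Dominated s (F i)) : Dominated s (fun h τ z => ∑ i ∈ t, F i h τ z) := by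
  induction t using Finset.cons_induction with
  | empty => simpa using Dominated.zero
  | cons i t hi ih =>
    simp only [Finset.sum_cons]
    exact (hF i (Finset.mem_cons_self _ _)).add
      (ih fun j hj => hF j (Finset.mem_cons_of_mem hj))

lemma MemSk.dd {k l : ℕ} {a : SymbolFamily n} (ha : MemSk k a) (hl : k ≤ l + 1) (v : Phase n) :
    MemSk l (fun h => dd v (a h)) := by
  refine ⟨fun h h0 h1 => contDiff_dd (ha.1 h h0 h1) v, fun m hm => ?_⟩
  obtain ⟨C, hC⟩ := ha.2 (m + 1) (by omega)
  exact ⟨‖v‖ * C, fun h h0 h1 z => (norm_iteratedFDeriv_dd_le (ha.1 h h0 h1) v m z).trans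
    (mul_le_mul_of_nonneg_left (hC h h0 h1 z) (norm_nonneg v))⟩

lemma MemSk.mono {k l : ℕ} {a : SymbolFamily n} (ha : MemSk k a) (hl : k ≤ l) : MemSk l a :=
  ⟨ha.1, fun m hm => ha.2 m (hl.trans hm)⟩

lemma MemSk.gam {k : ℕ} {a : SymbolFamily n} (ha : MemSk k a) {h : ℝ} (h0 : 0 < h) (h1 : h < 1) :
    Gam k (a h) :=
  gam_of_bounded_derivs (ha.1 h h0 h1) k fun m hm =>
    let ⟨C, hC⟩ := ha.2 m hm
    ⟨C, fun z => hC h h0 h1 z⟩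

lemma dominated_tw (hρ : ρ ≤ 1) {a : SymbolFamily n} (ha : MemSk 0 a) {g : ℝ → Phase n → ℂ}
    (hg : GSym ρ s g) : Dominated s (fun h τ => tw τ (a h) (g h)) := by
  obtain ⟨C, hC0, hC⟩ := norm_tw_le n
  obtain ⟨D, hD0, hD⟩ := hg.eLpNorm_omul_le hρ
  choose A hA using fun m => ha.2 m (Nat.zero_le m)
  set B := ∑ m ∈ Finset.range (2 * n + 2), |A m|
  have hB0 : 0 ≤ B := Finset.sum_nonneg fun m _ => abs_nonneg _
  set I : ℝ := ∫ v : Phase n, wgt v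
  have hI0 : 0 ≤ I := integral_nonneg wgt_nonneg
  refine ⟨C * B * (I * D), by positivity, fun h h0 h1 => ?_⟩
  have hGc := continuous_syn ((hg.1 h h0 h1).omul h)
  refine ⟨fun z => C * B * avg wgt h (syn (omul h (g h))) z,
    (aestronglyMeasurable_avg continuous_wgt h hGc).const_mul _, fun τ t0 t1 z => ?_, ?_⟩
  · refine hC (a h) B (ha.1 h h0 h1) (fun m hm z => (hA m h h0 h1 z).trans ?_) (g h)
      (hg.1 h h0 h1) h τ h0 (by rwa [abs_of_nonneg t0]) z
    exact (le_abs_self _).trans (Finset.single_le_sum (f := fun m => |A m|)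
      (fun m _ => abs_nonneg _) (Finset.mem_range.2 (by omega)))
  · have e1 : eLpNorm (fun z => C * B * avg wgt h (syn (omul h (g h))) z) 2 volume ≤
        ENNReal.ofReal (C * B) * eLpNorm (avg wgt h (syn (omul h (g h)))) 2 volume := by
      refine eLpNorm_le_mul_eLpNorm_of_ae_le_mul (Filter.Eventually.of_forall fun ζ => ?_) 2
      rw [norm_mul, Real.norm_of_nonneg (by positivity : 0 ≤ C * B)]
    have hW := (hg.1 h h0 h1).omul h
    have h2 : MemLp (omul h (g h)) 2 volume :=
      ⟨hW.1, (hD h h0 h1).trans_lt ENNReal.ofReal_lt_top⟩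
    have e2 := eLpNorm_avg_le continuous_wgt wgt_nonneg integrable_inv_pow h hGc
    rw [eLpNorm_syn hW.integrable h2] at e2
    calc _ ≤ ENNReal.ofReal (C * B) * (ENNReal.ofReal I * ENNReal.ofReal (D * h ^ s)) := by
          refine e1.trans ?_
          gcongr
          refine e2.trans ?_
          gcongr
          exact hD h h0 h1
      _ = _ := by
          rw [← ENNReal.ofReal_mul hI0, ← ENNReal.ofReal_mul (by positivity)]
          ring_nf

end Expansion

/-! ### Taylor expansion in the twisting parameter -/

section Moyal

variable {n : ℕ} {ρ s : ℝ}

/-- The `j`-th derivative of the twisted product in the twisting parameter. -/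
def mo : ℕ → ℝ → (Phase n → ℂ) → (Phase n → ℂ) → Phase n → ℂ
  | 0, τ, a, g => tw τ a g
  | j + 1, τ, a, g => fun z => ∑ i, mo j τ (dd (pb i) a) (lm (rc i) g) z

lemma hasDerivAt_mo {r : ℕ} (j : ℕ) {a g : Phase n → ℂ} (ha : Gam r a) (hg : Wt g) (τ : ℝ)
    (z : Phase n) : HasDerivAt (fun τ => mo j τ a g z) (mo (j + 1) τ a g z) τ := by
  induction j generalizing a g with
  | zero => exact hasDerivAt_tw ha hg τ z
  | succ j ih => exact HasDerivAt.fun_sum fun i _ => ih (ha.dd _) (hg.lm _)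

lemma contDiff_mo {r : ℕ} (j : ℕ) {a g : Phase n → ℂ} (ha : Gam r a) (hg : Wt g) (τ : ℝ) :
    ContDiff ℝ ∞ (mo j τ a g) := by
  induction j generalizing a g with
  | zero => exact contDiff_tw ha hg τ
  | succ j ih => exact ContDiff.sum fun i _ => ih (ha.dd _) (hg.lm _)

lemma lm_comm (l l' : Phase n →L[ℝ] ℂ) (g : Phase n → ℂ) : lm l (lm l' g) = lm l' (lm l g) :=
  funext fun _ => mul_left_comm _ _ _

lemma dd_mo {r : ℕ} (j : ℕ) {a g : Phase n → ℂ} (ha : Gam r a) (hg : Wt g) (τ : ℝ)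
    (v : Phase n) :
    dd v (mo j τ a g) = fun z => mo j τ (dd v a) g z + mo j τ a (lm (dsym v) g) z := by
  induction j generalizing a g with
  | zero => exact dd_tw ha hg τ v
  | succ j ih =>
    funext z
    have h1 : HasFDerivAt (mo (j + 1) τ a g)
        (∑ i, fderiv ℝ (mo j τ (dd (pb i) a) (lm (rc i) g)) z) z :=
      HasFDerivAt.fun_sum fun i _ =>
        ((contDiff_mo j (ha.dd _) (hg.lm _) τ).differentiable (by simp) z).hasFDerivAt
    rw [dd, h1.fderiv, sum_apply]
    simp only [mo]
    rw [← Finset.sum_add_distrib]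
    refine Finset.sum_congr rfl fun i _ => ?_
    have h2 := congrFun (ih (ha.dd (pb i)) (hg.lm (rc i))) z
    rw [dd_comm ha.1, lm_comm]
    exact h2

/-- The `l` derivatives spent on `a` bring it from S_(l) to S_(0), where `dominated_tw` applies; the
`l` linear factors on `g` cost `h^(-ρl)`. -/
lemma dominated_mo (hρ : ρ ≤ 1) (l : ℕ) {a : SymbolFamily n} (ha : MemSk l a)
    {g : ℝ → Phase n → ℂ} (hg : GSym ρ s g) :
    Dominated (s - ρ * l) (fun h τ => mo l τ (a h) (g h)) := by
  induction l generalizing a g s with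
  | zero =>
    simp only [Nat.cast_zero, mul_zero, sub_zero]
    exact dominated_tw hρ ha hg
  | succ l ih =>
    have h1 := Dominated.sum (Finset.univ : Finset (Fin n ⊕ Fin n)) fun i _ =>
      ih (ha.dd le_rfl (pb i)) (hg.lm_mul (rc i))
    have e : s - ρ - ρ * l = s - ρ * ((l + 1 : ℕ) : ℝ) := by push_cast; ring
    rw [e] at h1
    exact h1

/-- The derivative of the remainder of order `N + 1` is the remainder of order `N` of the shifted
sequence, and the remainder vanishes at zero. The factor `1/N!` is not kept. -/
lemma norm_taylor_remainder_le (N : ℕ) {f : ℕ → ℝ → ℂ}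
    (hf : ∀ j t, HasDerivAt (f j) (f (j + 1) t) t) {C T : ℝ}
    (hC : ∀ t, 0 ≤ t → t ≤ T → ‖f N t‖ ≤ C) {t : ℝ} (t0 : 0 ≤ t) (t1 : t ≤ T) :
    ‖f 0 t - ∑ j ∈ Finset.range N, ((t ^ j / j.factorial : ℝ) : ℂ) * f j 0‖ ≤ C * t ^ N := by
  induction N generalizing f t with
  | zero => simpa using hC t t0 t1
  | succ N ih =>
    have hC0 : 0 ≤ C := (norm_nonneg _).trans (hC t t0 t1)
    have hd : ∀ u, HasDerivAt
        (fun u => f 0 u - ∑ j ∈ Finset.range (N + 1), ((u ^ j / j.factorial : ℝ) : ℂ) * f j 0)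
        (f 1 u - ∑ j ∈ Finset.range N, ((u ^ j / j.factorial : ℝ) : ℂ) * f (j + 1) 0) u := by
      intro u
      refine (hf 0 u).sub ?_
      simp only [Finset.sum_range_succ' _ N, pow_zero]
      refine (HasDerivAt.fun_sum fun j _ => ?_).add_const _
      refine HasDerivAt.mul_const ?_ _
      refine HasDerivAt.ofReal_comp ?_
      refine ((hasDerivAt_pow (j + 1) u).div_const _).congr_deriv ?_
      have : (j.factorial : ℝ) ≠ 0 := by exact_mod_cast j.factorial_ne_zero
      rw [Nat.factorial_succ, Nat.add_sub_cancel]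
      push_cast
      field_simp
    have hb : ∀ u ∈ Set.Ico 0 t,
        ‖f 1 u - ∑ j ∈ Finset.range N, ((u ^ j / j.factorial : ℝ) : ℂ) * f (j + 1) 0‖ ≤
          C * t ^ N := by
      intro u hu
      refine (ih (f := fun j => f (j + 1)) (fun j t => hf (j + 1) t) (fun t t0 t1 => hC t t0 t1)
        hu.1 (hu.2.le.trans t1)).trans ?_
      have := hu.1
      have := hu.2.le
      gcongr
    have h1 := norm_image_sub_le_of_norm_deriv_le_segment'
      (fun u _ => (hd u).hasDerivWithinAt) hb t ⟨t0, le_rfl⟩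
    have h2 : f 0 0 - ∑ j ∈ Finset.range (N + 1), (((0 : ℝ) ^ j / j.factorial : ℝ) : ℂ) * f j 0 =
        0 := by
      rw [Finset.sum_range_succ']
      simp
    rw [h2, sub_zero, sub_zero, mul_assoc, ← pow_succ] at h1
    exact h1

/-- The remainder of the expansion of the twisted product of order `N`. -/
def rem (N : ℕ) (h : ℝ) (a g : Phase n → ℂ) (z : Phase n) : ℂ :=
  tw h a g z - ∑ j ∈ Finset.range N, ((h ^ j / j.factorial : ℝ) : ℂ) * mo j 0 a g z

lemma contDiff_rem {r : ℕ} (N : ℕ) (h : ℝ) {a g : Phase n → ℂ} (ha : Gam r a) (hg : Wt g) :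
    ContDiff ℝ ∞ (rem N h a g) :=
  (contDiff_tw ha hg h).sub (ContDiff.sum fun j _ => contDiff_const.mul (contDiff_mo j ha hg 0))

/-- The same Leibniz rule holds for the twisted product and for each Taylor term, hence for their
difference. Estimates of derivatives thus reduce to the undifferentiated remainder. -/
lemma dd_rem {r : ℕ} (N : ℕ) (h : ℝ) {a g : Phase n → ℂ} (ha : Gam r a) (hg : Wt g)
    (v : Phase n) :
    dd v (rem N h a g) = fun z => rem N h (dd v a) g z + rem N h a (lm (dsym v) g) z := by
  funext z
  have h1 : HasFDerivAt (rem N h a g) (fderiv ℝ (tw h a g) z -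
      ∑ j ∈ Finset.range N, ((h ^ j / j.factorial : ℝ) : ℂ) • fderiv ℝ (mo j 0 a g) z) z :=
    ((contDiff_tw ha hg h).differentiable (by simp) z).hasFDerivAt.sub
      (HasFDerivAt.fun_sum fun j _ =>
        ((contDiff_mo j ha hg 0).differentiable (by simp) z).hasFDerivAt.const_mul _)
  have h2 := congrFun (dd_tw ha hg h v) z
  have h3 := fun j => congrFun (dd_mo j ha hg 0 v) z
  simp only [dd] at h2 h3
  rw [dd, h1.fderiv]
  simp only [sub_apply, sum_apply, smul_apply, smul_eq_mul, h2, h3, rem, mul_add,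
    Finset.sum_add_distrib]
  ring

/-- Taylor's formula is used at each `z` separately, which is why a majorant common to all `τ` is
required instead of an L² bound for each `τ`. -/
lemma eLpNorm_rem_zero_le (hρ : ρ ≤ 1) (N : ℕ) {a : SymbolFamily n} (ha : MemSk N a)
    {g : ℝ → Phase n → ℂ} (hg : GSym ρ s g) : ∃ C, 0 ≤ C ∧ ∀ h, 0 < h → h < 1 →
      eLpNorm (rem N h (a h) (g h)) 2 volume ≤ ENNReal.ofReal (C * h ^ (s + N * (1 - ρ))) := by
  obtain ⟨C, hC0, hC⟩ := dominated_mo hρ N ha hg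
  refine ⟨C, hC0, fun h h0 h1 => ?_⟩
  obtain ⟨Ψ, hΨm, hΨ, hΨL⟩ := hC h h0 h1
  have hpt : ∀ z, ‖rem N h (a h) (g h) z‖ ≤ h ^ N * ‖Ψ z‖ := by
    intro z
    have h2 := norm_taylor_remainder_le N (f := fun j τ => mo j τ (a h) (g h) z)
      (fun j t => hasDerivAt_mo j (ha.gam h0 h1) (hg.1 h h0 h1) t z)
      (fun t t0 t1 => hΨ t t0 t1 z) h0.le le_rfl
    refine h2.trans ?_
    rw [mul_comm]
    exact mul_le_mul_of_nonneg_left (Real.le_norm_self _) (by positivity)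
  refine (eLpNorm_le_mul_eLpNorm_of_ae_le_mul (Filter.Eventually.of_forall hpt) 2).trans ?_
  refine (mul_le_mul_right hΨL _).trans (le_of_eq ?_)
  rw [← ENNReal.ofReal_mul (by positivity), mul_left_comm, ← Real.rpow_natCast h N,
    ← Real.rpow_add h0]
  congr 3
  ring

lemma eLpNorm_iteratedFDeriv_rem_le (hρ0 : 0 ≤ ρ) (hρ : ρ ≤ 1) (N m : ℕ) {a : SymbolFamily n}
    (ha : MemSk N a) {g : ℝ → Phase n → ℂ} (hg : GSym ρ s g) : ∃ C, 0 ≤ C ∧ ∀ h, 0 < h → h < 1 →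
      eLpNorm (iteratedFDeriv ℝ m (rem N h (a h) (g h))) 2 volume ≤
        ENNReal.ofReal (C * h ^ (s + N * (1 - ρ) - ρ * m)) := by
  induction m generalizing a g s with
  | zero =>
    obtain ⟨C, hC0, hC⟩ := eLpNorm_rem_zero_le hρ N ha hg
    refine ⟨C, hC0, fun h h0 h1 => ?_⟩
    refine le_trans (le_of_eq ?_) ((hC h h0 h1).trans (le_of_eq (by simp)))
    exact eLpNorm_congr_norm_ae (Filter.Eventually.of_forall fun z => norm_iteratedFDeriv_zero)
  | succ m ih =>
    choose C hC0 hC using fun i => ih (ha.dd (by omega) (pb i)) hg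
    choose D hD0 hD using fun i => ih ha (hg.lm_mul (dsym (pb i)))
    refine ⟨∑ i : Fin n ⊕ Fin n, (C i + D i),
      Finset.sum_nonneg fun i _ => add_nonneg (hC0 i) (hD0 i), fun h h0 h1 => ?_⟩
    have hG := ha.gam h0 h1
    have hW := hg.1 h h0 h1
    set F : Fin n ⊕ Fin n → Phase n → ℝ := fun i z =>
      ‖iteratedFDeriv ℝ m (rem N h (dd (pb i) (a h)) (g h)) z‖
    set G : Fin n ⊕ Fin n → Phase n → ℝ := fun i z =>
      ‖iteratedFDeriv ℝ m (rem N h (a h) (lm (dsym (pb i)) (g h))) z‖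
    have hFm : ∀ i, AEStronglyMeasurable (F i) volume := fun i =>
      (aestronglyMeasurable_iteratedFDeriv (contDiff_rem N h (hG.dd _) hW) m).norm
    have hGm : ∀ i, AEStronglyMeasurable (G i) volume := fun i =>
      (aestronglyMeasurable_iteratedFDeriv (contDiff_rem N h hG (hW.lm _)) m).norm
    have hpt : ∀ z, ‖iteratedFDeriv ℝ (m + 1) (rem N h (a h) (g h)) z‖ ≤
        (∑ i, (F i + G i)) z := by
      intro z
      refine (norm_iteratedFDeriv_succ_le_sum phase_sum (contDiff_rem N h hG hW) m z).trans ?_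
      rw [Finset.sum_apply]
      refine Finset.sum_le_sum fun i _ => ?_
      refine (mul_le_of_le_one_left (norm_nonneg _) (norm_pc_le i)).trans ?_
      rw [dd_rem N h hG hW]
      have e : iteratedFDeriv ℝ m (fun z => rem N h (dd (pb i) (a h)) (g h) z +
          rem N h (a h) (lm (dsym (pb i)) (g h)) z) z = _ :=
        iteratedFDeriv_add_apply
          ((contDiff_rem N h (hG.dd _) hW).of_le (by exact_mod_cast le_top)).contDiffAt
          ((contDiff_rem N h hG (hW.lm _)).of_le (by exact_mod_cast le_top)).contDiffAt
      rw [e]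
      exact norm_add_le _ _
    have hle : ∀ i, eLpNorm (F i + G i) 2 volume ≤
        ENNReal.ofReal ((C i + D i) * h ^ (s + N * (1 - ρ) - ρ * ((m + 1 : ℕ) : ℝ))) := by
      intro i
      have hp : 0 ≤ h ^ (s + N * (1 - ρ) - ρ * ((m + 1 : ℕ) : ℝ)) := by positivity
      have := hC0 i
      have := hD0 i
      rw [add_mul, ENNReal.ofReal_add (by positivity) (by positivity)]
      refine (eLpNorm_add_le (hFm i) (hGm i) (by norm_num)).trans (add_le_add ?_ ?_)
      · rw [eLpNorm_norm]
        refine (hC i h h0 h1).trans (ENNReal.ofReal_le_ofReal ?_)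
        -- A derivative falling on `a` loses nothing, so this term is better than required by `h^ρ`;
        -- only one falling on the character costs `h^(-ρ)`.
        refine mul_le_mul_of_nonneg_left (Real.rpow_le_rpow_of_exponent_ge h0 h1.le ?_) (hC0 i)
        push_cast
        linarith
      · rw [eLpNorm_norm]
        refine (hD i h h0 h1).trans (le_of_eq ?_)
        congr 3
        push_cast
        ring
    calc _ ≤ eLpNorm (∑ i, (F i + G i)) 2 volume :=
          eLpNorm_mono_real hpt
      _ ≤ ∑ i, eLpNorm (F i + G i) 2 volume :=
          eLpNorm_sum_le (fun i _ => (hFm i).add (hGm i)) (by norm_num)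
      _ ≤ ∑ i, ENNReal.ofReal
          ((C i + D i) * h ^ (s + N * (1 - ρ) - ρ * ((m + 1 : ℕ) : ℝ))) :=
          Finset.sum_le_sum fun i _ => hle i
      _ = _ := by
          rw [← ENNReal.ofReal_sum_of_nonneg, Finset.sum_mul]
          intro i _
          have := hC0 i
          have := hD0 i
          positivity

end Moyal

/-! ### Identification of the Taylor terms and passage to symbol classes -/

section Diagonal

variable {n : ℕ} {ρ s : ℝ}

lemma contDiff_dirD {F : Phase n × Phase n → ℂ} (hF : ContDiff ℝ ∞ F) (v : Phase n × Phase n) :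
    ContDiff ℝ ∞ (dirD v F) := contDiff_const.mul (contDiff_dd hF v)

lemma dirD_sum {ι : Type*} (t : Finset ι) (c : ℂ) {F : ι → Phase n × Phase n → ℂ}
    (hF : ∀ i ∈ t, ContDiff ℝ ∞ (F i)) (v : Phase n × Phase n) :
    dirD v (fun p => c * ∑ i ∈ t, F i p) = fun p => c * ∑ i ∈ t, dirD v (F i) p := by
  funext p
  have h1 : HasFDerivAt (fun p => c * ∑ i ∈ t, F i p) (c • ∑ i ∈ t, fderiv ℝ (F i) p) p :=
    (HasFDerivAt.fun_sum fun i hi =>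
      ((hF i hi).differentiable (by simp) p).hasFDerivAt).const_mul c
  rw [dirD, h1.fderiv]
  simp only [smul_apply, sum_apply, smul_eq_mul, dirD]
  rw [← Finset.mul_sum, mul_left_comm]

lemma sigmaD_sum {ι : Type*} (t : Finset ι) (c : ℂ) {F : ι → Phase n × Phase n → ℂ}
    (hF : ∀ i ∈ t, ContDiff ℝ ∞ (F i)) :
    sigmaD (fun p => c * ∑ i ∈ t, F i p) = fun p => c * ∑ i ∈ t, sigmaD (F i) p := by
  funext p
  simp only [sigmaD]
  have h1 : ∀ v w, dirD v (dirD w fun p => c * ∑ i ∈ t, F i p) =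
      fun p => c * ∑ i ∈ t, dirD v (dirD w (F i)) p := fun v w => by
    rw [dirD_sum t c hF, dirD_sum t c fun i hi => contDiff_dirD (hF i hi) w]
  simp only [h1, ← mul_sub, ← Finset.sum_sub_distrib]
  rw [← Finset.mul_sum, Finset.sum_comm]

lemma dirD_tensor {a b : Phase n → ℂ} (ha : Differentiable ℝ a) (hb : Differentiable ℝ b)
    (v w : Phase n) : dirD (v, w) (fun p : Phase n × Phase n => a p.1 * b p.2) =
      fun p => (1 / Complex.I) * (a p.1 * dd w b p.2 + dd v a p.1 * b p.2) := by
  funext p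
  have h1 := (ha p.1).hasFDerivAt.comp p (hasFDerivAt_fst (𝕜 := ℝ) (p := p))
  have h2 := (hb p.2).hasFDerivAt.comp p (hasFDerivAt_snd (𝕜 := ℝ) (p := p))
  have h3 : HasFDerivAt (fun p : Phase n × Phase n => a p.1 * b p.2) _ p := h1.mul h2
  rw [dirD, h3.fderiv]
  simp [dd]
  ring

lemma dd_zero_left (f : Phase n → ℂ) : dd 0 f = fun _ => 0 := funext fun z => by simp [dd]

/-- The two factors `1/i` multiply to `-1`, which reverses the sign of the symplectic form. -/
lemma sigmaD_tensor {a b : Phase n → ℂ} (ha : ContDiff ℝ ∞ a) (hb : ContDiff ℝ ∞ b) :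
    sigmaD (fun p : Phase n × Phase n => a p.1 * b p.2) = fun p => ∑ j : Fin n,
      (dd (0, basisVec j) a p.1 * dd (basisVec j, 0) b p.2 -
        dd (basisVec j, 0) a p.1 * dd (0, basisVec j) b p.2) := by
  have key : ∀ v w : Phase n, dirD (v, 0) (dirD (0, w) fun p : Phase n × Phase n =>
      a p.1 * b p.2) = fun p => -(dd v a p.1 * dd w b p.2) := by
    intro v w
    have h1 : dirD (0, w) (fun p : Phase n × Phase n => a p.1 * b p.2) =
        fun p => (fun z => (1 / Complex.I) * a z) p.1 * dd w b p.2 := by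
      rw [dirD_tensor (ha.differentiable (by simp)) (hb.differentiable (by simp))]
      funext p
      simp only [dd_zero_left]
      ring
    have h2 : ContDiff ℝ ∞ fun z => (1 / Complex.I) * a z := contDiff_const.mul ha
    have h3 : dd v (fun z => (1 / Complex.I) * a z) = fun z => (1 / Complex.I) * dd v a z := by
      funext z
      rw [dd, ((ha.differentiable (by simp) z).hasFDerivAt.const_mul (1 / Complex.I)).fderiv]
      rfl
    rw [h1, dirD_tensor (h2.differentiable (by simp))
      ((contDiff_dd hb w).differentiable (by simp))]
    funext p
    simp only [dd_zero_left, h3]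
    have hI : (1 / Complex.I) * (1 / Complex.I) = -1 := by
      rw [← mul_div_mul_comm, Complex.I_mul_I]; norm_num
    linear_combination (dd v a p.1 * dd w b p.2) * hI
  funext p
  simp only [sigmaD]
  refine Finset.sum_congr rfl fun j _ => ?_
  have e1 := congrFun (key (basisVec j, 0) (0, basisVec j)) p
  have e2 := congrFun (key (0, basisVec j) (basisVec j, 0)) p
  have z0 : ((0 : Pos n), (0 : Pos n)) = (0 : Phase n) := rfl
  rw [z0, e1, e2]
  ring

lemma gam_one : Gam 0 (fun _ : Phase n => (1 : ℂ)) := by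
  have := gam_of_bounded_derivs (f := fun _ : Phase n => (1 : ℂ)) contDiff_const 0 fun m _ => by
    rcases m with _ | m
    · exact ⟨1, fun z => by simp⟩
    · exact ⟨0, fun z => by simp [iteratedFDeriv_const_of_ne]⟩
  exact_mod_cast this

lemma tw_zero_one (g : Phase n → ℂ) : tw 0 (fun _ => 1) g = syn g :=
  funext fun z => by rw [tw_zero, one_mul]

lemma contDiff_syn {g : Phase n → ℂ} (hg : Wt g) : ContDiff ℝ ∞ (syn g) := by
  rw [← tw_zero_one]
  exact contDiff_tw (r := 0) gam_one hg 0

lemma dd_syn {g : Phase n → ℂ} (hg : Wt g) (v : Phase n) :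
    dd v (syn g) = syn (lm (dsym v) g) := by
  have h1 := dd_tw (r := 0) gam_one hg 0 v
  rw [tw_zero_one, tw_zero_one] at h1
  rw [h1]
  funext z
  simp [tw_zero, dd]

lemma syn_lm_of_eq (c : ℂ) {l l' : Phase n →L[ℝ] ℂ} (hl : ∀ ζ, l ζ = c * l' ζ)
    (g : Phase n → ℂ) (z : Phase n) : syn (lm l g) z = c * syn (lm l' g) z := by
  rw [syn, syn, ← integral_const_mul]
  refine integral_congr_ae (Filter.Eventually.of_forall fun ζ => ?_)
  simp only [lm, hl]
  ring

lemma dsym_basis_right (j : Fin n) (ζ : Phase n) :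
    dsym (0, basisVec j) ζ = -(2 * Complex.I) * rc (Sum.inl j) ζ := by
  rw [dsym_apply, rc_apply, pair_eq]
  simp [rot, basisVec, EuclideanSpace.inner_single_right]
  ring

/-- The iterates of the bidifferential operator `sigmaD` on a tensor product. -/
def bm : ℕ → (Phase n → ℂ) → (Phase n → ℂ) → Phase n × Phase n → ℂ
  | 0, a, g => fun p => a p.1 * syn g p.2
  | j + 1, a, g => fun p => ∑ i, bm j (dd (pb i) a) (lm (rc i) g) p

lemma contDiff_bm (j : ℕ) {a g : Phase n → ℂ} (ha : ContDiff ℝ ∞ a) (hg : Wt g) :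
    ContDiff ℝ ∞ (bm j a g) := by
  induction j generalizing a g with
  | zero => exact (ha.comp contDiff_fst).mul ((contDiff_syn hg).comp contDiff_snd)
  | succ j ih => exact ContDiff.sum fun i _ => ih (contDiff_dd ha _) (hg.lm _)

/-- On amplitudes, `∂_{x_j}` is `2i` times the `ξ_j`-coordinate of `rot ζ`, and `∂_{ξ_j}` is `-2i`
times its `x_j`-coordinate. The minus sign absorbs the antisymmetry, leaving the same sum as in the
`τ`-derivative; the factor `2i` cancels the one in `h/(2i)`. -/
lemma sigmaD_bm (j : ℕ) {a g : Phase n → ℂ} (ha : ContDiff ℝ ∞ a) (hg : Wt g) :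
    sigmaD (bm j a g) = fun p => 2 * Complex.I * bm (j + 1) a g p := by
  induction j generalizing a g with
  | zero =>
    have h1 : sigmaD (bm 0 a g) = _ := sigmaD_tensor ha (contDiff_syn hg)
    rw [h1]
    funext p
    simp only [bm, Fintype.sum_sum_type, dd_syn hg, syn_lm_of_eq _ (dsym_basis_left _),
      syn_lm_of_eq _ (dsym_basis_right _), pb, Sum.elim_inl, Sum.elim_inr]
    rw [mul_add, Finset.mul_sum, Finset.mul_sum, ← Finset.sum_add_distrib]
    exact Finset.sum_congr rfl fun i _ => by ring
  | succ j ih =>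
    have h1 := sigmaD_sum (Finset.univ : Finset (Fin n ⊕ Fin n)) 1
      (F := fun i => bm j (dd (pb i) a) (lm (rc i) g))
      fun i _ => contDiff_bm j (contDiff_dd ha _) (hg.lm _)
    simp only [one_mul, fun i => ih (contDiff_dd ha (pb i)) (hg.lm (rc i)), ← Finset.mul_sum] at h1
    exact h1

lemma sigmaD_iterate (j : ℕ) {a g : Phase n → ℂ} (ha : ContDiff ℝ ∞ a) (hg : Wt g) :
    sigmaD^[j] (fun p : Phase n × Phase n => a p.1 * syn g p.2) =
      fun p => (2 * Complex.I) ^ j * bm j a g p := by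
  induction j with
  | zero => simp [bm]
  | succ j ih =>
    rw [Function.iterate_succ_apply', ih]
    have h1 := sigmaD_sum ({()} : Finset Unit) ((2 * Complex.I) ^ j) (F := fun _ => bm j a g)
      fun _ _ => contDiff_bm j ha hg
    simp only [Finset.sum_singleton, sigmaD_bm j ha hg] at h1
    rw [h1]
    funext p
    ring

lemma bm_diagonal (j : ℕ) (a g : Phase n → ℂ) (z : Phase n) : bm j a g (z, z) = mo j 0 a g z := by
  induction j generalizing a g with
  | zero => exact (tw_zero a g z).symm
  | succ j ih => exact Finset.sum_congr rfl fun i _ => ih _ _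

lemma moyalTerm_syn (h : ℝ) (j : ℕ) {a g : Phase n → ℂ} (ha : ContDiff ℝ ∞ a) (hg : Wt g)
    (z : Phase n) :
    moyalTerm h j a (syn g) z = ((h ^ j / j.factorial : ℝ) : ℂ) * mo j 0 a g z := by
  rw [moyalTerm, sigmaD_iterate j ha hg]
  beta_reduce
  rw [bm_diagonal, div_pow]
  have hI : (2 * Complex.I) ^ j ≠ 0 := pow_ne_zero j (by simp)
  push_cast
  field_simp

/-- The normalization `h^(-n/2)` in the class of `b` becomes the exponent `s = n/2` on the Fourier
side. -/
lemma exists_amplitude_family {b : SymbolFamily n} (hb : MemSL2 ρ b) :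
    ∃ g : ℝ → Phase n → ℂ, GSym ρ (n / 2) g ∧ ∀ h, 0 < h → h < 1 → b h = syn (g h) := by
  obtain ⟨K, hK⟩ := exists_syn n
  choose C hC using hb.2
  have hbd : ∀ m h, 0 < h → h < 1 → eLpNorm (iteratedFDeriv ℝ m (b h)) 2 volume ≤
      ENNReal.ofReal (|C m| * h ^ ((n : ℝ) / 2 - ρ * m)) := by
    intro m h h0 h1
    have hp : 0 < h ^ (-(n : ℝ) / 2) := by positivity
    have h2 : ENNReal.ofReal (h ^ ((n : ℝ) / 2)) * ENNReal.ofReal (h ^ (-(n : ℝ) / 2)) = 1 := by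
      rw [← ENNReal.ofReal_mul (by positivity), ← Real.rpow_add h0]
      simp [neg_div]
    calc _ = ENNReal.ofReal (h ^ ((n : ℝ) / 2)) * (ENNReal.ofReal (h ^ (-(n : ℝ) / 2)) *
          eLpNorm (iteratedFDeriv ℝ m (b h)) 2 volume) := by rw [← mul_assoc, h2, one_mul]
      _ ≤ ENNReal.ofReal (h ^ ((n : ℝ) / 2)) * ENNReal.ofReal (|C m| * h ^ (-(ρ * m))) := by
          gcongr
          refine (hC m h h0 h1).trans (ENNReal.ofReal_le_ofReal ?_)
          gcongr
          exact le_abs_self _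
      _ = _ := by
          rw [← ENNReal.ofReal_mul (by positivity), mul_left_comm, ← Real.rpow_add h0]
          rfl
  have hex : ∀ h, ∃ g : Phase n → ℂ, 0 < h → h < 1 → Wt g ∧ b h = syn g ∧
      ∀ m, eLpNorm (fun ζ => ‖ζ‖ ^ m • g ζ) 2 volume ≤
        ENNReal.ofReal (K m) * eLpNorm (iteratedFDeriv ℝ m (b h)) 2 volume := by
    intro h
    by_cases hh : 0 < h ∧ h < 1
    · obtain ⟨g, hg⟩ := hK (b h) (hb.1 h hh.1 hh.2)
        fun m => (hbd m h hh.1 hh.2).trans_lt ENNReal.ofReal_lt_top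
      exact ⟨g, fun _ _ => hg⟩
    · exact ⟨0, fun h0 h1 => absurd ⟨h0, h1⟩ hh⟩
  choose g hg using hex
  refine ⟨g, ⟨fun h h0 h1 => (hg h h0 h1).1, fun m => ⟨|K m| * |C m|, by positivity,
    fun h h0 h1 => ?_⟩⟩, fun h h0 h1 => (hg h h0 h1).2.1⟩
  refine ((hg h h0 h1).2.2 m).trans ?_
  calc _ ≤ ENNReal.ofReal |K m| * ENNReal.ofReal (|C m| * h ^ ((n : ℝ) / 2 - ρ * m)) := by
        gcongr
        · exact le_abs_self _
        · exact hbd m h h0 h1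
    _ = _ := by rw [← ENNReal.ofReal_mul (abs_nonneg _), mul_assoc]

lemma memPowSL2_rem (hρ0 : 0 ≤ ρ) (hρ : ρ ≤ 1) (N : ℕ) {a : SymbolFamily n} (ha : MemSk N a)
    {g : ℝ → Phase n → ℂ} (hg : GSym ρ (n / 2) g) {r : SymbolFamily n}
    (hr : ∀ h, 0 < h → h < 1 → r h = rem N h (a h) (g h)) :
    MemPowSL2 (N * (1 - ρ)) ρ r := by
  have hsm : ∀ h, 0 < h → h < 1 → ContDiff ℝ ∞ (r h) := fun h h0 h1 => by
    rw [hr h h0 h1]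
    exact contDiff_rem N h (ha.gam h0 h1) (hg.1 h h0 h1)
  refine ⟨fun h h0 h1 => contDiff_const.mul (hsm h h0 h1), fun m => ?_⟩
  obtain ⟨C, hC0, hC⟩ := eLpNorm_iteratedFDeriv_rem_le hρ0 hρ N m ha hg
  refine ⟨C, fun h h0 h1 => ?_⟩
  have e1 : eLpNorm (fun z => iteratedFDeriv ℝ m
        (fun z => ((h ^ (-((N : ℝ) * (1 - ρ))) : ℝ) : ℂ) * r h z) z) 2 volume ≤
      ENNReal.ofReal (h ^ (-((N : ℝ) * (1 - ρ)))) *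
        eLpNorm (iteratedFDeriv ℝ m (r h)) 2 volume := by
    refine eLpNorm_le_mul_eLpNorm_of_ae_le_mul (Filter.Eventually.of_forall fun z => ?_) 2
    have e2 := iteratedFDeriv_const_smul_apply (𝕜 := ℝ) (i := m) (x := z)
      (a := h ^ (-((N : ℝ) * (1 - ρ))))
      ((hsm h h0 h1).of_le (by exact_mod_cast le_top) : ContDiff ℝ m (r h)).contDiffAt
    have e3 : (h ^ (-((N : ℝ) * (1 - ρ)))) • r h =
        fun z => ((h ^ (-((N : ℝ) * (1 - ρ))) : ℝ) : ℂ) * r h z :=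
      funext fun z => by rw [Pi.smul_apply, Complex.real_smul]
    rw [e3] at e2
    rw [e2, norm_smul, Real.norm_of_nonneg (by positivity)]
  calc _ ≤ ENNReal.ofReal (h ^ (-(n : ℝ) / 2)) * (ENNReal.ofReal (h ^ (-((N : ℝ) * (1 - ρ)))) *
        ENNReal.ofReal (C * h ^ ((n : ℝ) / 2 + N * (1 - ρ) - ρ * m))) := by
        gcongr
        refine e1.trans ?_
        gcongr
        rw [hr h h0 h1]
        exact hC h h0 h1
    _ = _ := by
        rw [← ENNReal.ofReal_mul (by positivity), ← ENNReal.ofReal_mul (by positivity)]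
        congr 1
        rw [mul_left_comm (h ^ (-((N : ℝ) * (1 - ρ)))), mul_left_comm (h ^ (-(n : ℝ) / 2)),
          ← Real.rpow_add h0, ← Real.rpow_add h0]
        congr 2
        ring

end Diagonal

end WeylL2

end

theorem mainTheorem6 (n k : ℕ) (ρ : ℝ) (hρ0 : 0 ≤ ρ) (hρ1 : ρ < 1)
    (a b : WeylL2.SymbolFamily n) (ha : WeylL2.MemSk k a) (hb : WeylL2.MemSL2 ρ b) :
    ∃ c : WeylL2.SymbolFamily n,
      (∀ h : ℝ, 0 < h → h < 1 →
        ContDiff ℝ ∞ (c h) ∧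
        ∃ A B C : 𝓢(WeylL2.Pos n, ℂ) →L[ℂ] 𝓢(WeylL2.Pos n, ℂ),
          WeylL2.IsWeylQuantization h (a h) A ∧
          WeylL2.IsWeylQuantization h (b h) B ∧
          WeylL2.IsWeylQuantization h (c h) C ∧
          A.comp B = C) ∧
      ∀ N : ℕ, k ≤ N →
        WeylL2.MemPowSL2 ((N : ℝ) * (1 - ρ)) ρ
          (fun h z => c h z - ∑ j ∈ Finset.range N, WeylL2.moyalTerm h j (a h) (b h) z) := by
  obtain ⟨g, hg, hbg⟩ := WeylL2.exists_amplitude_family hb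
  -- The exact symbol of the composition, independent of `N`.
  refine ⟨fun h => WeylL2.tw h (a h) (g h), fun h h0 h1 => ?_, fun N hN => ?_⟩
  · have hG := ha.gam h0 h1
    have hW := hg.1 h h0 h1
    obtain ⟨A, hA, hAg⟩ := WeylL2.quantizable_of_gam h0 hG
    refine ⟨WeylL2.contDiff_tw hG hW h, A, WeylL2.wopCLM h (g h) hW, _, hA, ?_, hAg _ hW, rfl⟩
    rw [hbg h h0 h1]
    exact WeylL2.isWeylQuantization_of_superposition h0 measurable_id hW.integrable
      (fun _ => rfl) (fun _ _ => rfl)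
  -- Here `N ≥ k` enters: S_(k) is contained in S_(N), as the remainder bound requires.
  · refine WeylL2.memPowSL2_rem hρ0 hρ1.le N (ha.mono hN) hg fun h h0 h1 => funext fun z => ?_
    simp only [hbg h h0 h1, WeylL2.rem,
      WeylL2.moyalTerm_syn h _ (ha.1 h h0 h1) (hg.1 h h0 h1)]
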